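/- Let $\mathcal L_{or}$ be the first-order language of ordered rings, with symbols $0,1,<,+,\cdot$ (and equality), interpreted in the ordered ring of real numbers $\mathbb R_0=\langle\mathbb R;0,1,<,+,\cdot\rangle$. A subset of $\mathbb R^k$ is called semialgebraic if it is definable in $\mathbb R_0$ by an $\mathcal L_{or}$-formula without parameters; such a set is represented by any formula defining it, and a real algebraic number $\rho$ is represented by any $\mathcal L_{or}$-formula defining the singleton $\{\rho\}$. Let $k>0$ and $m\ge 0$, let $\varphi$ be an $\mathcal L_{or}$-formula with $k+m+1$ free variables, and let $\rho_1,\ldots,\rho_m$ be positive real algebraic numbers. With $N,n$ ranging over $\mathbb N$, define \[ A=\{(x_1,\ldots,x_k)\in\mathbb R^k \mid \exists N\,\forall n\ge N:\ \varphi(x_1,\ldots,x_k,n,\rho_1^n,\ldots,\rho_m^n)\}, \] \[ B=\{(x_1,\ldots,x_k)\in\mathbb R^k \mid \exists N\,\forall n\ge N:\ \lnot\varphi(x_1,\ldots,x_k,n,\rho_1^n,\ldots,\rho_m^n)\}. \] Then: (a) $A\cup B=\mathbb R^k$. (b) $A$ and $B$ are semialgebraic, and representations of them can be computed effectively: there is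 a single algorithm that, given $k$, any such $\varphi$ and representations of any such $\rho_1,\ldots,\rho_m$, outputs formulas defining $A$ and $B$. (c) There is a single algorithm that, given $k$, any such $\varphi$, representations of any such $\rho_1,\ldots,\rho_m$, and any $x=(x_1,\ldots,x_k)\in B\cap\mathbb Q^k$, outputs an $N\in\mathbb N$ such that for all $n\ge N$, $\varphi(x_1,\ldots,x_k,n,\rho_1^n,\ldots,\rho_m^n)$ does not hold. -/

import Mathlib

namespace OrderedRings

/-- The function symbols `0`, `1`, `+`, `·` of the language of ordered rings. -/
inductive Func : ℕ → Type
  | zero : Func 0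
  | one : Func 0
  | add : Func 2
  | mul : Func 2

/-- The relation symbol `<` of the language of ordered rings (equality is a logical symbol). -/
inductive Rel : ℕ → Type
  | lt : Rel 2

/-- The first-order language of ordered rings, with symbols `0`, `1`, `<`, `+`, `·`. -/
abbrev Lor : FirstOrder.Language.{0, 0} := ⟨Func, Rel⟩

/-- The ordered ring of real numbers, as a structure for the language of ordered rings. -/
noncomputable instance realStructure : Lor.Structure ℝ where
  funMap {_} f v :=
    match f, v with
    | Func.zero, _ => 0
    | Func.one, _ => 1
    | Func.add, v => v 0 + v 1
    | Func.mul, v => v 0 * v 1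
  RelMap {_} r v :=
    match r, v with
    | Rel.lt, v => v 0 < v 1

/-- A set is semialgebraic if it is definable, without parameters, in the ordered ring `ℝ`. -/
def IsSemialgebraic {k : ℕ} (S : Set (Fin k → ℝ)) : Prop :=
  (∅ : Set ℝ).Definable Lor S

/-- The subset of `ℝ^k` defined by a formula with free variables among `x_0, …, x_{k-1}`. -/
def definedSet {k : ℕ} (φ : Lor.Formula (Fin k)) : Set (Fin k → ℝ) :=
  {x | φ.Realize x}

/-- `χ` represents the real number `r`: it defines the singleton `{r}`. -/
def Represents (χ : Lor.Formula (Fin 1)) (r : ℝ) : Prop :=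
  definedSet χ = {fun _ => r}

/-- Gödel number of a term whose free variables are indexed by `Fin p`
and whose bound variables are indexed by `Fin n`. -/
def termCode {p n : ℕ} : Lor.Term (Fin p ⊕ Fin n) → ℕ
  | .var (.inl i) => Nat.pair 0 i
  | .var (.inr j) => Nat.pair 1 j
  | .func Func.zero _ => Nat.pair 2 0
  | .func Func.one _ => Nat.pair 3 0
  | .func Func.add ts => Nat.pair 4 (Nat.pair (termCode (ts 0)) (termCode (ts 1)))
  | .func Func.mul ts => Nat.pair 5 (Nat.pair (termCode (ts 0)) (termCode (ts 1)))

/-- Gödel number of a formula. The primitives are those of Mathlib's first-order logic: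
falsum, equality, `<`, implication and universal quantification. -/
def code {p : ℕ} : {n : ℕ} → Lor.BoundedFormula (Fin p) n → ℕ
  | _, .falsum => Nat.pair 0 0
  | _, .equal t s => Nat.pair 1 (Nat.pair (termCode t) (termCode s))
  | _, .rel Rel.lt ts => Nat.pair 2 (Nat.pair (termCode (ts 0)) (termCode (ts 1)))
  | _, .imp φ ψ => Nat.pair 3 (Nat.pair (code φ) (code ψ))
  | _, .all φ => Nat.pair 4 (code φ)

theorem termCode_injective {p n : ℕ} :
    Function.Injective (termCode : Lor.Term (Fin p ⊕ Fin n) → ℕ) := by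
  intro t
  induction t with
  | var v =>
    rintro (w | ⟨f, us⟩) h
    · rcases v with v | v <;> rcases w with w | w <;>
        simp_all [termCode, Nat.pair_eq_pair, Fin.ext_iff]
    · cases f <;> rcases v with v | v <;> simp [termCode, Nat.pair_eq_pair] at h
  | func f ts ih =>
    rintro (w | ⟨g, us⟩) h
    · cases f <;> rcases w with w | w <;> simp [termCode, Nat.pair_eq_pair] at h
    · cases f <;> cases g <;> simp [termCode, Nat.pair_eq_pair] at h ⊢
      · exact Subsingleton.elim _ _
      · exact Subsingleton.elim _ _
      · ext i
        fin_cases i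
        · exact ih 0 h.1
        · exact ih 1 h.2
      · ext i
        fin_cases i
        · exact ih 0 h.1
        · exact ih 1 h.2

/-- A formula is determined by its Gödel number. -/
theorem code_injective {p n : ℕ} :
    Function.Injective (code : Lor.BoundedFormula (Fin p) n → ℕ) := by
  intro φ
  induction φ with
  | falsum =>
    intro ψ h
    cases ψ with
    | rel R us => cases R; simp [code, Nat.pair_eq_pair] at h
    | _ => simp_all [code, Nat.pair_eq_pair]
  | equal t s =>
    intro ψ h
    cases ψ with
    | rel R us => cases R; simp [code, Nat.pair_eq_pair] at h
    | equal t' s' =>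
      simp only [code, Nat.pair_eq_pair, true_and] at h
      rw [termCode_injective h.1, termCode_injective h.2]
    | _ => simp [code, Nat.pair_eq_pair] at h
  | rel R ts =>
    intro ψ h
    cases R
    cases ψ with
    | rel R us =>
      cases R
      simp only [code, Nat.pair_eq_pair, true_and] at h
      congr 1
      ext i
      fin_cases i
      · exact termCode_injective h.1
      · exact termCode_injective h.2
    | _ => simp [code, Nat.pair_eq_pair] at h
  | imp a b iha ihb =>
    intro ψ h
    cases ψ with
    | rel R us => cases R; simp [code, Nat.pair_eq_pair] at h
    | imp a' b' =>
      simp only [code, Nat.pair_eq_pair, true_and] at h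
      rw [iha h.1, ihb h.2]
    | _ => simp [code, Nat.pair_eq_pair] at h
  | all a iha =>
    intro ψ h
    cases ψ with
    | rel R us => cases R; simp [code, Nat.pair_eq_pair] at h
    | all a' =>
      simp only [code, Nat.pair_eq_pair, true_and] at h
      rw [iha h]
    | _ => simp [code, Nat.pair_eq_pair] at h

/-- The assertion `φ(x_1, …, x_k, n, ρ_1^n, …, ρ_m^n)` over the real numbers. -/
def HoldsAt {k m : ℕ} (φ : Lor.Formula (Fin (k + (m + 1)))) (ρ : Fin m → ℝ)
    (x : Fin k → ℝ) (n : ℕ) : Prop :=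
  φ.Realize (Fin.append x (Fin.cons (n : ℝ) fun i => ρ i ^ n))

/-- The set of `x` for which `φ(x, n, ρ_1^n, …, ρ_m^n)` holds for all large `n`. -/
def eventuallyTrue {k m : ℕ} (φ : Lor.Formula (Fin (k + (m + 1)))) (ρ : Fin m → ℝ) :
    Set (Fin k → ℝ) :=
  {x | ∃ N : ℕ, ∀ n ≥ N, HoldsAt φ ρ x n}

/-- The set of `x` for which `φ(x, n, ρ_1^n, …, ρ_m^n)` fails for all large `n`. -/
def eventuallyFalse {k m : ℕ} (φ : Lor.Formula (Fin (k + (m + 1)))) (ρ : Fin m → ℝ) :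
    Set (Fin k → ℝ) :=
  {x | ∃ N : ℕ, ∀ n ≥ N, ¬ HoldsAt φ ρ x n}

/-- The finite data handed to an algorithm: the number `k`, the Gödel number of `φ`, and the list
of the Gödel numbers of formulas representing `ρ_1, …, ρ_m`. -/
def input {k m : ℕ} (φ : Lor.Formula (Fin (k + (m + 1)))) (χ : Fin m → Lor.Formula (Fin 1)) :
    ℕ × ℕ × List ℕ :=
  (k, code φ, List.ofFn fun i => code (χ i))

/-- A rational vector as a list of pairs (numerator, denominator). -/
def ratInput {k : ℕ} (x : Fin k → ℚ) : List (ℤ × ℕ) :=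
  List.ofFn fun i => ((x i).num, (x i).den)

end OrderedRings

set_option linter.unusedSectionVars false

/-! Fix `x`. A polynomial in `x, n, ρ_1^n, …, ρ_m^n` is a finite sum of terms `c(x) n^a μ^n`, where
`μ` is a monomial in the `ρ_i`. When the pairs `(μ, a)` are ordered lexicographically, the largest
one whose total coefficient does not vanish decides the sign for all large `n`. The truth value of
`φ` depends only on the signs of finitely many integer polynomials (`exists_decidedBy`), so it is
constant for large `n`; this gives (a).

For definability, "`n` is large" is replaced by a first-order condition. `Dominated` says of a point
`(t, y)` and some `ε` that `t > 1`, `εt > 1`, `y > 0`, that `t^a y^b < ε y^b'` whenever `ρ^b <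
ρ^b'`, and that `y^b = y^b'` whenever `ρ^b = ρ^b'`, for a finite list `T` of comparisons which does
not depend on `x`. For each `x` and a suitable `ε > 0`, `φ` has one truth value on all dominated
points (`exists_dominated_const`), and `(n, ρ^n)` is dominated for large `n`
(`eventually_dominated`). Hence `A` consists of the `x` for which some `ε > 0` makes `φ` true on all
dominated points. This is first-order in `x` and `ρ`, and `ρ` is removed by means of its defining
formulas. For (c), domination also passes from `(t, y)` to `(t + 1, ρy)` once `t` is large
(`eventually_dominated_succ`), so one sentence can certify a threshold `N`, and induction on `n`
does the rest.

The algorithms guess an output and verify it. Correctness of an output is implied by the truth in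
`ℝ` of a sentence computed from the input and the guess (`setsSentence`, `thresholdSentence`), so it
suffices to enumerate the true sentences. The axioms are those of ordered fields together with the
intermediate and mean value theorems for polynomials. Any two models agree on sentences
(`sat_iff_of_models`), by elimination in the style of Cohen and Hörmander: derivatives and
pseudo-remainders build matching sign diagrams of a finite family of polynomials in two fields at
once. No proof calculus is needed. Truth is axiomatized by propositional clauses about Henkin
constants (`clauses`); a valuation satisfying them yields a model (`Model`), and `ℝ` yields such a
valuation (`isModel_realVal`). By compactness of Cantor space a true sentence has a finite
refutation of its negation, which is recognized by a primitive recursive test (`refutes`).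

Formulas are handled as numbers throughout. `sat` gives every number a meaning in every structure,
so it applies to the Henkin model before that is known to be a field. -/

namespace OrderedRings

/-! ### Semantics of codes

Every natural number is read as a term code and as a formula code, evaluated at a list of elements.
-/

section Semantics

variable {K : Type} [Zero K] [One K] [Add K] [Mul K]

/-- Value of the term with code `t` at the list `e`, the first `p` entries being the free variables. -/
def tval (p : ℕ) (e : List K) (t : ℕ) : K :=
  match h : t.unpair with
  | (0, i) => e.getD i 0
  | (1, j) => e.getD (p + j) 0
  | (2, _) => 0
  | (3, _) => 1
  | (4, x) =>
    have : x < t := by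
      have := Nat.pair_unpair t
      rw [h] at this; rw [← this]
      exact lt_of_lt_of_le (by omega) (Nat.add_le_pair _ _)
    have := Nat.unpair_left_le x
    have := Nat.unpair_right_le x
    tval p e x.unpair.1 + tval p e x.unpair.2
  | (5, x) =>
    have : x < t := by
      have := Nat.pair_unpair t
      rw [h] at this; rw [← this]
      exact lt_of_lt_of_le (by omega) (Nat.add_le_pair _ _)
    have := Nat.unpair_left_le x
    have := Nat.unpair_right_le x
    tval p e x.unpair.1 * tval p e x.unpair.2
  | _ => 0
termination_by t
decreasing_by all_goals omega

variable {p : ℕ} {e : List K}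

theorem tval_free (i : ℕ) : tval p e (Nat.pair 0 i) = e.getD i 0 := by
  rw [tval]; split <;> rename_i h <;> rw [Nat.unpair_pair] at h <;> simp_all

theorem tval_bound (i : ℕ) : tval p e (Nat.pair 1 i) = e.getD (p + i) 0 := by
  rw [tval]; split <;> rename_i h <;> rw [Nat.unpair_pair] at h <;> simp_all

theorem tval_zero (i : ℕ) : tval p e (Nat.pair 2 i) = 0 := by
  rw [tval]; split <;> rename_i h <;> rw [Nat.unpair_pair] at h <;> simp_all

theorem tval_one (i : ℕ) : tval p e (Nat.pair 3 i) = 1 := by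
  rw [tval]; split <;> rename_i h <;> rw [Nat.unpair_pair] at h <;> simp_all

theorem tval_add (s t : ℕ) :
    tval p e (Nat.pair 4 (Nat.pair s t)) = tval p e s + tval p e t := by
  rw [tval]; split <;> rename_i h <;> rw [Nat.unpair_pair] at h <;> simp_all
  rw [← h]; simp

theorem tval_mul (s t : ℕ) :
    tval p e (Nat.pair 5 (Nat.pair s t)) = tval p e s * tval p e t := by
  rw [tval]; split <;> rename_i h <;> rw [Nat.unpair_pair] at h <;> simp_all
  rw [← h]; simp

theorem tval_other (k x : ℕ) : tval p e (Nat.pair (k + 6) x) = 0 := by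
  rw [tval]; split <;> rename_i h <;> rw [Nat.unpair_pair] at h <;> simp_all

variable [LT K]

/-- Truth of the formula with code `φ` at the list `e`. Besides the tags of `code`, tag `5` evaluates
a formula at a list of entries of `e`. -/
def sat (φ : ℕ) (p : ℕ) (e : List K) : Prop :=
  match h : φ.unpair with
  | (0, _) => False
  | (1, x) => tval p e x.unpair.1 = tval p e x.unpair.2
  | (2, x) => tval p e x.unpair.1 < tval p e x.unpair.2
  | (3, x) =>
    have : x < φ := by
      have := Nat.pair_unpair φ
      rw [h] at this; rw [← this]
      exact lt_of_lt_of_le (by omega) (Nat.add_le_pair _ _)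
    have := Nat.unpair_left_le x
    have := Nat.unpair_right_le x
    sat x.unpair.1 p e → sat x.unpair.2 p e
  | (4, x) =>
    have : x < φ := by
      have := Nat.pair_unpair φ
      rw [h] at this; rw [← this]
      exact lt_of_lt_of_le (by omega) (Nat.add_le_pair _ _)
    ∀ c : K, sat x p (e ++ [c])
  | (5, x) =>
    have : x < φ := by
      have := Nat.pair_unpair φ
      rw [h] at this; rw [← this]
      exact lt_of_lt_of_le (by omega) (Nat.add_le_pair _ _)
    have := Nat.unpair_right_le x
    have := Nat.unpair_left_le x.unpair.2
    sat x.unpair.2.unpair.1 x.unpair.1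
      ((Denumerable.ofNat (List ℕ) x.unpair.2.unpair.2).map fun i => e.getD i 0)
  | _ => False
termination_by φ
decreasing_by all_goals omega

theorem sat_falsum (i : ℕ) : ¬ sat (Nat.pair 0 i) p e := by
  rw [sat]; split <;> rename_i h <;> rw [Nat.unpair_pair] at h <;> simp_all

theorem sat_equal (s t : ℕ) :
    sat (Nat.pair 1 (Nat.pair s t)) p e ↔ tval p e s = tval p e t := by
  rw [sat]; split <;> rename_i h <;> rw [Nat.unpair_pair] at h <;> simp_all
  rw [← h]; simp

theorem sat_lt (s t : ℕ) :
    sat (Nat.pair 2 (Nat.pair s t)) p e ↔ tval p e s < tval p e t := by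
  rw [sat]; split <;> rename_i h <;> rw [Nat.unpair_pair] at h <;> simp_all
  rw [← h]; simp

theorem sat_imp (φ ψ : ℕ) :
    sat (Nat.pair 3 (Nat.pair φ ψ)) p e ↔ (sat φ p e → sat ψ p e) := by
  rw [sat]; split <;> rename_i h <;> rw [Nat.unpair_pair] at h <;> simp_all
  rw [← h]; simp

theorem sat_all (φ : ℕ) :
    sat (Nat.pair 4 φ) p e ↔ ∀ c : K, sat φ p (e ++ [c]) := by
  rw [sat]; split <;> rename_i h <;> rw [Nat.unpair_pair] at h <;> simp_all

theorem sat_call (q ψ : ℕ) (l : List ℕ) :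
    sat (Nat.pair 5 (Nat.pair q (Nat.pair ψ (Encodable.encode l)))) p e ↔
      sat ψ q (l.map fun i => e.getD i 0) := by
  rw [sat]; split <;> rename_i h <;> rw [Nat.unpair_pair] at h <;> simp_all
  rw [← h]; simp

theorem sat_other (k x : ℕ) : ¬ sat (Nat.pair (k + 6) x) p e := by
  rw [sat]; split <;> rename_i h <;> rw [Nat.unpair_pair] at h <;> simp_all

end Semantics

theorem lt_pair_right {a b : ℕ} (h : a ≠ 0) : b < Nat.pair a b :=
  lt_of_lt_of_le (by omega) (Nat.add_le_pair _ _)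

/-- Induction over term codes. -/
theorem termCode_induction {P : ℕ → Prop} (free : ∀ i, P (Nat.pair 0 i))
    (bound : ∀ i, P (Nat.pair 1 i)) (zero : ∀ i, P (Nat.pair 2 i)) (one : ∀ i, P (Nat.pair 3 i))
    (add : ∀ s t, P s → P t → P (Nat.pair 4 (Nat.pair s t)))
    (mul : ∀ s t, P s → P t → P (Nat.pair 5 (Nat.pair s t)))
    (other : ∀ k x, P (Nat.pair (k + 6) x)) (n : ℕ) : P n := by
  induction n using Nat.strong_induction_on with
  | _ n ih =>
    obtain ⟨a, b, rfl⟩ : ∃ a b, n = Nat.pair a b := ⟨_, _, (Nat.pair_unpair n).symm⟩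
    have hs : ∀ s t, s ≤ Nat.pair s t ∧ t ≤ Nat.pair s t := fun s t =>
      ⟨Nat.left_le_pair s t, Nat.right_le_pair s t⟩
    match a, ih with
    | 0, _ => exact free b
    | 1, _ => exact bound b
    | 2, _ => exact zero b
    | 3, _ => exact one b
    | 4, ih =>
      obtain ⟨s, t, rfl⟩ : ∃ s t, b = Nat.pair s t := ⟨_, _, (Nat.pair_unpair b).symm⟩
      have := lt_pair_right (a := 4) (b := Nat.pair s t) (by simp)
      exact add s t (ih _ (by linarith [hs s t])) (ih _ (by linarith [hs s t]))
    | 5, ih =>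
      obtain ⟨s, t, rfl⟩ : ∃ s t, b = Nat.pair s t := ⟨_, _, (Nat.pair_unpair b).symm⟩
      have := lt_pair_right (a := 5) (b := Nat.pair s t) (by simp)
      exact mul s t (ih _ (by linarith [hs s t])) (ih _ (by linarith [hs s t]))
    | k + 6, _ => exact other k b

/-- Induction over formula codes. -/
theorem code_induction {P : ℕ → Prop} (falsum : ∀ i, P (Nat.pair 0 i))
    (equal : ∀ s t, P (Nat.pair 1 (Nat.pair s t))) (lt : ∀ s t, P (Nat.pair 2 (Nat.pair s t)))
    (imp : ∀ φ ψ, P φ → P ψ → P (Nat.pair 3 (Nat.pair φ ψ)))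
    (all : ∀ φ, P φ → P (Nat.pair 4 φ))
    (call : ∀ q ψ (l : List ℕ), P ψ →
      P (Nat.pair 5 (Nat.pair q (Nat.pair ψ (Encodable.encode l)))))
    (other : ∀ k x, P (Nat.pair (k + 6) x)) (n : ℕ) : P n := by
  induction n using Nat.strong_induction_on with
  | _ n ih =>
    obtain ⟨a, b, rfl⟩ : ∃ a b, n = Nat.pair a b := ⟨_, _, (Nat.pair_unpair n).symm⟩
    obtain ⟨s, t, rfl⟩ : ∃ s t, b = Nat.pair s t := ⟨_, _, (Nat.pair_unpair b).symm⟩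
    have hs : ∀ s t, s ≤ Nat.pair s t ∧ t ≤ Nat.pair s t := fun s t =>
      ⟨Nat.left_le_pair s t, Nat.right_le_pair s t⟩
    match a, ih with
    | 0, _ => exact falsum _
    | 1, _ => exact equal _ _
    | 2, _ => exact lt _ _
    | 3, ih =>
      have := lt_pair_right (a := 3) (b := Nat.pair s t) (by simp)
      exact imp s t (ih _ (by linarith [hs s t])) (ih _ (by linarith [hs s t]))
    | 4, ih => exact all _ (ih _ (lt_pair_right (by simp)))
    | 5, ih =>
      obtain ⟨ψ, l, rfl⟩ : ∃ a b, t = Nat.pair a b := ⟨_, _, (Nat.pair_unpair t).symm⟩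
      obtain ⟨l, rfl⟩ : ∃ l' : List ℕ, l = Encodable.encode l' :=
        ⟨Denumerable.ofNat _ l, by simp⟩
      have h1 := lt_pair_right (a := 5) (b := Nat.pair s (Nat.pair ψ (Encodable.encode l)))
        (by simp)
      have h2 := hs s (Nat.pair ψ (Encodable.encode l))
      have h3 := hs ψ (Encodable.encode l)
      exact call s ψ l (ih _ (by omega))
    | k + 6, _ => exact other k _

theorem tval_termCode {p n : ℕ} (t : Lor.Term (Fin p ⊕ Fin n)) (v : Fin p → ℝ) (xs : Fin n → ℝ) :
    tval p (List.ofFn v ++ List.ofFn xs) (termCode t) = t.realize (Sum.elim v xs) := by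
  induction t with
  | var w =>
    rcases w with i | j
    · simp only [termCode, tval_free, FirstOrder.Language.Term.realize, Sum.elim_inl]
      rw [List.getD_append _ _ _ _ (by simp)]; simp
    · simp only [termCode, tval_bound, FirstOrder.Language.Term.realize, Sum.elim_inr]
      rw [List.getD_append_right _ _ _ _ (by simp)]; simp
  | func f ts ih =>
    cases f <;> simp only [termCode, tval_zero, tval_one, tval_add, tval_mul, ih] <;> rfl

/-- On codes of formulas, `sat` is Mathlib's notion of realization. -/
theorem sat_code {p n : ℕ} (φ : Lor.BoundedFormula (Fin p) n) (v : Fin p → ℝ) (xs : Fin n → ℝ) :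
    sat (code φ) p (List.ofFn v ++ List.ofFn xs) ↔ φ.Realize v xs := by
  induction φ with
  | falsum => simp [code, sat_falsum, FirstOrder.Language.BoundedFormula.Realize]
  | equal t s =>
    simp [code, sat_equal, FirstOrder.Language.BoundedFormula.Realize, tval_termCode]
  | rel R ts =>
    cases R
    simp only [code, sat_lt, FirstOrder.Language.BoundedFormula.Realize, tval_termCode]
    rfl
  | imp a b iha ihb =>
    simp [code, sat_imp, FirstOrder.Language.BoundedFormula.Realize, iha, ihb]
  | all a iha =>
    simp only [code, sat_all, FirstOrder.Language.BoundedFormula.Realize]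
    refine forall_congr' fun c => ?_
    rw [← iha, List.append_assoc, List.ofFn_succ_last]
    simp

theorem sat_code_formula {p : ℕ} (φ : Lor.Formula (Fin p)) (v : Fin p → ℝ) :
    sat (code φ) p (List.ofFn v) ↔ φ.Realize v := by
  have := sat_code φ v default
  rw [List.ofFn_zero, List.append_nil] at this
  rw [this, FirstOrder.Language.Formula.Realize, Subsingleton.elim (default : Fin 0 → ℝ)]

end OrderedRings

namespace OrderedRings

open Polynomial

/-! ### Sign diagrams of families of polynomials over two fields -/

/-- Ordered fields whose polynomials satisfy the intermediate value theorem and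
the mean value theorem. -/
class PolynomialIVT (K : Type) [Field K] [LinearOrder K] [IsStrictOrderedRing K] : Prop where
  ivt : ∀ (P : K[X]) (a b : K), a < b → P.eval a < 0 → 0 < P.eval b →
    ∃ c, a < c ∧ c < b ∧ P.eval c = 0
  mvt : ∀ (P : K[X]) (a b : K), a < b →
    ∃ c, a < c ∧ c < b ∧ P.eval b - P.eval a = P.derivative.eval c * (b - a)

/-! ### Signs near infinity and monotonicity away from critical points, in one field. -/

section OneField

variable {K : Type} [Field K] [LinearOrder K] [IsStrictOrderedRing K]

/-- Induction through `P = divX P * X + P(0)`: once the quotient exceeds 1 and `x ≥ 1`, the value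
exceeds `x + P(0)`. The field is an arbitrary ordered field, so no limits are available. -/
theorem exists_forall_eval_gt (n : ℕ) : ∀ P : K[X], P.natDegree = n + 1 → 0 < P.leadingCoeff →
    ∀ B : K, ∃ M : K, ∀ x, M ≤ x → B < P.eval x := by
  induction n with
  | zero =>
    intro P hd hl B
    have hP : ∀ x, P.eval x = P.leadingCoeff * x + P.coeff 0 := by
      intro x
      rw [leadingCoeff, hd, eval_eq_sum_range, hd]
      simp [Finset.sum_range_succ]; ring
    refine ⟨(B - P.coeff 0) / P.leadingCoeff + 1, fun x hx => ?_⟩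
    rw [hP]
    have : (B - P.coeff 0) / P.leadingCoeff < x := by linarith
    rw [div_lt_iff₀ hl] at this
    linarith
  | succ n ih =>
    intro P hd hl B
    have h1 : P.divX.natDegree = n + 1 := by rw [natDegree_divX_eq_natDegree_tsub_one, hd]; rfl
    have h2 : P.divX.leadingCoeff = P.leadingCoeff := by
      rw [leadingCoeff, leadingCoeff, h1, hd, coeff_divX]
    obtain ⟨M, hM⟩ := ih P.divX h1 (h2 ▸ hl) 1
    refine ⟨max M (max 1 (B - P.coeff 0 + 1)), fun x hx => ?_⟩
    have hx1 : M ≤ x := (le_max_left _ _).trans hx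
    have hx2 : 1 ≤ x := (le_max_left _ _).trans ((le_max_right _ _).trans hx)
    have hx3 : B - P.coeff 0 + 1 ≤ x := (le_max_right _ _).trans ((le_max_right _ _).trans hx)
    have hE : P.eval x = P.divX.eval x * x + P.coeff 0 := by
      conv_lhs => rw [← divX_mul_X_add P]
      simp
    rw [hE]
    nlinarith [hM x hx1]

theorem exists_sign_eval_eq (P : K[X]) (hd : P.natDegree ≠ 0) :
    ∃ M : K, ∀ x, M ≤ x → SignType.sign (P.eval x) = SignType.sign P.leadingCoeff := by
  obtain ⟨n, hn⟩ := Nat.exists_eq_succ_of_ne_zero hd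
  have hP : P ≠ 0 := by rintro rfl; simp at hd
  rcases lt_or_gt_of_ne (leadingCoeff_ne_zero.2 hP) with h | h
  · obtain ⟨M, hM⟩ := exists_forall_eval_gt n (-P) (by rw [natDegree_neg, hn])
      (by rw [leadingCoeff_neg]; linarith) 0
    refine ⟨M, fun x hx => ?_⟩
    have := hM x hx
    rw [eval_neg] at this
    rw [sign_neg h, sign_neg (by linarith)]
  · obtain ⟨M, hM⟩ := exists_forall_eval_gt n P hn h 0
    exact ⟨M, fun x hx => by rw [sign_pos h, sign_pos (hM x hx)]⟩

theorem exists_sign_eval_eq_neg (P : K[X]) (hd : P.natDegree ≠ 0) :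
    ∃ M : K, ∀ x, x ≤ -M → SignType.sign (P.eval x) =
      SignType.sign (P.leadingCoeff * (-1) ^ P.natDegree) := by
  have hd' : (P.comp (-X)).natDegree = P.natDegree := by
    rw [natDegree_comp]; simp
  obtain ⟨M, hM⟩ := exists_sign_eval_eq (P.comp (-X)) (hd'.symm ▸ hd)
  refine ⟨M, fun x hx => ?_⟩
  have := hM (-x) (by linarith)
  rw [leadingCoeff_comp (by simp)] at this
  simpa using this

variable [PolynomialIVT K]

theorem sign_eval_eq_of_ne_zero (P : K[X]) {x y : K} (hxy : x ≤ y)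
    (h : ∀ z, x ≤ z → z ≤ y → P.eval z ≠ 0) :
    SignType.sign (P.eval x) = SignType.sign (P.eval y) := by
  rcases hxy.eq_or_lt with rfl | hlt
  · rfl
  rcases lt_or_gt_of_ne (h x le_rfl hxy) with h1 | h1 <;>
    rcases lt_or_gt_of_ne (h y hxy le_rfl) with h2 | h2
  · rw [sign_neg h1, sign_neg h2]
  · obtain ⟨c, h3, h4, h5⟩ := PolynomialIVT.ivt P x y hlt h1 h2
    exact absurd h5 (h c h3.le h4.le)
  · obtain ⟨c, h3, h4, h5⟩ := PolynomialIVT.ivt (-P) x y hlt (by simpa) (by simpa)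
    exact absurd (by simpa using h5) (h c h3.le h4.le)
  · rw [sign_pos h1, sign_pos h2]

/-- A derivative without zeros on the open interval keeps its sign there, by the intermediate value
property. The mean value point is interior, so `u` and `w` may be the end points. -/
theorem eval_lt_eval_of_derivative {P : K[X]} {a b x : K} (ha : a < x) (hb : x < b)
    (h : ∀ z, a < z → z < b → P.derivative.eval z ≠ 0) (hx : 0 < P.derivative.eval x)
    {u w : K} (hu : a ≤ u) (huw : u < w) (hw : w ≤ b) : P.eval u < P.eval w := by
  obtain ⟨c, h1, h2, h3⟩ := PolynomialIVT.mvt P u w huw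
  have hc : 0 < P.derivative.eval c := by
    have : SignType.sign (P.derivative.eval c) = SignType.sign (P.derivative.eval x) := by
      rcases le_total c x with hcx | hcx
      · exact sign_eval_eq_of_ne_zero _ hcx fun z h4 h5 => h z (by linarith) (by linarith)
      · exact (sign_eval_eq_of_ne_zero _ hcx fun z h4 h5 => h z (by linarith) (by linarith)).symm
    rwa [sign_pos hx, sign_eq_one_iff] at this
  have := mul_pos hc (sub_pos.2 huw)
  linarith

end OneField

/-! ### Two polynomials over two fields, between consecutive points of a diagram. -/

section Gap

variable {K : Type} [Field K] [LinearOrder K] [IsStrictOrderedRing K] [PolynomialIVT K]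
  {L : Type} [Field L] [LinearOrder L] [IsStrictOrderedRing L] [PolynomialIVT L]

theorem sign_pos_iff_of_sign_eq {x : K} {y : L} (h : SignType.sign x = SignType.sign y) :
    0 < x ↔ 0 < y := by rw [← sign_eq_one_iff, h, sign_eq_one_iff]

theorem sign_neg_iff_of_sign_eq {x : K} {y : L} (h : SignType.sign x = SignType.sign y) :
    x < 0 ↔ y < 0 := by rw [← sign_eq_neg_one_iff, h, sign_eq_neg_one_iff]

theorem sign_zero_iff_of_sign_eq {x : K} {y : L} (h : SignType.sign x = SignType.sign y) :
    x = 0 ↔ y = 0 := by rw [← sign_eq_zero_iff, h, sign_eq_zero_iff]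

/-- An interior zero of an increasing `P` forces `P(a) < 0 < P(b)`. These signs transfer to `Q` at
`a'` and `b'`, where the intermediate value property applies. -/
theorem exists_root_of_increasing {P : K[X]} {Q : L[X]} {a b : K} {a' b' : L} (hab' : a' < b')
    (hP : ∀ u w, a ≤ u → u < w → w ≤ b → P.eval u < P.eval w)
    (ha : SignType.sign (P.eval a) = SignType.sign (Q.eval a'))
    (hb : SignType.sign (P.eval b) = SignType.sign (Q.eval b'))
    {z : K} (h1 : a < z) (h2 : z < b) (hz : P.eval z = 0) :
    ∃ z', a' < z' ∧ z' < b' ∧ Q.eval z' = 0 := by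
  have h3 := hP a z le_rfl h1 h2.le
  have h4 := hP z b h1.le h2 le_rfl
  rw [hz] at h3 h4
  exact PolynomialIVT.ivt Q a' b' hab' ((sign_neg_iff_of_sign_eq ha).1 h3)
    ((sign_pos_iff_of_sign_eq hb).1 h4)

/-- If `Q(y) < 0`, then `Q` has a zero to the right of `y`, because `Q(b') > 0`. The corresponding
zero of `P` then lies to the right of `x`, which is impossible since `P` increases and is already
positive at `x`. -/
theorem not_neg_of_increasing {P : K[X]} {Q : L[X]} {a b : K} {a' b' : L} (hab : a < b)
    (hP : ∀ u w, a ≤ u → u < w → w ≤ b → P.eval u < P.eval w)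
    (hQ : ∀ u w, a' ≤ u → u < w → w ≤ b' → Q.eval u < Q.eval w)
    (ha : SignType.sign (P.eval a) = SignType.sign (Q.eval a'))
    (hb : SignType.sign (P.eval b) = SignType.sign (Q.eval b'))
    {x : K} {y : L} (hx1 : a < x) (hx2 : x < b) (hy1 : a' < y) (hy2 : y < b')
    (hxy : ∀ z z', a < z → z < b → a' < z' → z' < b' → P.eval z = 0 → Q.eval z' = 0 →
      (x < z ↔ y < z')) (h1 : 0 < P.eval x) : ¬ Q.eval y < 0 := by
  intro h2
  have h3 := (sign_pos_iff_of_sign_eq hb).1 (h1.trans (hP x b hx1.le hx2 le_rfl))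
  obtain ⟨z', h4, h5, h6⟩ := PolynomialIVT.ivt Q y b' hy2 h2 h3
  obtain ⟨z, h7, h8, h9⟩ := exists_root_of_increasing hab hQ ha.symm hb.symm
    (hy1.trans h4) h5 h6
  have h10 := hP x z hx1.le ((hxy z z' h7 h8 (hy1.trans h4) h5 h9 h6).2 h4) h8.le
  linarith

/-- Comparison of two polynomials on two intervals on which their derivatives have no zero. -/
structure GapPair (P : K[X]) (Q : L[X]) (a b : K) (a' b' : L) : Prop where
  lt_left : a < b
  lt_right : a' < b'
  sign_a : SignType.sign (P.eval a) = SignType.sign (Q.eval a')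
  sign_b : SignType.sign (P.eval b) = SignType.sign (Q.eval b')
  left_ne : ∀ z, a < z → z < b → P.derivative.eval z ≠ 0
  right_ne : ∀ z, a' < z → z < b' → Q.derivative.eval z ≠ 0
  sign_derivative : ∀ x y, a < x → x < b → a' < y → y < b' →
    SignType.sign (P.derivative.eval x) = SignType.sign (Q.derivative.eval y)

theorem GapPair.neg {P : K[X]} {Q : L[X]} {a b : K} {a' b' : L} (h : GapPair P Q a b a' b') :
    GapPair (-P) (-Q) a b a' b' where
  lt_left := h.lt_left
  lt_right := h.lt_right
  sign_a := by simp [Left.sign_neg, h.sign_a]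
  sign_b := by simp [Left.sign_neg, h.sign_b]
  left_ne := by simpa using h.left_ne
  right_ne := by simpa using h.right_ne
  sign_derivative x y h1 h2 h3 h4 := by
    simp [Left.sign_neg, h.sign_derivative x y h1 h2 h3 h4]

theorem GapPair.symm {P : K[X]} {Q : L[X]} {a b : K} {a' b' : L} (h : GapPair P Q a b a' b') :
    GapPair Q P a' b' a b where
  lt_left := h.lt_right
  lt_right := h.lt_left
  sign_a := h.sign_a.symm
  sign_b := h.sign_b.symm
  left_ne := h.right_ne
  right_ne := h.left_ne
  sign_derivative x y h1 h2 h3 h4 := (h.sign_derivative y x h3 h4 h1 h2).symm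

/-- Up to a common sign, both polynomials of a gap pair increase. -/
theorem GapPair.increasing {P : K[X]} {Q : L[X]} {a b : K} {a' b' : L}
    (h : GapPair P Q a b a' b') :
    ((∀ u w, a ≤ u → u < w → w ≤ b → P.eval u < P.eval w) ∧
      (∀ u w, a' ≤ u → u < w → w ≤ b' → Q.eval u < Q.eval w)) ∨
    ((∀ u w, a ≤ u → u < w → w ≤ b → (-P).eval u < (-P).eval w) ∧
      (∀ u w, a' ≤ u → u < w → w ≤ b' → (-Q).eval u < (-Q).eval w)) := by
  obtain ⟨x, hx1, hx2⟩ := exists_between h.lt_left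
  obtain ⟨y, hy1, hy2⟩ := exists_between h.lt_right
  have hs := h.sign_derivative x y hx1 hx2 hy1 hy2
  rcases lt_or_gt_of_ne (h.left_ne x hx1 hx2) with h1 | h1
  · right
    have h' := h.neg
    have h2 := (sign_neg_iff_of_sign_eq hs).1 h1
    exact ⟨fun u w hu huw hw => eval_lt_eval_of_derivative hx1 hx2 h'.left_ne (by simpa) hu huw hw,
      fun u w hu huw hw => eval_lt_eval_of_derivative hy1 hy2 h'.right_ne (by simpa) hu huw hw⟩
  · left
    have h2 := (sign_pos_iff_of_sign_eq hs).1 h1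
    exact ⟨fun u w hu huw hw => eval_lt_eval_of_derivative hx1 hx2 h.left_ne h1 hu huw hw,
      fun u w hu huw hw => eval_lt_eval_of_derivative hy1 hy2 h.right_ne h2 hu huw hw⟩

theorem GapPair.root {P : K[X]} {Q : L[X]} {a b : K} {a' b' : L}
    (h : GapPair P Q a b a' b') {z : K} (h1 : a < z) (h2 : z < b) (hz : P.eval z = 0) :
    ∃ z', a' < z' ∧ z' < b' ∧ Q.eval z' = 0 := by
  rcases h.increasing with hi | hi
  · exact exists_root_of_increasing h.lt_right hi.1 h.sign_a h.sign_b h1 h2 hz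
  · simpa using exists_root_of_increasing h.lt_right hi.1 h.neg.sign_a h.neg.sign_b h1 h2 (by simpa)

theorem GapPair.root_unique {P : K[X]} {Q : L[X]} {a b : K} {a' b' : L}
    (h : GapPair P Q a b a' b') {z w : K} (h1 : a < z) (h2 : z < w) (h3 : w < b)
    (hz : P.eval z = 0) : P.eval w ≠ 0 := by
  intro hw
  rcases h.increasing with hi | hi
  · have := hi.1 z w h1.le h2 h3.le
    rw [hz, hw] at this
    exact lt_irrefl _ this
  · have := hi.1 z w h1.le h2 h3.le
    rw [eval_neg, eval_neg, hz, hw] at this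
    exact lt_irrefl _ this

theorem sign_eq_of_not {x : K} {y : L} (h0 : x = 0 ↔ y = 0) (h1 : 0 < x → ¬ y < 0)
    (h2 : 0 < y → ¬ x < 0) : SignType.sign x = SignType.sign y := by
  rcases lt_trichotomy x 0 with h | h | h
  · have : y < 0 := lt_of_le_of_ne (not_lt.1 fun h' => h2 h' h) fun h' => h.ne (h0.2 h')
    rw [sign_neg h, sign_neg this]
  · rw [h, h0.1 h]; simp
  · have : 0 < y := lt_of_le_of_ne (not_lt.1 (h1 h)) fun h' => h.ne' (h0.2 h'.symm)
    rw [sign_pos h, sign_pos this]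

/-- Zeros are assumed to correspond in position, so only strictly opposite signs must be excluded.
`not_neg_of_increasing` does this in both directions, after a common change of sign if the
polynomials decrease. -/
theorem GapPair.sign_eq {P : K[X]} {Q : L[X]} {a b : K} {a' b' : L}
    (h : GapPair P Q a b a' b') {x : K} {y : L} (hx1 : a < x) (hx2 : x < b) (hy1 : a' < y)
    (hy2 : y < b') (h0 : P.eval x = 0 ↔ Q.eval y = 0)
    (hxy : ∀ z z', a < z → z < b → a' < z' → z' < b' → P.eval z = 0 → Q.eval z' = 0 →
      (x < z ↔ y < z')) : SignType.sign (P.eval x) = SignType.sign (Q.eval y) := by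
  rcases h.increasing with hi | hi
  · exact sign_eq_of_not h0
      (not_neg_of_increasing h.lt_left hi.1 hi.2 h.sign_a h.sign_b hx1 hx2 hy1 hy2 hxy)
      (not_neg_of_increasing h.lt_right hi.2 hi.1 h.symm.sign_a h.symm.sign_b hy1 hy2 hx1 hx2
        fun z z' h1 h2 h3 h4 h5 h6 => (hxy z' z h3 h4 h1 h2 h6 h5).symm)
  · have h' := h.neg
    have : SignType.sign ((-P).eval x) = SignType.sign ((-Q).eval y) := sign_eq_of_not (by simpa)
      (not_neg_of_increasing h.lt_left hi.1 hi.2 h'.sign_a h'.sign_b hx1 hx2 hy1 hy2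
        (by simpa using hxy))
      (not_neg_of_increasing h.lt_right hi.2 hi.1 h'.symm.sign_a h'.symm.sign_b hy1 hy2 hx1 hx2
        fun z z' h1 h2 h3 h4 h5 h6 => (hxy z' z h3 h4 h1 h2 (by simpa using h6)
          (by simpa using h5)).symm)
    rw [eval_neg, eval_neg, Left.sign_neg, Left.sign_neg] at this
    exact neg_injective this

end Gap

end OrderedRings

namespace OrderedRings

open Polynomial

/-! ### Sign diagrams and their extension by one polynomial. -/

section Diagram

variable {K : Type} [Field K] [LinearOrder K] [IsStrictOrderedRing K] [PolynomialIVT K]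
  {L : Type} [Field L] [LinearOrder L] [IsStrictOrderedRing L] [PolynomialIVT L]

/-- `x` and `y` lie in corresponding positions relative to the pairs in `Γ`. -/
def Match (Γ : Finset (K × L)) (x : K) (y : L) : Prop :=
  ∀ p ∈ Γ, cmp p.1 x = cmp p.2 y

/-- A finite partial isomorphism of orders, through all zeros of the members of `W`, along which
the members of `W` have equal signs. -/
structure Diagram (Γ : Finset (K × L)) (W : Set (K[X] × L[X])) : Prop where
  mono : ∀ p ∈ Γ, Match Γ p.1 p.2
  sign_eq : ∀ w ∈ W, ∀ x y, Match Γ x y →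
    SignType.sign (w.1.eval x) = SignType.sign (w.2.eval y)
  root_left : ∀ w ∈ W, w.1 ≠ 0 → ∀ x, w.1.eval x = 0 → ∃ y, (x, y) ∈ Γ
  root_right : ∀ w ∈ W, w.2 ≠ 0 → ∀ y, w.2.eval y = 0 → ∃ x, (x, y) ∈ Γ

theorem Match.lt_iff {Γ : Finset (K × L)} {x : K} {y : L} (h : Match Γ x y) {p : K × L}
    (hp : p ∈ Γ) : p.1 < x ↔ p.2 < y := lt_iff_lt_of_cmp_eq_cmp (h p hp)

theorem Match.gt_iff {Γ : Finset (K × L)} {x : K} {y : L} (h : Match Γ x y) {p : K × L}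
    (hp : p ∈ Γ) : x < p.1 ↔ y < p.2 := by
  have := h p hp
  rw [← cmp_eq_gt_iff p.1, this, cmp_eq_gt_iff]

theorem Match.eq_iff {Γ : Finset (K × L)} {x : K} {y : L} (h : Match Γ x y) {p : K × L}
    (hp : p ∈ Γ) : p.1 = x ↔ p.2 = y := by
  have := h p hp
  rw [← cmp_eq_eq_iff, this, cmp_eq_eq_iff]

theorem match_of_iff {Γ : Finset (K × L)} {x : K} {y : L}
    (h1 : ∀ p ∈ Γ, p.1 < x ↔ p.2 < y) (h2 : ∀ p ∈ Γ, x < p.1 ↔ y < p.2) : Match Γ x y := by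
  intro p hp
  rcases lt_trichotomy p.1 x with h | h | h
  · rw [(cmp_eq_lt_iff _ _).2 h, (cmp_eq_lt_iff _ _).2 ((h1 p hp).1 h)]
  · have : p.2 = y := le_antisymm (not_lt.1 fun h' => ((h2 p hp).2 h').ne' h)
      (not_lt.1 fun h' => ((h1 p hp).2 h').ne h)
    rw [(cmp_eq_eq_iff _ _).2 h, (cmp_eq_eq_iff _ _).2 this]
  · rw [(cmp_eq_gt_iff _ _).2 h, (cmp_eq_gt_iff _ _).2 ((h2 p hp).1 h)]

theorem Match.mono {Γ Γ' : Finset (K × L)} {x : K} {y : L} (h : Match Γ x y) (hs : Γ' ⊆ Γ) :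
    Match Γ' x y := fun p hp => h p (hs hp)

/-- Ordered fields are dense orders without end points, so a finite partial isomorphism extends to
any new point. This back-and-forth property is what makes diagrams control quantifiers. -/
theorem exists_match_right {Γ : Finset (K × L)} (hΓ : ∀ p ∈ Γ, Match Γ p.1 p.2) (x : K) :
    ∃ y, Match Γ x y :=
  Order.PartialIso.exists_across ⟨Γ, fun p hp q hq => hΓ q hq p hp⟩ x

theorem exists_match_left {Γ : Finset (K × L)} (hΓ : ∀ p ∈ Γ, Match Γ p.1 p.2) (y : L) :
    ∃ x, Match Γ x y := by
  obtain ⟨x, hx⟩ := Order.PartialIso.exists_across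
    (Order.PartialIso.comm ⟨Γ, fun p hp q hq => hΓ q hq p hp⟩) y
  refine ⟨x, fun p hp => (hx p.swap ?_).symm⟩
  simpa [Order.PartialIso.comm] using hp

theorem Diagram.subset {Γ : Finset (K × L)} {W W' : Set (K[X] × L[X])} (h : Diagram Γ W)
    (hs : W' ⊆ W) : Diagram Γ W' :=
  ⟨h.mono, fun w hw => h.sign_eq w (hs hw), fun w hw => h.root_left w (hs hw),
    fun w hw => h.root_right w (hs hw)⟩

/-- Every point of either field is matched with one of the other, so vanishing everywhere transfers;
over an infinite field this means being the zero polynomial. -/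
theorem Diagram.eq_zero_iff {Γ : Finset (K × L)} {W : Set (K[X] × L[X])} (h : Diagram Γ W)
    {w : K[X] × L[X]} (hw : w ∈ W) : w.1 = 0 ↔ w.2 = 0 := by
  constructor
  · intro h0
    refine Polynomial.funext fun y => ?_
    obtain ⟨x, hx⟩ := exists_match_left h.mono y
    have := h.sign_eq w hw x y hx
    rw [h0, eval_zero, sign_zero] at this
    rw [sign_eq_zero_iff.1 this.symm, eval_zero]
  · intro h0
    refine Polynomial.funext fun x => ?_
    obtain ⟨y, hy⟩ := exists_match_right h.mono x
    have := h.sign_eq w hw x y hy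
    rw [h0, eval_zero, sign_zero] at this
    rw [sign_eq_zero_iff.1 this, eval_zero]

theorem Diagram.insert_point {Γ : Finset (K × L)} {W : Set (K[X] × L[X])} [DecidableEq (K × L)]
    (h : Diagram Γ W) {x : K} {y : L} (hxy : Match Γ x y) :
    Diagram (insert (x, y) Γ) W where
  mono p hp := by
    rw [Finset.mem_insert] at hp
    intro q hq
    rw [Finset.mem_insert] at hq
    rcases hp with rfl | hp <;> rcases hq with rfl | hq
    · simp
    · exact hxy q hq
    · have := hxy p hp
      rw [← cmp_swap, this, cmp_swap]
    · exact h.mono p hp q hq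
  sign_eq w hw x y hm := h.sign_eq w hw x y (hm.mono (Finset.subset_insert _ _))
  root_left w hw h0 x hx := (h.root_left w hw h0 x hx).imp fun y => Finset.mem_insert_of_mem
  root_right w hw h0 x hx := (h.root_right w hw h0 x hx).imp fun y => Finset.mem_insert_of_mem

/-- Points that are not zeros of the polynomials under consideration may be dropped. -/
theorem Diagram.restrict {Γ Γ' : Finset (K × L)} {W W' : Set (K[X] × L[X])} (h : Diagram Γ W)
    (hW : W' ⊆ W) (hΓ : Γ' ⊆ Γ)
    (hr : ∀ p ∈ Γ, (∃ w ∈ W', w.1 ≠ 0 ∧ w.1.eval p.1 = 0) → p ∈ Γ') : Diagram Γ' W' := by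
  have hl : ∀ w ∈ W', w.1 ≠ 0 → ∀ x, w.1.eval x = 0 → ∃ y, (x, y) ∈ Γ' := by
    intro w hw h0 x hx
    obtain ⟨y, hy⟩ := h.root_left w (hW hw) h0 x hx
    exact ⟨y, hr _ hy ⟨w, hw, h0, hx⟩⟩
  have hrt : ∀ w ∈ W', w.2 ≠ 0 → ∀ y, w.2.eval y = 0 → ∃ x, (x, y) ∈ Γ' := by
    intro w hw h0 y hy
    obtain ⟨x, hx⟩ := h.root_right w (hW hw) h0 y hy
    refine ⟨x, hr _ hx ⟨w, hw, fun h' => h0 ((h.eq_zero_iff (hW hw)).1 h'), ?_⟩⟩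
    have := h.sign_eq w (hW hw) x y (h.mono _ hx)
    rwa [hy, sign_zero, sign_eq_zero_iff] at this
  refine ⟨fun p hp => (h.mono p (hΓ hp)).mono hΓ, fun w hw x y hm => ?_, hl, hrt⟩
  -- `y` is matched to `x` only relative to the smaller `Γ'`. Choose `y'` matched relative to all of
  -- `Γ`: unless `x` is a point of `Γ'`, both lie in one cell of `Γ'`, which contains no zero of
  -- `w.2`, so the signs at `y` and `y'` agree.
  obtain ⟨y', hy'⟩ := exists_match_right h.mono x
  rw [h.sign_eq w (hW hw) x y' hy']
  have hy'' := hy'.mono hΓ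
  by_cases h0 : w.2 = 0
  · simp [h0]
  by_cases hx : ∃ z, (x, z) ∈ Γ'
  · obtain ⟨z, hz⟩ := hx
    rw [← (hm.eq_iff hz).1 rfl, ← (hy''.eq_iff hz).1 rfl]
  have key : ∀ z, (y' ≤ z ∧ z ≤ y) ∨ (y ≤ z ∧ z ≤ y') → w.2.eval z ≠ 0 := by
    intro z hz hz0
    obtain ⟨u, hu⟩ := hrt w hw h0 z hz0
    rcases lt_trichotomy u x with h1 | h1 | h1
    · have h2 := (hm.lt_iff hu).1 h1
      have h3 := (hy''.lt_iff hu).1 h1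
      simp only at h2 h3
      rcases hz with hz | hz <;> linarith
    · exact hx ⟨z, h1 ▸ hu⟩
    · have h2 := (hm.gt_iff hu).1 h1
      have h3 := (hy''.gt_iff hu).1 h1
      simp only at h2 h3
      rcases hz with hz | hz <;> linarith
  rcases le_total y' y with hle | hle
  · exact sign_eval_eq_of_ne_zero _ hle fun z h1 h2 => key z (Or.inl ⟨h1, h2⟩)
  · exact (sign_eval_eq_of_ne_zero _ hle fun z h1 h2 => key z (Or.inr ⟨h1, h2⟩)).symm

/-- A point strictly inside the range of `Γ` but not on `Γ` lies between two neighbours. -/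
theorem exists_gap {Γ : Finset (K × L)} {x : K} (h1 : ∃ p ∈ Γ, p.1 < x) (h2 : ∃ p ∈ Γ, x < p.1)
    (h3 : ∀ p ∈ Γ, p.1 ≠ x) :
    ∃ p ∈ Γ, ∃ q ∈ Γ, p.1 < x ∧ x < q.1 ∧ ∀ u ∈ Γ, u.1 ≤ p.1 ∨ q.1 ≤ u.1 := by
  classical
  obtain ⟨p, hp, hpm⟩ := Finset.exists_max_image (Γ.filter fun p => p.1 < x) Prod.fst
    (by obtain ⟨p, hp, h⟩ := h1; exact ⟨p, by simp [hp, h]⟩)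
  obtain ⟨q, hq, hqm⟩ := Finset.exists_min_image (Γ.filter fun p => x < p.1) Prod.fst
    (by obtain ⟨p, hp, h⟩ := h2; exact ⟨p, by simp [hp, h]⟩)
  simp only [Finset.mem_filter] at hp hq hpm hqm
  refine ⟨p, hp.1, q, hq.1, hp.2, hq.2, fun u hu => ?_⟩
  rcases lt_or_gt_of_ne (h3 u hu) with h | h
  · exact Or.inl (hpm u ⟨hu, h⟩)
  · exact Or.inr (hqm u ⟨hu, h⟩)

/-- Since `Γ` preserves order, the second coordinates also avoid the open interval between `p.2` and
`q.2`. Hence any two points of the two gaps are in corresponding position. -/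
theorem match_of_gap {Γ : Finset (K × L)} (hΓ : ∀ p ∈ Γ, Match Γ p.1 p.2) {p q : K × L}
    (hp : p ∈ Γ) (hq : q ∈ Γ) (hpq : ∀ u ∈ Γ, u.1 ≤ p.1 ∨ q.1 ≤ u.1) {x : K} {y : L}
    (h1 : p.1 < x) (h2 : x < q.1) (h3 : p.2 < y) (h4 : y < q.2) : Match Γ x y := by
  have hp' : ∀ u ∈ Γ, u.1 ≤ p.1 → u.2 ≤ p.2 := fun u hu h =>
    not_lt.1 fun h' => not_lt.2 h (((hΓ u hu).lt_iff hp).2 h')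
  have hq' : ∀ u ∈ Γ, q.1 ≤ u.1 → q.2 ≤ u.2 := fun u hu h =>
    not_lt.1 fun h' => not_lt.2 h (((hΓ u hu).gt_iff hq).2 h')
  refine match_of_iff (fun u hu => ?_) (fun u hu => ?_) <;> rcases hpq u hu with h | h
  · exact iff_of_true (h.trans_lt h1) ((hp' u hu h).trans_lt h3)
  · exact iff_of_false (by linarith) (by linarith [hq' u hu h])
  · exact iff_of_false (by linarith) (by linarith [hp' u hu h])
  · exact iff_of_true (h2.trans_le h) (h4.trans_le (hq' u hu h))

/-- All zeros of the derivative are points of the diagram, so none lies strictly between two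
neighbours. -/
theorem Diagram.gapPair {Γ : Finset (K × L)} {W : Set (K[X] × L[X])} (h : Diagram Γ W)
    {P : K[X]} {Q : L[X]} (hder : (derivative P, derivative Q) ∈ W) (hP : derivative P ≠ 0)
    (hpt : ∀ p ∈ Γ, SignType.sign (P.eval p.1) = SignType.sign (Q.eval p.2))
    {p q : K × L} (hp : p ∈ Γ) (hq : q ∈ Γ) (hlt : p.1 < q.1)
    (hpq : ∀ u ∈ Γ, u.1 ≤ p.1 ∨ q.1 ≤ u.1) : GapPair P Q p.1 q.1 p.2 q.2 where
  lt_left := hlt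
  lt_right := ((h.mono q hq).lt_iff hp).1 hlt
  sign_a := hpt p hp
  sign_b := hpt q hq
  left_ne z h1 h2 h0 := by
    obtain ⟨y, hy⟩ := h.root_left _ hder hP z h0
    rcases hpq _ hy with h3 | h3 <;> simp only at h3 <;> linarith
  right_ne z h1 h2 h0 := by
    obtain ⟨x, hx⟩ := h.root_right _ hder (fun h' => hP ((h.eq_zero_iff hder).2 h')) z h0
    have h1' := ((h.mono _ hx).lt_iff hp).2 h1
    have h2' := ((h.mono _ hx).gt_iff hq).2 h2
    rcases hpq _ hx with h3 | h3 <;> simp only at h3 h1' h2' <;> linarith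
  sign_derivative x y h1 h2 h3 h4 :=
    h.sign_eq _ hder x y (match_of_gap h.mono hp hq hpq h1 h2 h3 h4)

/-- Adding a pair of polynomials whose signs agree on the diagram and outside its range. -/
theorem Diagram.insert_poly {Γ : Finset (K × L)} {W : Set (K[X] × L[X])} (h : Diagram Γ W)
    {P : K[X]} {Q : L[X]} (hder : (derivative P, derivative Q) ∈ W) (hP : derivative P ≠ 0)
    (hpt : ∀ p ∈ Γ, SignType.sign (P.eval p.1) = SignType.sign (Q.eval p.2))
    (hout : ∀ x y, Match Γ x y → ((∀ p ∈ Γ, x < p.1) ∨ (∀ p ∈ Γ, p.1 < x)) →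
      SignType.sign (P.eval x) = SignType.sign (Q.eval y) ∧ P.eval x ≠ 0) :
    ∃ Γ', Diagram Γ' (insert (P, Q) W) := by
  classical
  have hP0 : P ≠ 0 := by rintro rfl; simp at hP
  have hQ0 : Q ≠ 0 := by
    rintro rfl
    exact hP ((h.eq_zero_iff hder).2 (by simp))
  -- every point is outside, on the diagram, or in a gap
  have cases3 : ∀ x y, Match Γ x y → (((∀ p ∈ Γ, x < p.1) ∨ (∀ p ∈ Γ, p.1 < x)) ∨ (x, y) ∈ Γ ∨
      ∃ p ∈ Γ, ∃ q ∈ Γ, p.1 < x ∧ x < q.1 ∧ p.2 < y ∧ y < q.2 ∧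
        ∀ u ∈ Γ, u.1 ≤ p.1 ∨ q.1 ≤ u.1) := by
    intro x y hxy
    by_cases h1 : ∃ p ∈ Γ, p.1 = x
    · obtain ⟨p, hp, rfl⟩ := h1
      have := (hxy.eq_iff hp).1 rfl
      exact Or.inr (Or.inl (this ▸ hp))
    push Not at h1
    by_cases h2 : ∃ p ∈ Γ, p.1 < x
    · by_cases h3 : ∃ p ∈ Γ, x < p.1
      · obtain ⟨p, hp, q, hq, h4, h5, h6⟩ := exists_gap h2 h3 h1
        exact Or.inr (Or.inr ⟨p, hp, q, hq, h4, h5, (hxy.lt_iff hp).1 h4, (hxy.gt_iff hq).1 h5, h6⟩)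
      · push Not at h3
        exact Or.inl (Or.inr fun p hp => lt_of_le_of_ne (h3 p hp) (h1 p hp))
    · push Not at h2
      exact Or.inl (Or.inl fun p hp => lt_of_le_of_ne (h2 p hp) (h1 p hp).symm)
  have rootL : ∀ x, P.eval x = 0 → ∃ y, Match Γ x y ∧ Q.eval y = 0 := by
    intro x hx
    obtain ⟨y, hy⟩ := exists_match_right h.mono x
    rcases cases3 x y hy with h1 | h1 | ⟨p, hp, q, hq, h1, h2, h3, h4, h5⟩
    · exact absurd hx (hout x y hy h1).2
    · exact ⟨y, hy, (sign_zero_iff_of_sign_eq (hpt _ h1)).1 hx⟩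
    · obtain ⟨z, h6, h7, h8⟩ :=
        (h.gapPair hder hP hpt hp hq (h1.trans h2) h5).root h1 h2 hx
      exact ⟨z, match_of_gap h.mono hp hq h5 h1 h2 h6 h7, h8⟩
  have rootR : ∀ y, Q.eval y = 0 → ∃ x, Match Γ x y ∧ P.eval x = 0 := by
    intro y hy
    obtain ⟨x, hx⟩ := exists_match_left h.mono y
    rcases cases3 x y hx with h1 | h1 | ⟨p, hp, q, hq, h1, h2, h3, h4, h5⟩
    · have h2 := hout x y hx h1
      exact absurd ((sign_zero_iff_of_sign_eq h2.1).2 hy) h2.2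
    · exact ⟨x, hx, (sign_zero_iff_of_sign_eq (hpt _ h1)).2 hy⟩
    · obtain ⟨z, h6, h7, h8⟩ :=
        (h.gapPair hder hP hpt hp hq (h1.trans h2) h5).symm.root h3 h4 hy
      exact ⟨z, match_of_gap h.mono hp hq h5 h6 h7 h3 h4, h8⟩
  -- two matched zeros are matched in the same gap in the same order
  have uniq : ∀ x y x' y', Match Γ x y → Match Γ x' y' → P.eval x = 0 → P.eval x' = 0 →
      Q.eval y = 0 → Q.eval y' = 0 → x < x' → y < y' := by
    intro x y x' y' hm hm' hx hx' hy hy' hlt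
    rcases cases3 x y hm with h1 | h1 | ⟨p, hp, q, hq, h1, h2, h3, h4, h5⟩
    · exact absurd hx (hout x y hm h1).2
    · exact (hm'.lt_iff h1).1 hlt
    · have hg := h.gapPair hder hP hpt hp hq (h1.trans h2) h5
      rcases lt_trichotomy x' q.1 with h6 | h6 | h6
      · exact absurd hx' (hg.root_unique h1 hlt h6 hx)
      · exact h4.trans_eq ((hm'.eq_iff hq).1 h6.symm)
      · exact h4.trans ((hm'.lt_iff hq).1 h6)
  have uniqR : ∀ x y x' y', Match Γ x y → Match Γ x' y' → P.eval x = 0 → P.eval x' = 0 →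
      Q.eval y = 0 → Q.eval y' = 0 → y < y' → x < x' := by
    intro x y x' y' hm hm' hx hx' hy hy' hlt
    rcases cases3 x y hm with h1 | h1 | ⟨p, hp, q, hq, h1, h2, h3, h4, h5⟩
    · exact absurd hx (hout x y hm h1).2
    · exact (hm'.lt_iff h1).2 hlt
    · have hg := h.gapPair hder hP hpt hp hq (h1.trans h2) h5
      rcases lt_trichotomy y' q.2 with h6 | h6 | h6
      · exact absurd hy' (hg.symm.root_unique h3 hlt h6 hy)
      · exact h2.trans_eq ((hm'.eq_iff hq).2 h6.symm)
      · exact h2.trans ((hm'.lt_iff hq).2 h6)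
  -- The new points: all matched pairs of zeros. A gap contains at most one zero of each polynomial,
  -- so `N` pairs them up in increasing order, which is what `uniq` and `uniqR` express.
  set N : Finset (K × L) := (P.roots.toFinset ×ˢ Q.roots.toFinset).filter
    (fun p => Match Γ p.1 p.2) with hN
  have memN : ∀ p : K × L, p ∈ N ↔ (P.eval p.1 = 0 ∧ Q.eval p.2 = 0) ∧ Match Γ p.1 p.2 := by
    intro p
    simp [hN, hP0, hQ0]
  have hmono : ∀ p ∈ Γ ∪ N, Match (Γ ∪ N) p.1 p.2 := by
    intro p hp q hq
    rw [Finset.mem_union, memN] at hp hq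
    rcases hq with hq | hq
    · rcases hp with hp | hp
      · exact h.mono p hp q hq
      · exact hp.2 q hq
    · rcases hp with hp | hp
      · have := hq.2 p hp
        rw [← cmp_swap, this, cmp_swap]
      · have h1 := uniq _ _ _ _ hq.2 hp.2 hq.1.1 hp.1.1 hq.1.2 hp.1.2
        have h2 := uniqR _ _ _ _ hq.2 hp.2 hq.1.1 hp.1.1 hq.1.2 hp.1.2
        have h3 := uniq _ _ _ _ hp.2 hq.2 hp.1.1 hq.1.1 hp.1.2 hq.1.2
        have h4 := uniqR _ _ _ _ hp.2 hq.2 hp.1.1 hq.1.1 hp.1.2 hq.1.2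
        exact match_of_iff (Γ := {q}) (x := p.1) (y := p.2)
          (by simpa using ⟨h1, h2⟩) (by simpa using ⟨h3, h4⟩) q (by simp)
  have hroots : ∀ x y, Match (Γ ∪ N) x y → (P.eval x = 0 ↔ Q.eval y = 0) := by
    intro x y hm
    have hm' := hm.mono (Γ' := Γ) Finset.subset_union_left
    constructor
    · intro hx
      obtain ⟨z, hz, hz0⟩ := rootL x hx
      have hmem : (x, z) ∈ Γ ∪ N := by
        rw [Finset.mem_union, memN]; exact Or.inr ⟨⟨hx, hz0⟩, hz⟩
      rw [← (hm.eq_iff hmem).1 rfl]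
      exact hz0
    · intro hy
      obtain ⟨z, hz, hz0⟩ := rootR y hy
      have hmem : (z, y) ∈ Γ ∪ N := by
        rw [Finset.mem_union, memN]; exact Or.inr ⟨⟨hz0, hy⟩, hz⟩
      rw [← (hm.eq_iff hmem).2 rfl]
      exact hz0
  refine ⟨Γ ∪ N, hmono, ?_, ?_, ?_⟩
  · rintro w (rfl | hw) x y hm
    · have hm' := hm.mono (Γ' := Γ) Finset.subset_union_left
      rcases cases3 x y hm' with h1 | h1 | ⟨p, hp, q, hq, h1, h2, h3, h4, h5⟩
      · exact (hout x y hm' h1).1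
      · exact hpt _ h1
      · refine (h.gapPair hder hP hpt hp hq (h1.trans h2) h5).sign_eq h1 h2 h3 h4
          (hroots x y hm) ?_
        intro z z' h6 h7 h8 h9 hz hz'
        have hmem : (z, z') ∈ Γ ∪ N := by
          rw [Finset.mem_union, memN]
          exact Or.inr ⟨⟨hz, hz'⟩, match_of_gap h.mono hp hq h5 h6 h7 h8 h9⟩
        exact hm.gt_iff hmem
    · exact h.sign_eq w hw x y (hm.mono Finset.subset_union_left)
  · rintro w (rfl | hw) h0 x hx
    · obtain ⟨z, hz, hz0⟩ := rootL x hx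
      exact ⟨z, by rw [Finset.mem_union, memN]; exact Or.inr ⟨⟨hx, hz0⟩, hz⟩⟩
    · exact (h.root_left w hw h0 x hx).imp fun y => Finset.mem_union_left _
  · rintro w (rfl | hw) h0 y hy
    · obtain ⟨z, hz, hz0⟩ := rootR y hy
      exact ⟨z, by rw [Finset.mem_union, memN]; exact Or.inr ⟨⟨hz0, hy⟩, hz⟩⟩
    · exact (h.root_right w hw h0 y hy).imp fun y => Finset.mem_union_left _

/-- Makes the leading term decide the sign beyond `±M`. Positivity of `M` ensures `-M < M`, so that
`±M` can be added to a diagram as two distinct points. -/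
theorem exists_outer_bound (P : K[X]) (hd : P.natDegree ≠ 0) (Γ : Finset K) :
    ∃ M : K, 0 < M ∧ (∀ x, M ≤ x → SignType.sign (P.eval x) = SignType.sign P.leadingCoeff) ∧
      (∀ x, x ≤ -M → SignType.sign (P.eval x) =
        SignType.sign (P.leadingCoeff * (-1) ^ P.natDegree)) ∧ ∀ x ∈ Γ, -M < x ∧ x < M := by
  obtain ⟨M₁, h1⟩ := exists_sign_eval_eq P hd
  obtain ⟨M₂, h2⟩ := exists_sign_eval_eq_neg P hd
  have h3 : ∃ M : K, ∀ x ∈ Γ, |x| < M := by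
    rcases Γ.eq_empty_or_nonempty with rfl | hne
    · exact ⟨0, by simp⟩
    · obtain ⟨x, _, hx⟩ := Finset.exists_max_image Γ (fun x => |x|) hne
      exact ⟨|x| + 1, fun y hy => by linarith [hx y hy]⟩
  obtain ⟨M₃, h3⟩ := h3
  refine ⟨max 1 (max M₁ (max M₂ M₃)), by positivity, fun x hx => h1 x ?_, fun x hx => h2 x ?_,
    fun x hx => ?_⟩
  · simp only [max_le_iff] at hx; exact hx.2.1
  · have : M₂ ≤ max 1 (max M₁ (max M₂ M₃)) := by simp
    linarith
  · have : M₃ ≤ max 1 (max M₁ (max M₂ M₃)) := by simp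
    have := h3 x hx
    rw [abs_lt] at this
    constructor <;> linarith

/-- The inductive step for sign diagrams: a polynomial whose derivative is already treated, and
whose signs at the zeros of the other polynomials agree. -/
theorem Diagram.step {Γ : Finset (K × L)} {W W' : Set (K[X] × L[X])} (h : Diagram Γ W)
    (hW : W' ⊆ W) {P : K[X]} {Q : L[X]} (hder : (derivative P, derivative Q) ∈ W')
    (hd : P.natDegree ≠ 0) (hdeg : Q.natDegree = P.natDegree)
    (hlc : SignType.sign P.leadingCoeff = SignType.sign Q.leadingCoeff)
    (hpt : ∀ w ∈ W', w.1 ≠ 0 → ∀ p ∈ Γ, w.1.eval p.1 = 0 → w.2.eval p.2 = 0 →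
      SignType.sign (P.eval p.1) = SignType.sign (Q.eval p.2)) :
    ∃ Γ', Diagram Γ' (insert (P, Q) W') := by
  classical
  have hP : P ≠ 0 := by rintro rfl; simp at hd
  have hl0 : P.leadingCoeff ≠ 0 := leadingCoeff_ne_zero.2 hP
  -- The sign of `P` is controlled only at zeros of members of `W'`. The other points, such as zeros
  -- of auxiliary remainders, are discarded.
  set Γ₁ := Γ.filter fun p => ∃ w ∈ W', w.1 ≠ 0 ∧ w.1.eval p.1 = 0 with hΓ₁
  have h1 : Diagram Γ₁ W' := h.restrict hW (Finset.filter_subset _ _) fun p hp hw => by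
    rw [hΓ₁, Finset.mem_filter]; exact ⟨hp, hw⟩
  have hpt1 : ∀ p ∈ Γ₁, SignType.sign (P.eval p.1) = SignType.sign (Q.eval p.2) := by
    intro p hp
    rw [hΓ₁, Finset.mem_filter] at hp
    obtain ⟨hp, w, hw, h0, hz⟩ := hp
    refine hpt w hw h0 p hp hz ?_
    have := h.sign_eq w (hW hw) _ _ (h.mono p hp)
    exact (sign_zero_iff_of_sign_eq this).1 hz
  obtain ⟨M, hM0, hM1, hM2, hM3⟩ := exists_outer_bound P hd (Γ₁.image Prod.fst)
  obtain ⟨M', hM0', hM1', hM2', hM3'⟩ := exists_outer_bound Q (hdeg ▸ hd) (Γ₁.image Prod.snd)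
  have hM4 : ∀ p ∈ Γ₁, (-M < p.1 ∧ p.1 < M) ∧ (-M' < p.2 ∧ p.2 < M') := fun p hp =>
    ⟨hM3 _ (Finset.mem_image_of_mem _ hp), hM3' _ (Finset.mem_image_of_mem _ hp)⟩
  have hlc' : SignType.sign (P.leadingCoeff * (-1) ^ P.natDegree) =
      SignType.sign (Q.leadingCoeff * (-1) ^ Q.natDegree) := by
    rw [hdeg, sign_mul, sign_mul, hlc, sign_pow, sign_pow, Left.sign_neg, Left.sign_neg]
    simp
  -- Adjoin the pairs `(M, M')` and `(-M, -M')`. Outside them the leading terms decide the signs, so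
  -- the unbounded cells cause no trouble.
  have h2 := h1.insert_point (x := M) (y := M') (match_of_iff
    (fun p hp => iff_of_true (hM4 p hp).1.2 (hM4 p hp).2.2)
    (fun p hp => iff_of_false (hM4 p hp).1.2.le.not_gt (hM4 p hp).2.2.le.not_gt))
  have h3 := h2.insert_point (x := -M) (y := -M') (by
    refine match_of_iff (fun p hp => ?_) (fun p hp => ?_) <;> rw [Finset.mem_insert] at hp <;>
      rcases hp with rfl | hp
    · exact iff_of_false (by simp only; linarith) (by simp only; linarith)
    · exact iff_of_false (hM4 p hp).1.1.le.not_gt (hM4 p hp).2.1.le.not_gt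
    · exact iff_of_true (by simp only; linarith) (by simp only; linarith)
    · exact iff_of_true (hM4 p hp).1.1 (hM4 p hp).2.1)
  refine h3.insert_poly hder ?_ ?_ ?_
  · intro h0
    exact hd (derivative_eq_zero.1 h0)
  · intro p hp
    simp only [Finset.mem_insert] at hp
    rcases hp with rfl | rfl | hp
    · simp only
      rw [hM2 _ le_rfl, hM2' _ le_rfl, hlc']
    · simp only
      rw [hM1 _ le_rfl, hM1' _ le_rfl, hlc]
    · exact hpt1 p hp
  · intro x y hm hx
    have hm1 : (-M, -M') ∈ insert (-M, -M') (insert (M, M') Γ₁) := by simp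
    have hm2 : (M, M') ∈ insert (-M, -M') (insert (M, M') Γ₁) := by simp
    rcases hx with hx | hx
    · have h4 := hx _ hm1
      have h5 := (hm.gt_iff hm1).1 h4
      have h6 := hM2 x h4.le
      refine ⟨by rw [h6, hM2' y h5.le, hlc'], fun h0 => ?_⟩
      have := (sign_zero_iff_of_sign_eq h6).1 h0
      simp [hl0] at this
    · have h4 := hx _ hm2
      have h5 := (hm.lt_iff hm2).1 h4
      have h6 := hM1 x h4.le
      refine ⟨by rw [h6, hM1' y h5.le, hlc], fun h0 => ?_⟩
      exact hl0 ((sign_zero_iff_of_sign_eq h6).1 h0)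

end Diagram

end OrderedRings

namespace OrderedRings

open Polynomial

/-! ### Pseudo-division and removal of vanishing leading terms. -/

section PseudoDivision

variable {R : Type} [CommRing R]

/-- Pseudo-division by a polynomial of positive degree. -/
theorem exists_pseudo_rem (q : R[X]) (hq : q.natDegree ≠ 0) (n : ℕ) :
    ∀ p : R[X], p.natDegree < n → ∃ (k : ℕ) (s r : R[X]),
      C (q.leadingCoeff ^ (2 * k)) * p = q * s + r ∧ r.natDegree < q.natDegree := by
  induction n with
  | zero => intro p hp; omega
  | succ n ih =>
    intro p hp
    by_cases hlt : p.natDegree < q.natDegree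
    · exact ⟨0, 0, p, by simp, hlt⟩
    push Not at hlt
    set a := q.leadingCoeff
    set b := p.leadingCoeff
    set m := X ^ (p.natDegree - q.natDegree) * q
    have hm : m.natDegree ≤ p.natDegree := by
      refine (natDegree_mul_le).trans ?_
      have := natDegree_X_pow_le (R := R) (p.natDegree - q.natDegree)
      omega
    have hmc : m.coeff p.natDegree = a := by
      simp only [m]
      rw [coeff_X_pow_mul', if_pos (by omega), Nat.sub_sub_self hlt]
      rfl
    -- Cancelling with `a²p - abm` instead of `ap - bm` keeps the multiplier of `p` an even power of
    -- the leading coefficient, so it does not affect signs.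
    have h1 : (C (a ^ 2) * p - C (a * b) * m).natDegree < n := by
      rcases Nat.eq_zero_or_pos p.natDegree with h0 | h0
      · omega
      have : (C (a ^ 2) * p - C (a * b) * m).natDegree < p.natDegree := by
        refine lt_of_le_of_ne ?_ fun h => ?_
        · refine (natDegree_sub_le _ _).trans (max_le ?_ ?_)
          · exact natDegree_C_mul_le _ _
          · exact (natDegree_C_mul_le _ _).trans hm
        · have h2 : (C (a ^ 2) * p - C (a * b) * m).coeff p.natDegree = 0 := by
            rw [coeff_sub, coeff_C_mul, coeff_C_mul, hmc]
            simp only [b, leadingCoeff]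
            ring
          rw [← h, coeff_natDegree, leadingCoeff_eq_zero] at h2
          rw [h2, natDegree_zero] at h
          omega
      omega
    obtain ⟨k, s, r, h2, h3⟩ := ih _ h1
    refine ⟨k + 1, s + C (a ^ (2 * k) * (a * b)) * X ^ (p.natDegree - q.natDegree), r, ?_, h3⟩
    have : C (a ^ (2 * (k + 1))) * p = C (a ^ (2 * k)) * (C (a ^ 2) * p - C (a * b) * m) +
        C (a ^ (2 * k) * (a * b)) * m := by
      simp only [map_mul, map_pow]
      ring
    rw [this, h2]
    simp only [m]
    ring

/-- A pseudo-remainder, of smaller degree than the divisor. -/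
noncomputable def pseudoRem (p q : R[X]) : R[X] :=
  open Classical in
  if h : q.natDegree ≠ 0 then
    (exists_pseudo_rem q h (p.natDegree + 1) p (Nat.lt_succ_self _)).choose_spec.choose_spec.choose
  else 0

theorem pseudoRem_spec (p q : R[X]) (h : q.natDegree ≠ 0) : ∃ (k : ℕ) (s : R[X]),
    C (q.leadingCoeff ^ (2 * k)) * p = q * s + pseudoRem p q ∧
      (pseudoRem p q).natDegree < q.natDegree := by
  have H := exists_pseudo_rem q h (p.natDegree + 1) p (Nat.lt_succ_self _)
  refine ⟨H.choose, H.choose_spec.choose, ?_⟩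
  rw [pseudoRem, dif_pos h]
  exact H.choose_spec.choose_spec.choose_spec

theorem natDegree_pseudoRem_le (p q : R[X]) : (pseudoRem p q).natDegree ≤ q.natDegree - 1 := by
  by_cases h : q.natDegree ≠ 0
  · obtain ⟨_, _, _, h1⟩ := pseudoRem_spec p q h
    omega
  · simp [pseudoRem, h]

theorem natDegree_eraseLead_iterate_le (q : R[X]) (i : ℕ) :
    (eraseLead^[i] q).natDegree ≤ q.natDegree := by
  induction i with
  | zero => simp
  | succ i ih =>
    rw [Function.iterate_succ_apply']
    exact (eraseLead_natDegree_le_aux).trans ih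

theorem map_eraseLead_of_eq_zero {K : Type} [CommRing K] (f : R →+* K) (q : R[X])
    (h : f q.leadingCoeff = 0) : q.eraseLead.map f = q.map f := by
  have := congrArg (Polynomial.map f) (eraseLead_add_C_mul_X_pow q)
  rw [← this, Polynomial.map_add, Polynomial.map_mul, map_C, h]
  simp

/-- Dropping leading terms that vanish under `f`. -/
theorem exists_truncation {K : Type} [CommRing K] (f : R →+* K) (n : ℕ) : ∀ (q : R[X]),
    q.natDegree ≤ n → q.map f ≠ 0 → ∃ i ≤ n,
      (∀ j < i, f (eraseLead^[j] q).leadingCoeff = 0) ∧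
      f (eraseLead^[i] q).leadingCoeff ≠ 0 := by
  induction n with
  | zero =>
    intro q hq h
    refine ⟨0, le_rfl, by simp, fun h0 => h ?_⟩
    rw [eq_C_of_natDegree_le_zero hq] at h0 ⊢
    simp at h0
    simp [h0]
  | succ n ih =>
    intro q hq h
    by_cases h0 : f q.leadingCoeff = 0
    · obtain ⟨i, h1, h2, h3⟩ := ih q.eraseLead
        ((eraseLead_natDegree_le q).trans (by omega))
        (by rwa [map_eraseLead_of_eq_zero f q h0])
      refine ⟨i + 1, by omega, fun j hj => ?_, by rwa [Function.iterate_succ_apply]⟩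
      cases j with
      | zero => exact h0
      | succ j => rw [Function.iterate_succ_apply]; exact h2 j (by omega)
    · exact ⟨0, by omega, by simp, h0⟩

theorem map_truncation {K : Type} [CommRing K] (f : R →+* K) (q : R[X]) (i : ℕ)
    (h : ∀ j < i, f (eraseLead^[j] q).leadingCoeff = 0) :
    (eraseLead^[i] q).map f = q.map f := by
  induction i with
  | zero => rfl
  | succ i ih =>
    rw [Function.iterate_succ_apply', map_eraseLead_of_eq_zero f _ (h i (by omega)),
      ih fun j hj => h j (by omega)]

end PseudoDivision

/-- The specializations of `S` under two ring homomorphisms. -/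
def specializations {R K L : Type} [CommRing R] [CommRing K] [CommRing L] (S : Finset R[X])
    (f : R →+* K) (g : R →+* L) : Set (K[X] × L[X]) :=
  {w | ∃ p ∈ S, w = (p.map f, p.map g)}

/-! ### Signs of finitely many coefficient expressions determine a diagram. -/

section Uniform

variable {R : Type} [CommRing R]

/-- The signs of the elements of `T` determine a sign diagram of `S`. -/
def Determines (T : Finset R) (S : Finset R[X]) : Prop :=
  ∀ (K : Type) [Field K] [LinearOrder K] [IsStrictOrderedRing K] [PolynomialIVT K]
    (L : Type) [Field L] [LinearOrder L] [IsStrictOrderedRing L] [PolynomialIVT L]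
    (f : R →+* K) (g : R →+* L),
    (∀ t ∈ T, SignType.sign (f t) = SignType.sign (g t)) →
      ∃ Γ, Diagram Γ (specializations S f g)

theorem determines_of_natDegree_eq_zero [DecidableEq R] (S : Finset R[X])
    (hS : ∀ p ∈ S, p.natDegree = 0) : Determines (S.image fun p => p.coeff 0) S := by
  intro K _ _ _ _ L _ _ _ _ f g h
  have hS' : ∀ p ∈ S, p = C (p.coeff 0) := fun p hp => eq_C_of_natDegree_eq_zero (hS p hp)
  refine ⟨∅, by simp, ?_, ?_, ?_⟩
  · rintro w ⟨p, hp, rfl⟩ x y -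
    rw [hS' p hp]
    simpa using h _ (Finset.mem_image_of_mem _ hp)
  · rintro w ⟨p, hp, rfl⟩ h0 x hx
    rw [hS' p hp] at h0 hx
    simp at h0 hx
    exact absurd hx h0
  · rintro w ⟨p, hp, rfl⟩ h0 x hx
    rw [hS' p hp] at h0 hx
    simp at h0 hx
    exact absurd hx h0

/-- The auxiliary family that governs the zeros of `p` relative to the family `S`. -/
noncomputable def auxFamily [DecidableEq R[X]] (p : R[X]) (S : Finset R[X]) : Finset R[X] :=
  S ∪ S.biUnion fun q => (Finset.range (q.natDegree + 1)).image
    fun i => pseudoRem p (eraseLead^[i] q)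

/-- If the leading coefficient of `p` specializes to zero, `p` may be replaced by `p.eraseLead`,
which `T₁` governs. Otherwise `T₂` provides a diagram of the derivative, of `S` and of the
pseudo-remainders. At a zero of some `q` the sign of `p` equals that of a remainder, and
`Diagram.step` then inserts `p`. -/
theorem determines_step [DecidableEq R] [DecidableEq R[X]] (p : R[X]) (S : Finset R[X])
    (hp : p.natDegree ≠ 0) (T₁ T₂ : Finset R) (h1 : Determines T₁ (insert p.eraseLead S))
    (h2 : Determines T₂ (auxFamily p (insert (derivative p) S))) :
    ∃ T, Determines T (insert p S) := by
  refine ⟨{p.leadingCoeff} ∪ T₁ ∪ T₂ ∪ (insert (derivative p) S).biUnion fun q =>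
    (Finset.range (q.natDegree + 1)).image fun i => (eraseLead^[i] q).leadingCoeff, ?_⟩
  intro K _ _ _ _ L _ _ _ _ f g h
  have hlc : SignType.sign (f p.leadingCoeff) = SignType.sign (g p.leadingCoeff) :=
    h _ (by simp)
  by_cases h0 : f p.leadingCoeff = 0
  · have h0' : g p.leadingCoeff = 0 := (sign_zero_iff_of_sign_eq hlc).1 h0
    obtain ⟨Γ, hΓ⟩ := h1 K L f g fun t ht => h t (by simp [ht])
    refine ⟨Γ, hΓ.subset ?_⟩
    rintro w ⟨q, hq, rfl⟩
    rw [Finset.mem_insert] at hq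
    rcases hq with rfl | hq
    · exact ⟨q.eraseLead, by simp, by
        rw [map_eraseLead_of_eq_zero f _ h0, map_eraseLead_of_eq_zero g _ h0']⟩
    · exact ⟨q, by simp [hq], rfl⟩
  have h0' : g p.leadingCoeff ≠ 0 := fun h' => h0 ((sign_zero_iff_of_sign_eq hlc).2 h')
  obtain ⟨Γ, hΓ⟩ := h2 K L f g fun t ht => h t (by simp [ht])
  have hsub : specializations (insert (derivative p) S) f g ⊆
      specializations (auxFamily p (insert (derivative p) S)) f g := by
    rintro w ⟨q, hq, rfl⟩
    exact ⟨q, Finset.mem_union_left _ hq, rfl⟩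
  obtain ⟨Γ', hΓ'⟩ := hΓ.step hsub (P := p.map f) (Q := p.map g)
    ⟨derivative p, by simp, by rw [derivative_map, derivative_map]⟩
    (by rwa [natDegree_map_of_leadingCoeff_ne_zero f h0])
    (by rw [natDegree_map_of_leadingCoeff_ne_zero f h0,
      natDegree_map_of_leadingCoeff_ne_zero g h0'])
    (by rwa [leadingCoeff_map_of_leadingCoeff_ne_zero f h0,
      leadingCoeff_map_of_leadingCoeff_ne_zero g h0'])
    (by
      rintro w ⟨q, hq, rfl⟩ hne x hx hz hz'
      simp only at hne hz hz'
      -- `q` may lose leading terms under specialization. The leading coefficients of all its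
      -- truncations are in the determining set, so both specializations truncate at the same `i`,
      -- and one pseudo-remainder serves both fields.
      obtain ⟨i, hi, h3, h4⟩ := exists_truncation f q.natDegree q le_rfl hne
      have hsg : ∀ j ≤ q.natDegree, SignType.sign (f (eraseLead^[j] q).leadingCoeff) =
          SignType.sign (g (eraseLead^[j] q).leadingCoeff) := by
        intro j hj
        refine h _ (Finset.mem_union_right _ ?_)
        rw [Finset.mem_biUnion]
        exact ⟨q, hq, Finset.mem_image.2 ⟨j, Finset.mem_range.2 (by omega), rfl⟩⟩
      have h3' : ∀ j < i, g (eraseLead^[j] q).leadingCoeff = 0 := fun j hj =>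
        (sign_zero_iff_of_sign_eq (hsg j (by omega))).1 (h3 j hj)
      have h4' : g (eraseLead^[i] q).leadingCoeff ≠ 0 := fun h' =>
        h4 ((sign_zero_iff_of_sign_eq (hsg i hi)).2 h')
      rw [← map_truncation f q i h3] at hz
      rw [← map_truncation g q i h3'] at hz'
      set u := eraseLead^[i] q with hu
      have hud : u.natDegree ≠ 0 := by
        intro hd
        rw [eq_C_of_natDegree_eq_zero hd] at hz h4
        simp at hz h4
        exact h4 hz
      obtain ⟨k, s, h5, -⟩ := pseudoRem_spec p u hud
      have h6 : f u.leadingCoeff ^ (2 * k) * (p.map f).eval x.1 =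
          ((pseudoRem p u).map f).eval x.1 := by
        have := congrArg (fun r => (r.map f).eval x.1) h5
        simpa [hz] using this
      have h7 : g u.leadingCoeff ^ (2 * k) * (p.map g).eval x.2 =
          ((pseudoRem p u).map g).eval x.2 := by
        have := congrArg (fun r => (r.map g).eval x.2) h5
        simpa [hz'] using this
      have h8 := hΓ.sign_eq ((pseudoRem p u).map f, (pseudoRem p u).map g)
        ⟨pseudoRem p u, by
          refine Finset.mem_union_right _ (Finset.mem_biUnion.2 ⟨q, hq, ?_⟩)
          exact Finset.mem_image.2 ⟨i, Finset.mem_range.2 (by omega), rfl⟩, rfl⟩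
        x.1 x.2 (hΓ.mono x hx)
      simp only at h8
      -- The exponent is even and the leading coefficient nonzero, so the multiplier is positive and
      -- drops out of the sign.
      have h9 : 0 < f u.leadingCoeff ^ (2 * k) := by rw [pow_mul]; positivity
      have h10 : 0 < g u.leadingCoeff ^ (2 * k) := by rw [pow_mul]; positivity
      rw [← h6, ← h7, sign_mul, sign_mul, sign_pos h9, sign_pos h10] at h8
      simpa using h8)
  refine ⟨Γ', hΓ'.subset ?_⟩
  rintro w ⟨q, hq, rfl⟩
  rw [Finset.mem_insert] at hq
  rcases hq with rfl | hq
  · exact Or.inl rfl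
  · exact Or.inr ⟨q, by simp [hq], rfl⟩

/-- Lexicographic induction on a degree bound and the number of members attaining it. For `p` of top
degree, both `p.eraseLead` and the derivative have smaller degree, and so has a remainder modulo any
truncation. Both families used in `determines_step` therefore have one top-degree member fewer. -/
theorem exists_determines (S : Finset R[X]) : ∃ T : Finset R, Determines T S := by
  classical
  suffices H : ∀ d c, ∀ S : Finset R[X], (∀ p ∈ S, p.natDegree ≤ d) →
      (S.filter fun p => p.natDegree = d).card ≤ c → ∃ T : Finset R, Determines T S from
    H (S.sup natDegree) _ S (fun p hp => Finset.le_sup (f := natDegree) hp) le_rfl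
  intro d
  induction d with
  | zero => exact fun c S hS _ => ⟨_, determines_of_natDegree_eq_zero S fun p hp => by
      simpa using hS p hp⟩
  | succ d ihd =>
    intro c
    induction c with
    | zero =>
      intro S hS hc
      refine ihd _ S (fun p hp => ?_) le_rfl
      rw [Nat.le_zero, Finset.card_eq_zero, Finset.filter_eq_empty_iff] at hc
      have := hS p hp
      have := hc hp
      omega
    | succ c ihc =>
      intro S hS hc
      by_cases he : ∃ p ∈ S, p.natDegree = d + 1
      · obtain ⟨p, hp, hpd⟩ := he
        have hcard : ((S.erase p).filter fun q => q.natDegree = d + 1).card ≤ c := by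
          rw [Finset.filter_erase, Finset.card_erase_of_mem (by simp [hp, hpd])]
          omega
        have hS' : ∀ q ∈ S.erase p, q.natDegree ≤ d + 1 := fun q hq =>
          hS q (Finset.mem_of_mem_erase hq)
        have hder : (derivative p).natDegree ≤ d := by
          have := natDegree_derivative_le p
          omega
        obtain ⟨T₁, h1⟩ := ihc (insert p.eraseLead (S.erase p))
          (fun q hq => by
            rw [Finset.mem_insert] at hq
            rcases hq with rfl | hq
            · exact (eraseLead_natDegree_le p).trans (by omega)
            · exact hS' q hq)
          (by
            rw [Finset.filter_insert, if_neg]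
            · exact hcard
            · have := eraseLead_natDegree_le p
              omega)
        have hins : ∀ q ∈ insert (derivative p) (S.erase p), q.natDegree ≤ d + 1 := fun q hq => by
          rw [Finset.mem_insert] at hq
          rcases hq with rfl | hq
          · omega
          · exact hS' q hq
        have haux : ∀ q ∈ auxFamily p (insert (derivative p) (S.erase p)),
            q ∈ S.erase p ∨ q.natDegree ≤ d := by
          intro q hq
          rw [auxFamily, Finset.mem_union, Finset.mem_insert, Finset.mem_biUnion] at hq
          rcases hq with (rfl | hq) | ⟨u, hu, hq⟩
          · exact Or.inr hder
          · exact Or.inl hq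
          · rw [Finset.mem_image] at hq
            obtain ⟨i, -, rfl⟩ := hq
            have h3 := natDegree_pseudoRem_le p (eraseLead^[i] u)
            have h4 := natDegree_eraseLead_iterate_le u i
            have h5 := hins u hu
            exact Or.inr (by omega)
        obtain ⟨T₂, h2⟩ := ihc (auxFamily p (insert (derivative p) (S.erase p)))
          (fun q hq => by
            rcases haux q hq with h | h
            · exact hS' q h
            · omega)
          ((Finset.card_le_card fun q hq => by
            rw [Finset.mem_filter] at hq ⊢
            rcases haux q hq.1 with h | h
            · exact ⟨h, hq.2⟩
            · omega).trans hcard)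
        have := determines_step p (S.erase p) (by omega) T₁ T₂ h1 h2
        rwa [Finset.insert_erase hp] at this
      · refine ihd _ S (fun p hp => ?_) le_rfl
        have := hS p hp
        have : p.natDegree ≠ d + 1 := fun h => he ⟨p, hp, h⟩
        omega

end Uniform

/-! ### Formulas are decided by the signs of finitely many integer polynomials -/

section QuantifierElimination

/-- The homomorphism evaluating integer polynomials at a list. -/
noncomputable def evalHom {K : Type} [CommRing K] (e : List K) : MvPolynomial ℕ ℤ →+* K :=
  (MvPolynomial.aeval fun i => e.getD i 0 : MvPolynomial ℕ ℤ →ₐ[ℤ] K).toRingHom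

/-- `P` decides `φ` at lists of length `n`, in all ordered fields with the intermediate value and
mean value properties for polynomials. -/
def DecidedBy (φ p n : ℕ) (P : Finset (MvPolynomial ℕ ℤ)) : Prop :=
  ∀ (K : Type) [Field K] [LinearOrder K] [IsStrictOrderedRing K] [PolynomialIVT K]
    (L : Type) [Field L] [LinearOrder L] [IsStrictOrderedRing L] [PolynomialIVT L]
    (e : List K) (e' : List L), e.length = n → e'.length = n →
    (∀ q ∈ P, SignType.sign (evalHom e q) = SignType.sign (evalHom e' q)) →
      (sat φ p e ↔ sat φ p e')

theorem exists_tval_eq (p t : ℕ) : ∃ q : MvPolynomial ℕ ℤ,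
    ∀ (K : Type) [Field K] (e : List K), tval p e t = evalHom e q := by
  induction t using termCode_induction with
  | free i => exact ⟨MvPolynomial.X i, fun K _ e => by simp [tval_free, evalHom]⟩
  | bound i => exact ⟨MvPolynomial.X (p + i), fun K _ e => by simp [tval_bound, evalHom]⟩
  | zero i => exact ⟨0, fun K _ e => by simp [tval_zero]⟩
  | one i => exact ⟨1, fun K _ e => by simp [tval_one]⟩
  | add s t ihs iht =>
    obtain ⟨q, hq⟩ := ihs
    obtain ⟨r, hr⟩ := iht
    exact ⟨q + r, fun K _ e => by rw [tval_add, hq, hr, map_add]⟩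
  | mul s t ihs iht =>
    obtain ⟨q, hq⟩ := ihs
    obtain ⟨r, hr⟩ := iht
    exact ⟨q * r, fun K _ e => by rw [tval_mul, hq, hr, map_mul]⟩
  | other k x => exact ⟨0, fun K _ e => by simp [tval_other]⟩

/-- Viewing an integer polynomial as a polynomial in the `n`-th variable. -/
noncomputable def asPolynomial (n : ℕ) : MvPolynomial ℕ ℤ →ₐ[ℤ] (MvPolynomial ℕ ℤ)[X] :=
  MvPolynomial.aeval fun i => if i = n then X else C (MvPolynomial.X i)

theorem evalHom_concat {K : Type} [Field K] (e : List K) (c : K) (q : MvPolynomial ℕ ℤ) :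
    evalHom (e ++ [c]) q = ((asPolynomial e.length q).map (evalHom e)).eval c := by
  have : evalHom (e ++ [c]) = ((evalRingHom c).comp (mapRingHom (evalHom e))).comp
      (asPolynomial e.length).toRingHom := by
    refine MvPolynomial.ringHom_ext (fun r => by simp) fun i => ?_
    rcases lt_trichotomy i e.length with h | h | h
    · simp [evalHom, asPolynomial, h.ne, List.getElem?_append_left h]
    · simp [evalHom, asPolynomial, h]
    · have h1 : (e ++ [c])[i]? = none := by simp; omega
      have h2 : e[i]? = none := by simp; omega
      simp [evalHom, asPolynomial, h.ne', h1, h2]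
  rw [this]
  rfl

/-- Only the quantifier step has content. The members of `P` become polynomials in the bound
variable; agreement of signs on a determining set `T` yields a diagram, and points matched by it
satisfy the same instances. No quantifier-free formula has to be written down: a finite set of sign
conditions is enough. -/
theorem exists_decidedBy (φ : ℕ) : ∀ p n, ∃ P, DecidedBy φ p n P := by
  classical
  induction φ using code_induction with
  | falsum i => exact fun p n => ⟨∅, fun K _ _ _ _ L _ _ _ _ e e' _ _ _ => by simp [sat_falsum]⟩
  | equal s t =>
    intro p n
    obtain ⟨q, hq⟩ := exists_tval_eq p s
    obtain ⟨r, hr⟩ := exists_tval_eq p t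
    refine ⟨{q - r}, fun K _ _ _ _ L _ _ _ _ e e' _ _ h => ?_⟩
    have := h (q - r) (by simp)
    rw [sat_equal, sat_equal, hq, hr, hq, hr, ← sub_eq_zero, ← map_sub, ← sub_eq_zero (b := evalHom e' r),
      ← map_sub]
    exact sign_zero_iff_of_sign_eq this
  | lt s t =>
    intro p n
    obtain ⟨q, hq⟩ := exists_tval_eq p s
    obtain ⟨r, hr⟩ := exists_tval_eq p t
    refine ⟨{r - q}, fun K _ _ _ _ L _ _ _ _ e e' _ _ h => ?_⟩
    have := h (r - q) (by simp)
    rw [sat_lt, sat_lt, hq, hr, hq, hr, ← sub_pos, ← map_sub, ← sub_pos (a := evalHom e' r),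
      ← map_sub]
    exact sign_pos_iff_of_sign_eq this
  | imp φ ψ ih1 ih2 =>
    intro p n
    obtain ⟨P, hP⟩ := ih1 p n
    obtain ⟨Q, hQ⟩ := ih2 p n
    refine ⟨P ∪ Q, fun K _ _ _ _ L _ _ _ _ e e' he he' h => ?_⟩
    rw [sat_imp, sat_imp, hP K L e e' he he' fun q hq => h q (Finset.mem_union_left _ hq),
      hQ K L e e' he he' fun q hq => h q (Finset.mem_union_right _ hq)]
  | all φ ih =>
    intro p n
    obtain ⟨P, hP⟩ := ih p (n + 1)
    obtain ⟨T, hT⟩ := exists_determines (P.image (asPolynomial n))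
    refine ⟨T, fun K _ _ _ _ L _ _ _ _ e e' he he' h => ?_⟩
    rw [sat_all, sat_all]
    obtain ⟨Γ, hΓ⟩ := hT K L (evalHom e) (evalHom e') h
    have key : ∀ x y, Match Γ x y → (sat φ p (e ++ [x]) ↔ sat φ p (e' ++ [y])) := by
      intro x y hm
      refine hP K L _ _ (by simp [he]) (by simp [he']) fun q hq => ?_
      rw [evalHom_concat, evalHom_concat, he, he']
      exact hΓ.sign_eq (_, _) ⟨_, Finset.mem_image_of_mem _ hq, rfl⟩ x y hm
    constructor
    · intro H y
      obtain ⟨x, hx⟩ := exists_match_left hΓ.mono y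
      exact (key x y hx).1 (H x)
    · intro H x
      obtain ⟨y, hy⟩ := exists_match_right hΓ.mono x
      exact (key x y hy).2 (H y)
  | call q ψ l ih =>
    intro p n
    obtain ⟨P, hP⟩ := ih q l.length
    let σ : MvPolynomial ℕ ℤ →ₐ[ℤ] MvPolynomial ℕ ℤ :=
      MvPolynomial.aeval fun i => if h : i < l.length then MvPolynomial.X l[i] else 0
    have hσ : ∀ (K : Type) [Field K] (e : List K) (r : MvPolynomial ℕ ℤ),
        evalHom (l.map fun i => e.getD i 0) r = evalHom e (σ r) := by
      intro K _ e r
      have : evalHom (l.map fun i => e.getD i 0) = (evalHom e).comp σ.toRingHom := by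
        refine MvPolynomial.ringHom_ext (fun r => by simp) fun i => ?_
        by_cases h : i < l.length
        · simp [evalHom, σ, h]
        · have h' : l[i]? = none := by simp; omega
          simp [evalHom, σ, h]
      rw [this]
      rfl
    refine ⟨P.image σ, fun K _ _ _ _ L _ _ _ _ e e' he he' h => ?_⟩
    rw [sat_call, sat_call]
    refine hP K L _ _ (by simp) (by simp) fun r hr => ?_
    rw [hσ, hσ]
    exact h _ (Finset.mem_image_of_mem _ hr)
  | other k x => exact fun p n => ⟨∅, fun K _ _ _ _ L _ _ _ _ e e' _ _ _ => by simp [sat_other]⟩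

instance : PolynomialIVT ℝ where
  ivt P a b hab ha hb := by
    obtain ⟨c, hc, h0⟩ := intermediate_value_Ioo hab.le P.continuousOn ⟨ha, hb⟩
    exact ⟨c, hc.1, hc.2, h0⟩
  mvt P a b hab := by
    obtain ⟨c, hc, h0⟩ := exists_deriv_eq_slope (fun x => P.eval x) hab P.continuousOn
      P.differentiable.differentiableOn
    refine ⟨c, hc.1, hc.2, ?_⟩
    rw [Polynomial.deriv, eq_div_iff (by linarith)] at h0
    exact h0.symm

/-- All models have the same true sentences. -/
theorem sat_iff_of_models (K : Type) [Field K] [LinearOrder K] [IsStrictOrderedRing K]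
    [PolynomialIVT K] (φ : ℕ) : sat φ 0 ([] : List K) ↔ sat φ 0 ([] : List ℝ) := by
  obtain ⟨P, hP⟩ := exists_decidedBy φ 0 0
  refine hP K ℝ [] [] rfl rfl fun q _ => ?_
  -- At the empty list every variable takes the value 0, so each polynomial becomes an integer,
  -- whose sign is the same in all ordered fields.
  have h : ∀ (F : Type) [Field F], (evalHom ([] : List F)) =
      (Int.castRingHom F).comp (MvPolynomial.aeval fun _ => (0 : ℤ)).toRingHom := by
    intro F _
    refine MvPolynomial.ringHom_ext (fun r => by simp) fun i => by simp [evalHom]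
  rw [h K, h ℝ]
  simp only [RingHom.comp_apply, eq_intCast]
  rw [sign_intCast, sign_intCast]

end QuantifierElimination

end OrderedRings

namespace OrderedRings

/-! ### Primitive recursive functions, as a property for `fun_prop` -/

section Primrec

variable {α β γ : Type} [Primcodable α] [Primcodable β] [Primcodable γ]

attribute [fun_prop] Primrec

@[fun_prop] theorem primrec_id : Primrec (fun x : α => x) := Primrec.id

@[fun_prop] theorem primrec_const (b : β) : Primrec (fun _ : α => b) := Primrec.const b

@[fun_prop] theorem primrec_comp {f : β → γ} {g : α → β} (hf : Primrec f) (hg : Primrec g) :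
    Primrec (fun x => f (g x)) := hf.comp hg

@[fun_prop] theorem primrec_fst {f : α → β × γ} (hf : Primrec f) : Primrec (fun x => (f x).1) :=
  Primrec.fst.comp hf

@[fun_prop] theorem primrec_snd {f : α → β × γ} (hf : Primrec f) : Primrec (fun x => (f x).2) :=
  Primrec.snd.comp hf

@[fun_prop] theorem primrec_mk {f : α → β} {g : α → γ} (hf : Primrec f) (hg : Primrec g) :
    Primrec (fun x => (f x, g x)) := hf.pair hg

@[fun_prop] theorem primrec_natPair {f g : α → ℕ} (hf : Primrec f) (hg : Primrec g) :
    Primrec (fun x => Nat.pair (f x) (g x)) := Primrec₂.natPair.comp hf hg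

@[fun_prop] theorem primrec_natUnpair {f : α → ℕ} (hf : Primrec f) :
    Primrec (fun x => Nat.unpair (f x)) := Primrec.unpair.comp hf

@[fun_prop] theorem primrec_add {f g : α → ℕ} (hf : Primrec f) (hg : Primrec g) :
    Primrec (fun x => f x + g x) := Primrec.nat_add.comp hf hg

@[fun_prop] theorem primrec_sub {f g : α → ℕ} (hf : Primrec f) (hg : Primrec g) :
    Primrec (fun x => f x - g x) := Primrec.nat_sub.comp hf hg

@[fun_prop] theorem primrec_encode {f : α → β} (hf : Primrec f) :
    Primrec (fun x => Encodable.encode (f x)) := Primrec.encode.comp hf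

@[fun_prop] theorem primrec_decode {f : α → ℕ} (hf : Primrec f) :
    Primrec (fun x => (Encodable.decode (f x) : Option β)) := Primrec.decode.comp hf

@[fun_prop] theorem primrec_cons {f : α → β} {g : α → List β} (hf : Primrec f) (hg : Primrec g) :
    Primrec (fun x => f x :: g x) := Primrec.list_cons.comp hf hg

@[fun_prop] theorem primrec_append {f g : α → List β} (hf : Primrec f) (hg : Primrec g) :
    Primrec (fun x => f x ++ g x) := Primrec.list_append.comp hf hg

@[fun_prop] theorem primrec_getD {f : α → List β} {g : α → ℕ} (d : β) (hf : Primrec f)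
    (hg : Primrec g) : Primrec (fun x => (f x).getD (g x) d) := (Primrec.list_getD d).comp hf hg

@[fun_prop] theorem primrec_getElem? {f : α → List β} {g : α → ℕ} (hf : Primrec f)
    (hg : Primrec g) : Primrec (fun x => (f x)[g x]?) := Primrec.list_getElem?.comp hf hg

@[fun_prop] theorem primrec_length {f : α → List β} (hf : Primrec f) :
    Primrec (fun x => (f x).length) := Primrec.list_length.comp hf

@[fun_prop] theorem primrec_range {f : α → ℕ} (hf : Primrec f) :
    Primrec (fun x => List.range (f x)) := Primrec.list_range.comp hf

@[fun_prop] theorem primrec_map {f : α → List β} {g : α → β → γ} (hf : Primrec f)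
    (hg : Primrec (fun x : α × β => g x.1 x.2)) : Primrec (fun x => (f x).map (g x)) :=
  Primrec.list_map hf hg

@[fun_prop] theorem primrec_flatMap {f : α → List β} {g : α → β → List γ} (hf : Primrec f)
    (hg : Primrec (fun x : α × β => g x.1 x.2)) : Primrec (fun x => (f x).flatMap (g x)) :=
  Primrec.list_flatMap hf hg

theorem primrec_foldr {f : α → List β} {g : α → γ} {h : α → β → γ → γ} (hf : Primrec f)
    (hg : Primrec g) (hh : Primrec (fun x : α × β × γ => h x.1 x.2.1 x.2.2)) :
    Primrec (fun x => (f x).foldr (h x) (g x)) :=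
  Primrec.list_foldr (h := fun x y => h x y.1 y.2) hf hg hh

theorem primrec_rec {f : α → ℕ} {g : α → γ} {h : α → ℕ → γ → γ} (hf : Primrec f)
    (hg : Primrec g) (hh : Primrec (fun x : α × ℕ × γ => h x.1 x.2.1 x.2.2)) :
    Primrec (fun x => (Nat.rec (g x) (h x) (f x) : γ)) :=
  Primrec.nat_rec' (h := fun x y => h x y.1 y.2) hf hg hh

@[fun_prop] theorem primrec_and {f g : α → Bool} (hf : Primrec f) (hg : Primrec g) :
    Primrec (fun x => f x && g x) := Primrec.and.comp hf hg

@[fun_prop] theorem primrec_or {f g : α → Bool} (hf : Primrec f) (hg : Primrec g) :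
    Primrec (fun x => f x || g x) := Primrec.or.comp hf hg

@[fun_prop] theorem primrec_not {f : α → Bool} (hf : Primrec f) :
    Primrec (fun x => !f x) := Primrec.not.comp hf

@[fun_prop] theorem primrec_all {f : α → List β} {p : α → β → Bool} (hf : Primrec f)
    (hp : Primrec (fun x : α × β => p x.1 x.2)) : Primrec (fun x => (f x).all (p x)) := by
  have : (fun x => (f x).all (p x)) =
      fun x => (f x).foldr (fun b r => p x b && r) true := by
    funext x
    induction f x <;> simp_all
  rw [this]
  exact primrec_foldr hf (by fun_prop) (Primrec.and.comp
    (hp.comp (Primrec.fst.pair (Primrec.fst.comp Primrec.snd))) (Primrec.snd.comp Primrec.snd))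

@[fun_prop] theorem primrec_any {f : α → List β} {p : α → β → Bool} (hf : Primrec f)
    (hp : Primrec (fun x : α × β => p x.1 x.2)) : Primrec (fun x => (f x).any (p x)) := by
  have : (fun x => (f x).any (p x)) =
      fun x => (f x).foldr (fun b r => p x b || r) false := by
    funext x
    induction f x <;> simp_all
  rw [this]
  exact primrec_foldr hf (by fun_prop) (Primrec.or.comp
    (hp.comp (Primrec.fst.pair (Primrec.fst.comp Primrec.snd))) (Primrec.snd.comp Primrec.snd))

@[fun_prop] theorem primrec_beq [DecidableEq β] {f g : α → β} (hf : Primrec f) (hg : Primrec g) :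
    Primrec (fun x => decide (f x = g x)) := (Primrec.eq.comp hf hg).decide

@[fun_prop] theorem primrec_decide_lt {f g : α → ℕ} (hf : Primrec f) (hg : Primrec g) :
    Primrec (fun x => decide (f x < g x)) := (Primrec.nat_lt.comp hf hg).decide

@[fun_prop] theorem primrec_ite_bool {c : α → Bool} {f g : α → β} (hc : Primrec c)
    (hf : Primrec f) (hg : Primrec g) : Primrec (fun x => if c x = true then f x else g x) :=
  Primrec.ite (Primrec.eq.comp hc (Primrec.const true)) hf hg

@[fun_prop] theorem primrec_some {f : α → β} (hf : Primrec f) :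
    Primrec (fun x => some (f x)) := Primrec.option_some.comp hf

@[fun_prop] theorem primrec_optionGetD {f : α → Option β} {g : α → β} (hf : Primrec f)
    (hg : Primrec g) : Primrec (fun x => (f x).getD (g x)) := Primrec.option_getD.comp hf hg

@[fun_prop] theorem primrec_optionMap {f : α → Option β} {g : α → β → γ} (hf : Primrec f)
    (hg : Primrec (fun x : α × β => g x.1 x.2)) : Primrec (fun x => (f x).map (g x)) :=
  Primrec.option_map hf hg

end Primrec

/-! ### Constructors for codes -/

section Constructors

def tVar (i : ℕ) : ℕ := Nat.pair 0 i
def tZero : ℕ := Nat.pair 2 0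
def tOne : ℕ := Nat.pair 3 0
def tAdd (s t : ℕ) : ℕ := Nat.pair 4 (Nat.pair s t)
def tMul (s t : ℕ) : ℕ := Nat.pair 5 (Nat.pair s t)
def tPow (s n : ℕ) : ℕ := Nat.rec tOne (fun _ r => tMul r s) n
def tNum (n : ℕ) : ℕ := Nat.rec tZero (fun _ r => tAdd r tOne) n

def fFalse : ℕ := Nat.pair 0 0
def fEq (s t : ℕ) : ℕ := Nat.pair 1 (Nat.pair s t)
def fLt (s t : ℕ) : ℕ := Nat.pair 2 (Nat.pair s t)
def fImp (φ ψ : ℕ) : ℕ := Nat.pair 3 (Nat.pair φ ψ)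
def fAll (φ : ℕ) : ℕ := Nat.pair 4 φ
def fCall (q ψ : ℕ) (l : List ℕ) : ℕ := Nat.pair 5 (Nat.pair q (Nat.pair ψ (Encodable.encode l)))
def fNot (φ : ℕ) : ℕ := fImp φ fFalse
def fAnd (φ ψ : ℕ) : ℕ := fNot (fImp φ (fNot ψ))
def fOr (φ ψ : ℕ) : ℕ := fImp (fNot φ) ψ
def fEx (φ : ℕ) : ℕ := fNot (fAll (fNot φ))
def fAlls (n φ : ℕ) : ℕ := Nat.rec φ (fun _ r => fAll r) n

section Computability

variable {α : Type} [Primcodable α] {f g : α → ℕ} {l : α → List ℕ}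

@[fun_prop] theorem primrec_tVar (hf : Primrec f) : Primrec fun x => tVar (f x) := by
  unfold tVar; fun_prop
@[fun_prop] theorem primrec_tAdd (hf : Primrec f) (hg : Primrec g) :
    Primrec fun x => tAdd (f x) (g x) := by unfold tAdd; fun_prop
@[fun_prop] theorem primrec_tMul (hf : Primrec f) (hg : Primrec g) :
    Primrec fun x => tMul (f x) (g x) := by unfold tMul; fun_prop
@[fun_prop] theorem primrec_tPow (hf : Primrec f) (hg : Primrec g) :
    Primrec fun x => tPow (f x) (g x) := primrec_rec hg (by fun_prop) (by fun_prop)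
@[fun_prop] theorem primrec_tNum (hf : Primrec f) : Primrec fun x => tNum (f x) :=
  primrec_rec hf (by fun_prop) (by fun_prop)
@[fun_prop] theorem primrec_fEq (hf : Primrec f) (hg : Primrec g) :
    Primrec fun x => fEq (f x) (g x) := by unfold fEq; fun_prop
@[fun_prop] theorem primrec_fLt (hf : Primrec f) (hg : Primrec g) :
    Primrec fun x => fLt (f x) (g x) := by unfold fLt; fun_prop
@[fun_prop] theorem primrec_fImp (hf : Primrec f) (hg : Primrec g) :
    Primrec fun x => fImp (f x) (g x) := by unfold fImp; fun_prop
@[fun_prop] theorem primrec_fAll (hf : Primrec f) : Primrec fun x => fAll (f x) := by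
  unfold fAll; fun_prop
@[fun_prop] theorem primrec_fCall (hf : Primrec f) (hg : Primrec g) (hl : Primrec l) :
    Primrec fun x => fCall (f x) (g x) (l x) := by unfold fCall; fun_prop
@[fun_prop] theorem primrec_fNot (hf : Primrec f) : Primrec fun x => fNot (f x) := by
  unfold fNot; fun_prop
@[fun_prop] theorem primrec_fAnd (hf : Primrec f) (hg : Primrec g) :
    Primrec fun x => fAnd (f x) (g x) := by unfold fAnd; fun_prop
@[fun_prop] theorem primrec_fOr (hf : Primrec f) (hg : Primrec g) :
    Primrec fun x => fOr (f x) (g x) := by unfold fOr; fun_prop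
@[fun_prop] theorem primrec_fEx (hf : Primrec f) : Primrec fun x => fEx (f x) := by
  unfold fEx; fun_prop
@[fun_prop] theorem primrec_fAlls (hf : Primrec f) (hg : Primrec g) :
    Primrec fun x => fAlls (f x) (g x) := primrec_rec hf hg (by fun_prop)

end Computability

section Values

variable {K : Type} [Zero K] [One K] [Add K] [Mul K] {p : ℕ} {e : List K}

@[simp] theorem tval_tVar (i : ℕ) : tval p e (tVar i) = e.getD i 0 := tval_free i
@[simp] theorem tval_tZero : tval p e tZero = 0 := tval_zero 0
@[simp] theorem tval_tOne : tval p e tOne = 1 := tval_one 0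
@[simp] theorem tval_tAdd (s t : ℕ) : tval p e (tAdd s t) = tval p e s + tval p e t :=
  tval_add s t
@[simp] theorem tval_tMul (s t : ℕ) : tval p e (tMul s t) = tval p e s * tval p e t :=
  tval_mul s t

variable [LT K]

@[simp] theorem sat_fFalse : ¬ sat fFalse p e := sat_falsum 0
@[simp] theorem sat_fEq (s t : ℕ) : sat (fEq s t) p e ↔ tval p e s = tval p e t := sat_equal s t
@[simp] theorem sat_fLt (s t : ℕ) : sat (fLt s t) p e ↔ tval p e s < tval p e t := sat_lt s t
@[simp] theorem sat_fImp (φ ψ : ℕ) : sat (fImp φ ψ) p e ↔ (sat φ p e → sat ψ p e) := sat_imp φ ψ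
@[simp] theorem sat_fAll (φ : ℕ) : sat (fAll φ) p e ↔ ∀ c : K, sat φ p (e ++ [c]) := sat_all φ
@[simp] theorem sat_fCall (q ψ : ℕ) (l : List ℕ) : sat (fCall q ψ l) p e ↔
    sat ψ q (l.map fun i => e.getD i 0) := sat_call q ψ l
@[simp] theorem sat_fNot (φ : ℕ) : sat (fNot φ) p e ↔ ¬ sat φ p e := by simp [fNot]
@[simp] theorem sat_fAnd (φ ψ : ℕ) : sat (fAnd φ ψ) p e ↔ sat φ p e ∧ sat ψ p e := by
  simp [fAnd]
@[simp] theorem sat_fOr (φ ψ : ℕ) : sat (fOr φ ψ) p e ↔ sat φ p e ∨ sat ψ p e := by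
  simp [fOr, or_iff_not_imp_left]
@[simp] theorem sat_fEx (φ : ℕ) : sat (fEx φ) p e ↔ ∃ c : K, sat φ p (e ++ [c]) := by
  simp [fEx]

@[simp] theorem sat_fAlls (n φ : ℕ) :
    ∀ e : List K, sat (fAlls n φ) p e ↔ ∀ l : List K, l.length = n → sat φ p (e ++ l) := by
  induction n with
  | zero => intro e; simp [fAlls]
  | succ n ih =>
    intro e
    have : fAlls (n + 1) φ = fAll (fAlls n φ) := rfl
    rw [this, sat_fAll]
    constructor
    · intro h l hl
      cases l with
      | nil => simp at hl
      | cons c l =>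
        have := (ih _).1 (h c) l (by simpa using hl)
        simpa using this
    · intro h c
      rw [ih]
      intro l hl
      have := h (c :: l) (by simpa using hl)
      simpa using this

end Values

section SemiringValues

variable {K : Type} [Field K] {p : ℕ} {e : List K}

@[simp] theorem tval_tPow (s n : ℕ) : tval p e (tPow s n) = tval p e s ^ n := by
  induction n with
  | zero => simp [tPow]
  | succ n ih =>
    have : tPow s (n + 1) = tMul (tPow s n) s := rfl
    rw [this, tval_tMul, ih, pow_succ]

@[simp] theorem tval_tNum (n : ℕ) : tval p e (tNum n) = n := by
  induction n with
  | zero => simp [tNum]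
  | succ n ih =>
    have : tNum (n + 1) = tAdd (tNum n) tOne := rfl
    rw [this, tval_tAdd, ih, tval_tOne, Nat.cast_succ]

end SemiringValues

end Constructors

/-! ### Axioms -/

/-- The polynomial of length `n` with coefficients `x_0, x_1, …`, at the term `s`. -/
def tPoly (n s : ℕ) : ℕ := Nat.rec tZero (fun i r => tAdd r (tMul (tVar i) (tPow s i))) n

/-- The derivative of the polynomial of length `n` with coefficients `x_0, x_1, …`. -/
def tDeriv (n s : ℕ) : ℕ :=
  Nat.rec tZero (fun i r => tAdd r (tMul (tMul (tVar i) (tNum i)) (tPow s (i - 1)))) n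

/-- The intermediate value theorem for polynomials of length `n`. -/
def ivtAxiom (n : ℕ) : ℕ :=
  fAlls n (fAll (fAll (fImp (fLt (tVar n) (tVar (n + 1)))
    (fImp (fLt (tPoly n (tVar n)) tZero) (fImp (fLt tZero (tPoly n (tVar (n + 1))))
      (fEx (fAnd (fLt (tVar n) (tVar (n + 2))) (fAnd (fLt (tVar (n + 2)) (tVar (n + 1)))
        (fEq (tPoly n (tVar (n + 2))) tZero)))))))))

/-- The mean value theorem for polynomials of length `n`. -/
def mvtAxiom (n : ℕ) : ℕ :=
  fAlls n (fAll (fAll (fImp (fLt (tVar n) (tVar (n + 1)))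
      (fEx (fAnd (fLt (tVar n) (tVar (n + 2))) (fAnd (fLt (tVar (n + 2)) (tVar (n + 1)))
        -- `P(b) - P(a) = P'(c)(b - a)` with the negative terms moved across, since the language has
        -- no subtraction.
        (fEq (tAdd (tPoly n (tVar (n + 1))) (tMul (tDeriv n (tVar (n + 2))) (tVar n)))
          (tAdd (tPoly n (tVar n)) (tMul (tDeriv n (tVar (n + 2))) (tVar (n + 1)))))))))))

/-- The axioms of ordered fields, and the schemes for the intermediate value theorem and the mean
value theorem. -/
def axiomList (n : ℕ) : List ℕ :=
  let x := tVar 0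
  let y := tVar 1
  let z := tVar 2
  [fAll (fAll (fEq (tAdd x y) (tAdd y x))),
   fAll (fAll (fAll (fEq (tAdd (tAdd x y) z) (tAdd x (tAdd y z))))),
   fAll (fEq (tAdd tZero x) x),
   fAll (fEx (fEq (tAdd y x) tZero)),
   fAll (fAll (fEq (tMul x y) (tMul y x))),
   fAll (fAll (fAll (fEq (tMul (tMul x y) z) (tMul x (tMul y z))))),
   fAll (fEq (tMul tOne x) x),
   fAll (fAll (fAll (fEq (tMul x (tAdd y z)) (tAdd (tMul x y) (tMul x z))))),
   fAll (fImp (fNot (fEq x tZero)) (fEx (fEq (tMul x y) tOne))),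
   fLt tZero tOne,
   fAll (fNot (fLt x x)),
   fAll (fAll (fAll (fImp (fLt x y) (fImp (fLt y z) (fLt x z))))),
   fAll (fAll (fOr (fLt x y) (fOr (fEq x y) (fLt y x)))),
   fAll (fAll (fAll (fImp (fLt x y) (fLt (tAdd z x) (tAdd z y))))),
   fAll (fAll (fImp (fLt tZero x) (fImp (fLt tZero y) (fLt tZero (tMul x y))))),
   ivtAxiom n, mvtAxiom n]

section AxiomComputability

variable {α : Type} [Primcodable α] {f g : α → ℕ}

@[fun_prop] theorem primrec_tPoly (hf : Primrec f) (hg : Primrec g) :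
    Primrec fun x => tPoly (f x) (g x) := primrec_rec hf (by fun_prop) (by fun_prop)

@[fun_prop] theorem primrec_tDeriv (hf : Primrec f) (hg : Primrec g) :
    Primrec fun x => tDeriv (f x) (g x) := primrec_rec hf (by fun_prop) (by fun_prop)

@[fun_prop] theorem primrec_ivtAxiom (hf : Primrec f) : Primrec fun x => ivtAxiom (f x) := by
  unfold ivtAxiom; fun_prop

@[fun_prop] theorem primrec_mvtAxiom (hf : Primrec f) : Primrec fun x => mvtAxiom (f x) := by
  unfold mvtAxiom; fun_prop

@[fun_prop] theorem primrec_axiomList (hf : Primrec f) : Primrec fun x => axiomList (f x) := by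
  unfold axiomList; fun_prop

end AxiomComputability

section AxiomValues

open Polynomial

variable {K : Type} [Field K] {p : ℕ} {e : List K}

theorem tval_tPoly (n s : ℕ) :
    tval p e (tPoly n s) = ∑ i ∈ Finset.range n, e.getD i 0 * tval p e s ^ i := by
  induction n with
  | zero => simp [tPoly]
  | succ n ih =>
    have : tPoly (n + 1) s = tAdd (tPoly n s) (tMul (tVar n) (tPow s n)) := rfl
    rw [this, tval_tAdd, ih, tval_tMul, tval_tVar, tval_tPow, Finset.sum_range_succ]

theorem tval_tDeriv (n s : ℕ) : tval p e (tDeriv n s) =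
    ∑ i ∈ Finset.range n, e.getD i 0 * i * tval p e s ^ (i - 1) := by
  induction n with
  | zero => simp [tDeriv]
  | succ n ih =>
    have : tDeriv (n + 1) s =
      tAdd (tDeriv n s) (tMul (tMul (tVar n) (tNum n)) (tPow s (n - 1))) := rfl
    rw [this, tval_tAdd, ih, tval_tMul, tval_tMul, tval_tVar, tval_tPow, tval_tNum,
      Finset.sum_range_succ]

/-- The polynomial with given list of coefficients. -/
noncomputable def listPoly (l : List K) : K[X] :=
  ∑ i ∈ Finset.range l.length, C (l.getD i 0) * X ^ i

theorem eval_listPoly (l : List K) (e : List K) (s : ℕ) :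
    tval p (l ++ e) (tPoly l.length s) = (listPoly l).eval (tval p (l ++ e) s) := by
  rw [tval_tPoly, listPoly, eval_finsetSum]
  refine Finset.sum_congr rfl fun i hi => ?_
  rw [List.getD_append _ _ _ _ (by simpa using hi)]
  simp

theorem eval_derivative_listPoly (l : List K) (e : List K) (s : ℕ) :
    tval p (l ++ e) (tDeriv l.length s) =
      (derivative (listPoly l)).eval (tval p (l ++ e) s) := by
  rw [tval_tDeriv, listPoly, derivative_sum, eval_finsetSum]
  refine Finset.sum_congr rfl fun i hi => ?_
  rw [List.getD_append _ _ _ _ (by simpa using hi), derivative_C_mul_X_pow]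
  simp

theorem listPoly_coeff (P : K[X]) :
    listPoly ((List.range (P.natDegree + 1)).map P.coeff) = P := by
  conv_rhs => rw [P.as_sum_range_C_mul_X_pow]
  rw [listPoly]
  simp only [List.length_map, List.length_range]
  refine Finset.sum_congr rfl fun i hi => ?_
  rw [Finset.mem_range] at hi
  simp [hi]

theorem sat_ivtAxiom [LinearOrder K] (n : ℕ) : sat (ivtAxiom n) p ([] : List K) ↔
    ∀ l : List K, l.length = n → ∀ a b : K, a < b → (listPoly l).eval a < 0 →
      0 < (listPoly l).eval b → ∃ c, a < c ∧ c < b ∧ (listPoly l).eval c = 0 := by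
  rw [ivtAxiom, sat_fAlls]
  refine forall₂_congr fun l hl => ?_
  subst hl
  simp [eval_listPoly]

theorem sat_mvtAxiom [LinearOrder K] (n : ℕ) : sat (mvtAxiom n) p ([] : List K) ↔
    ∀ l : List K, l.length = n → ∀ a b : K, a < b → ∃ c, a < c ∧ c < b ∧
      (listPoly l).eval b - (listPoly l).eval a =
        (derivative (listPoly l)).eval c * (b - a) := by
  rw [mvtAxiom, sat_fAlls]
  refine forall₂_congr fun l hl => ?_
  subst hl
  simp only [List.nil_append, sat_fAll, List.append_assoc, List.cons_append, sat_fImp, sat_fLt,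
    sat_fEx, sat_fAnd, sat_fEq, tval_tAdd, tval_tMul, eval_listPoly, eval_derivative_listPoly]
  simp
  refine forall₃_congr fun a b _ => exists_congr fun c => and_congr_right fun _ =>
    and_congr_right fun _ => ?_
  constructor <;> intro h <;> linear_combination h

/-- A polynomial is given by its `natDegree + 1` coefficients, so the schemes over all lengths say
exactly what the class requires. -/
theorem polynomialIVT_iff [LinearOrder K] [IsStrictOrderedRing K] : PolynomialIVT K ↔
    ∀ n, sat (ivtAxiom n) 0 ([] : List K) ∧ sat (mvtAxiom n) 0 ([] : List K) := by
  constructor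
  · exact fun h n => ⟨(sat_ivtAxiom n).2 fun l _ => h.ivt _, (sat_mvtAxiom n).2 fun l _ => h.mvt _⟩
  · intro h
    refine ⟨fun P => ?_, fun P => ?_⟩
    · have := (sat_ivtAxiom _).1 (h (P.natDegree + 1)).1 ((List.range (P.natDegree + 1)).map P.coeff)
        (by simp)
      rwa [listPoly_coeff] at this
    · have := (sat_mvtAxiom _).1 (h (P.natDegree + 1)).2 ((List.range (P.natDegree + 1)).map P.coeff)
        (by simp)
      rwa [listPoly_coeff] at this

theorem sat_axiomList_real (n : ℕ) : ∀ φ ∈ axiomList n, sat φ 0 ([] : List ℝ) := by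
  have h := (polynomialIVT_iff (K := ℝ)).1 inferInstance n
  simp only [axiomList, List.forall_mem_cons]
  refine ⟨?_, ?_, ?_, ?_, ?_, ?_, ?_, ?_, ?_, ?_, ?_, ?_, ?_, ?_, ?_, h.1, h.2, by simp⟩ <;> simp
  · exact fun x y => add_comm x y
  · exact fun x y z => add_assoc x y z
  · exact fun x => ⟨-x, by simp⟩
  · exact fun x y => mul_comm x y
  · exact fun x y z => mul_assoc x y z
  · exact fun x y z => mul_add x y z
  · exact fun x hx => ⟨x⁻¹, mul_inv_cancel₀ hx⟩
  · exact fun x y z => lt_trans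
  · exact fun x y => lt_trichotomy x y
  · exact fun x y => mul_pos

end AxiomValues

end OrderedRings

namespace OrderedRings

/-! ### A system of clauses for Henkin models -/

section Clauses

/-- Constants of the Henkin language: closed under the operations, the values of terms at lists of
constants, and witnesses against universal formulas at lists of constants. -/
def cZero : ℕ := Nat.pair 0 0
def cOne : ℕ := Nat.pair 1 0
def cAdd (a b : ℕ) : ℕ := Nat.pair 2 (Nat.pair a b)
def cMul (a b : ℕ) : ℕ := Nat.pair 3 (Nat.pair a b)
def cTerm (p t : ℕ) (e : List ℕ) : ℕ := Nat.pair 4 (Nat.pair p (Nat.pair t (Encodable.encode e)))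
def cWit (p φ : ℕ) (e : List ℕ) : ℕ := Nat.pair 5 (Nat.pair p (Nat.pair φ (Encodable.encode e)))

/-- Propositions about constants: equality, order, and truth of a formula at a list of constants. -/
def pEq (a b : ℕ) : ℕ := Nat.pair 0 (Nat.pair a b)
def pLt (a b : ℕ) : ℕ := Nat.pair 1 (Nat.pair a b)
def pSat (φ p : ℕ) (e : List ℕ) : ℕ := Nat.pair 2 (Nat.pair φ (Nat.pair p (Encodable.encode e)))

section

variable {α : Type} [Primcodable α] {f g : α → ℕ} {l : α → List ℕ}

@[fun_prop] theorem primrec_cAdd (hf : Primrec f) (hg : Primrec g) :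
    Primrec fun x => cAdd (f x) (g x) := by unfold cAdd; fun_prop
@[fun_prop] theorem primrec_cMul (hf : Primrec f) (hg : Primrec g) :
    Primrec fun x => cMul (f x) (g x) := by unfold cMul; fun_prop
@[fun_prop] theorem primrec_cTerm (hf : Primrec f) (hg : Primrec g) (hl : Primrec l) :
    Primrec fun x => cTerm (f x) (g x) (l x) := by unfold cTerm; fun_prop
@[fun_prop] theorem primrec_cWit (hf : Primrec f) (hg : Primrec g) (hl : Primrec l) :
    Primrec fun x => cWit (f x) (g x) (l x) := by unfold cWit; fun_prop
@[fun_prop] theorem primrec_pEq (hf : Primrec f) (hg : Primrec g) :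
    Primrec fun x => pEq (f x) (g x) := by unfold pEq; fun_prop
@[fun_prop] theorem primrec_pLt (hf : Primrec f) (hg : Primrec g) :
    Primrec fun x => pLt (f x) (g x) := by unfold pLt; fun_prop
@[fun_prop] theorem primrec_pSat (hf : Primrec f) (hg : Primrec g) (hl : Primrec l) :
    Primrec fun x => pSat (f x) (g x) (l x) := by unfold pSat; fun_prop

end

/-- A clause: a disjunction of propositions and negated propositions. -/
abbrev Clause := List (ℕ × Bool)

/-- Equality is a congruence. -/
def eqClauses (a b c d : ℕ) : List Clause :=
  [[(pEq a a, true)],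
   [(pEq a b, false), (pEq b a, true)],
   [(pEq a b, false), (pEq b c, false), (pEq a c, true)],
   [(pEq a b, false), (pEq c d, false), (pEq (cAdd a c) (cAdd b d), true)],
   [(pEq a b, false), (pEq c d, false), (pEq (cMul a c) (cMul b d), true)],
   [(pEq a b, false), (pEq c d, false), (pLt a c, false), (pLt b d, true)]]

/-- Evaluation of terms. -/
def termClauses (p s t : ℕ) (e : List ℕ) : List Clause :=
  [[(pEq (cTerm p (Nat.pair 0 s) e) (e.getD s cZero), true)],
   [(pEq (cTerm p (Nat.pair 1 s) e) (e.getD (p + s) cZero), true)],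
   [(pEq (cTerm p (Nat.pair 2 s) e) cZero, true)],
   [(pEq (cTerm p (Nat.pair 3 s) e) cOne, true)],
   [(pEq (cTerm p (Nat.pair 4 (Nat.pair s t)) e) (cAdd (cTerm p s e) (cTerm p t e)), true)],
   [(pEq (cTerm p (Nat.pair 5 (Nat.pair s t)) e) (cMul (cTerm p s e) (cTerm p t e)), true)],
   [(pEq (cTerm p (Nat.pair (s + 6) t) e) cZero, true)]]

/-- Truth of formulas. -/
def formulaClauses (p s t : ℕ) (e l : List ℕ) : List Clause :=
  [[(pSat (Nat.pair 0 s) p e, false)],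
   [(pSat (Nat.pair 1 (Nat.pair s t)) p e, false), (pEq (cTerm p s e) (cTerm p t e), true)],
   [(pSat (Nat.pair 1 (Nat.pair s t)) p e, true), (pEq (cTerm p s e) (cTerm p t e), false)],
   [(pSat (Nat.pair 2 (Nat.pair s t)) p e, false), (pLt (cTerm p s e) (cTerm p t e), true)],
   [(pSat (Nat.pair 2 (Nat.pair s t)) p e, true), (pLt (cTerm p s e) (cTerm p t e), false)],
   [(pSat (Nat.pair 3 (Nat.pair s t)) p e, false), (pSat s p e, false), (pSat t p e, true)],
   [(pSat (Nat.pair 3 (Nat.pair s t)) p e, true), (pSat s p e, true)],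
   [(pSat (Nat.pair 3 (Nat.pair s t)) p e, true), (pSat t p e, false)],
   [(pSat (Nat.pair 4 s) p e, false), (pSat s p (e ++ [t]), true)],
   [(pSat (Nat.pair 4 s) p e, true), (pSat s p (e ++ [cWit p s e]), false)],
   [(pSat (Nat.pair 5 (Nat.pair s (Nat.pair t (Encodable.encode l)))) p e, false),
    (pSat t s (l.map fun i => e.getD i cZero), true)],
   [(pSat (Nat.pair 5 (Nat.pair s (Nat.pair t (Encodable.encode l)))) p e, true),
    (pSat t s (l.map fun i => e.getD i cZero), false)],
   [(pSat (Nat.pair (s + 6) t) p e, false)]]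

/-- All clauses with the given parameters. -/
def clauses (d : (ℕ × ℕ × ℕ × ℕ) × List ℕ × List ℕ) : List Clause :=
  eqClauses d.1.1 d.1.2.1 d.1.2.2.1 d.1.2.2.2 ++ (termClauses d.1.1 d.1.2.1 d.1.2.2.1 d.2.1 ++
    (formulaClauses d.1.1 d.1.2.1 d.1.2.2.1 d.2.1 d.2.2 ++
      (axiomList d.1.1).map fun φ => [(pSat φ 0 [], true)]))

theorem primrec_clauses : Primrec clauses := by
  unfold clauses
  refine primrec_append ?_ (primrec_append ?_ (primrec_append ?_ ?_))
  · unfold eqClauses; fun_prop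
  · unfold termClauses; fun_prop
  · unfold formulaClauses; fun_prop
  · fun_prop

/-- A valuation satisfying every clause. -/
def IsModel (v : ℕ → Bool) : Prop := ∀ d, ∀ c ∈ clauses d, ∃ l ∈ c, v l.1 = l.2

end Clauses

/-! ### The valuation given by the real numbers -/

section Soundness

/-- Makes the recursion in `interp` well-founded: the constants listed inside a code are smaller
than that code. -/
theorem lt_encode_of_mem {c : ℕ} : ∀ {l : List ℕ}, c ∈ l → c < Encodable.encode l
  | a :: l, h => by
    rw [Encodable.encode_list_cons, Encodable.encode_nat]
    rcases List.mem_cons.1 h with rfl | h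
    · exact Nat.lt_succ_of_le (Nat.left_le_pair _ _)
    · exact (lt_encode_of_mem h).trans_le ((Nat.right_le_pair _ _).trans (Nat.le_succ _))

/-- Interpretation of the Henkin constants in the real numbers. -/
noncomputable def interp (n : ℕ) : ℝ :=
  match h : n.unpair with
  | (1, _) => 1
  | (2, x) =>
    have : x < n := by rw [← Nat.pair_unpair n, h]; exact lt_pair_right (by simp)
    have := Nat.unpair_left_le x
    have := Nat.unpair_right_le x
    interp x.unpair.1 + interp x.unpair.2
  | (3, x) =>
    have : x < n := by rw [← Nat.pair_unpair n, h]; exact lt_pair_right (by simp)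
    have := Nat.unpair_left_le x
    have := Nat.unpair_right_le x
    interp x.unpair.1 * interp x.unpair.2
  | (4, x) =>
    -- The test `c < n` holds for every listed constant (`map_interp_of_encode_le`); it is there to
    -- justify termination. The default value is never used.
    tval x.unpair.1 ((Denumerable.ofNat (List ℕ) x.unpair.2.unpair.2).map
      fun c => if _h : c < n then interp c else 0) x.unpair.2.unpair.1
  | (5, x) =>
    Classical.epsilon fun r => ¬ sat x.unpair.2.unpair.1 x.unpair.1
      ((Denumerable.ofNat (List ℕ) x.unpair.2.unpair.2).map
        (fun c => if _ : c < n then interp c else 0) ++ [r])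
  | _ => 0
termination_by n
decreasing_by all_goals omega

theorem interp_cZero : interp cZero = 0 := by
  rw [cZero, interp]; split <;> rename_i h <;> rw [Nat.unpair_pair] at h <;> simp_all

theorem interp_cOne : interp cOne = 1 := by
  rw [cOne, interp]; split <;> rename_i h <;> rw [Nat.unpair_pair] at h <;> simp_all

theorem interp_cAdd (a b : ℕ) : interp (cAdd a b) = interp a + interp b := by
  rw [cAdd, interp]; split <;> rename_i h <;> rw [Nat.unpair_pair] at h <;> simp_all
  rw [← h]; simp

theorem interp_cMul (a b : ℕ) : interp (cMul a b) = interp a * interp b := by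
  rw [cMul, interp]; split <;> rename_i h <;> rw [Nat.unpair_pair] at h <;> simp_all
  rw [← h]; simp

theorem map_interp_of_encode_le {n : ℕ} {e : List ℕ} (h : Encodable.encode e ≤ n) :
    (e.map fun c => if _ : c < n then interp c else 0) = e.map interp :=
  List.map_congr_left fun _ hc => dif_pos ((lt_encode_of_mem hc).trans_le h)

theorem encode_le_pair (k p t : ℕ) (e : List ℕ) :
    Encodable.encode e ≤ Nat.pair k (Nat.pair p (Nat.pair t (Encodable.encode e))) :=
  (Nat.right_le_pair _ _).trans ((Nat.right_le_pair _ _).trans (Nat.right_le_pair _ _))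

theorem interp_cTerm (p t : ℕ) (e : List ℕ) :
    interp (cTerm p t e) = tval p (e.map interp) t := by
  rw [← map_interp_of_encode_le (encode_le_pair 4 p t e), cTerm, interp]
  split <;> rename_i h <;> rw [Nat.unpair_pair] at h <;> simp_all
  rw [← h]; simp

/-- The witness is chosen as a counterexample whenever there is one. If even it satisfies the
formula, there is none. -/
theorem interp_cWit (p φ : ℕ) (e : List ℕ) (h : sat φ p (e.map interp ++ [interp (cWit p φ e)])) :
    ∀ r, sat φ p (e.map interp ++ [r]) := by
  have hw : interp (cWit p φ e) =
      Classical.epsilon fun r => ¬ sat φ p (e.map interp ++ [r]) := by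
    rw [← map_interp_of_encode_le (encode_le_pair 5 p φ e), cWit, interp]
    split <;> rename_i h <;> rw [Nat.unpair_pair] at h <;> simp_all
    rw [← h]; simp
  intro r
  by_contra hr
  have := Classical.epsilon_spec (p := fun r => ¬ sat φ p (e.map interp ++ [r])) ⟨r, hr⟩
  rw [hw] at h
  exact this h

/-- Truth of the propositions about constants in the real numbers. -/
def realVal (n : ℕ) : Prop :=
  match n.unpair with
  | (0, x) => interp x.unpair.1 = interp x.unpair.2
  | (1, x) => interp x.unpair.1 < interp x.unpair.2
  | (2, x) => sat x.unpair.1 x.unpair.2.unpair.1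
      ((Denumerable.ofNat (List ℕ) x.unpair.2.unpair.2).map interp)
  | _ => False

theorem realVal_pEq (a b : ℕ) : realVal (pEq a b) ↔ interp a = interp b := by
  simp [pEq, realVal]

theorem realVal_pLt (a b : ℕ) : realVal (pLt a b) ↔ interp a < interp b := by
  simp [pLt, realVal]

theorem realVal_pSat (φ p : ℕ) (e : List ℕ) : realVal (pSat φ p e) ↔ sat φ p (e.map interp) := by
  simp [pSat, realVal]

theorem exists_mem_cons_iff {α : Type} (P : α → Prop) (a : α) (l : List α) :
    (∃ x ∈ a :: l, P x) ↔ P a ∨ ∃ x ∈ l, P x := by simp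

-- Soundness of the clauses: with constants read as real numbers, each clause expresses a law of
-- equality, a step in the evaluation of terms or formulas, or an axiom true in `ℝ`.
open scoped Classical in
theorem isModel_realVal : IsModel fun n => decide (realVal n) := by
  rintro ⟨⟨a, b, c, d⟩, e, l⟩
  simp only [clauses, List.forall_mem_append]
  have hget : ∀ i, (e.map interp).getD i 0 = interp (e.getD i cZero) := fun i => by
    rw [← interp_cZero, List.getD_map]
  refine ⟨?_, ?_, ?_, ?_⟩
  · simp only [eqClauses, List.forall_mem_cons, exists_mem_cons_iff, List.not_mem_nil, false_and,
      exists_false, or_false, decide_eq_true_eq, decide_eq_false_iff_not, realVal_pEq, realVal_pLt,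
      interp_cAdd, interp_cMul, IsEmpty.forall_iff, implies_true, and_true, true_and]
    refine ⟨?_, ?_, ?_, ?_, ?_⟩
    · by_cases h : interp a = interp b <;> simp [h]
    · by_cases h : interp a = interp b
      · simp only [h]; tauto
      · simp [h]
    · by_cases h : interp a = interp b <;> by_cases h' : interp c = interp d <;> simp [h, h']
    · by_cases h : interp a = interp b <;> by_cases h' : interp c = interp d <;> simp [h, h']
    · by_cases h : interp a = interp b <;> by_cases h' : interp c = interp d <;>
        simp [h, h', le_or_gt]
  · simp [termClauses, realVal_pEq, interp_cTerm, interp_cAdd, interp_cMul, interp_cZero,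
      interp_cOne, tval_free, tval_bound, tval_zero, tval_one, tval_add, tval_mul, tval_other,
      hget, -List.getD_eq_getElem?_getD]
  · have hmap : (l.map fun i => e.getD i cZero).map interp =
        l.map fun i => (e.map interp).getD i 0 := by
      rw [List.map_map]
      exact List.map_congr_left fun i _ => (hget i).symm
    simp only [formulaClauses, List.forall_mem_cons, exists_mem_cons_iff, List.not_mem_nil,
      false_and, exists_false, or_false, decide_eq_true_eq, decide_eq_false_iff_not, realVal_pEq,
      realVal_pLt, realVal_pSat, interp_cTerm, IsEmpty.forall_iff, implies_true, and_true,
      sat_equal, sat_lt, sat_imp, sat_all, sat_call, hmap, sat_falsum, sat_other, not_false_eq_true,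
      true_and,  List.map_append, List.map_cons, List.map_nil]
    refine ⟨?_, ?_, ?_, ?_, ?_, ?_, ?_, ?_, ?_, by tauto, by tauto⟩
    · tauto
    · tauto
    · tauto
    · tauto
    · tauto
    · tauto
    · tauto
    · by_cases h : ∀ r, sat b a (e.map interp ++ [r])
      · exact Or.inr (h _)
      · exact Or.inl h
    · by_cases h : sat b a (e.map interp ++ [interp (cWit a b e)])
      · exact Or.inl (interp_cWit a b e h)
      · exact Or.inr h
  · intro cl hcl
    obtain ⟨φ, hφ, rfl⟩ := List.mem_map.1 hcl
    exact ⟨_, List.mem_singleton_self _, by simpa [realVal_pSat] using sat_axiomList_real a φ hφ⟩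

end Soundness

end OrderedRings

namespace OrderedRings

/-! ### The Henkin model of a valuation -/

section Facts

variable {v : ℕ → Bool}

theorem IsModel.eqFacts (hv : IsModel v) (a b c d : ℕ) :
    v (pEq a a) = true ∧ (v (pEq a b) = true → v (pEq b a) = true) ∧
    (v (pEq a b) = true → v (pEq b c) = true → v (pEq a c) = true) ∧
    (v (pEq a b) = true → v (pEq c d) = true → v (pEq (cAdd a c) (cAdd b d)) = true) ∧
    (v (pEq a b) = true → v (pEq c d) = true → v (pEq (cMul a c) (cMul b d)) = true) ∧
    (v (pEq a b) = true → v (pEq c d) = true → v (pLt a c) = true → v (pLt b d) = true) := by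
  have h := hv ((a, b, c, d), [], [])
  simp only [clauses, List.forall_mem_append] at h
  have h := h.1
  simp only [eqClauses, List.forall_mem_cons, exists_mem_cons_iff, List.not_mem_nil, false_and,
    exists_false, or_false, IsEmpty.forall_iff, implies_true, and_true, ← Bool.not_eq_true] at h
  obtain ⟨h1, h2, h3, h4, h5, h6⟩ := h
  exact ⟨h1, fun x => h2.resolve_left (absurd x),
    fun x y => (h3.resolve_left (absurd x)).resolve_left (absurd y),
    fun x y => (h4.resolve_left (absurd x)).resolve_left (absurd y),
    fun x y => (h5.resolve_left (absurd x)).resolve_left (absurd y),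
    fun x y z => ((h6.resolve_left (absurd x)).resolve_left (absurd y)).resolve_left (absurd z)⟩

theorem IsModel.termFacts (hv : IsModel v) (p s t : ℕ) (e : List ℕ) :
    v (pEq (cTerm p (Nat.pair 0 s) e) (e.getD s cZero)) = true ∧
    v (pEq (cTerm p (Nat.pair 1 s) e) (e.getD (p + s) cZero)) = true ∧
    v (pEq (cTerm p (Nat.pair 2 s) e) cZero) = true ∧
    v (pEq (cTerm p (Nat.pair 3 s) e) cOne) = true ∧
    v (pEq (cTerm p (Nat.pair 4 (Nat.pair s t)) e) (cAdd (cTerm p s e) (cTerm p t e))) = true ∧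
    v (pEq (cTerm p (Nat.pair 5 (Nat.pair s t)) e) (cMul (cTerm p s e) (cTerm p t e))) = true ∧
    v (pEq (cTerm p (Nat.pair (s + 6) t) e) cZero) = true := by
  have h := hv ((p, s, t, 0), e, [])
  simp only [clauses, List.forall_mem_append] at h
  have h := h.2.1
  simp only [termClauses, List.forall_mem_cons, exists_mem_cons_iff, List.not_mem_nil, false_and,
    exists_false, or_false, IsEmpty.forall_iff, implies_true, and_true] at h
  exact h

/-- The clauses, in both polarities, amount to the defining conditions of truth. A universal formula
implies each of its instances at constants, and conversely the instance at its own witness implies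
it. -/
theorem IsModel.formulaFacts (hv : IsModel v) (p s t : ℕ) (e l : List ℕ) :
    ¬ v (pSat (Nat.pair 0 s) p e) = true ∧
    (v (pSat (Nat.pair 1 (Nat.pair s t)) p e) = true ↔
      v (pEq (cTerm p s e) (cTerm p t e)) = true) ∧
    (v (pSat (Nat.pair 2 (Nat.pair s t)) p e) = true ↔
      v (pLt (cTerm p s e) (cTerm p t e)) = true) ∧
    (v (pSat (Nat.pair 3 (Nat.pair s t)) p e) = true ↔
      (v (pSat s p e) = true → v (pSat t p e) = true)) ∧
    (v (pSat (Nat.pair 4 s) p e) = true → v (pSat s p (e ++ [t])) = true) ∧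
    (v (pSat s p (e ++ [cWit p s e])) = true → v (pSat (Nat.pair 4 s) p e) = true) ∧
    (v (pSat (Nat.pair 5 (Nat.pair s (Nat.pair t (Encodable.encode l)))) p e) = true ↔
      v (pSat t s (l.map fun i => e.getD i cZero)) = true) ∧
    ¬ v (pSat (Nat.pair (s + 6) t) p e) = true := by
  have h := hv ((p, s, t, 0), e, l)
  simp only [clauses, List.forall_mem_append] at h
  have h := h.2.2.1
  simp only [formulaClauses, List.forall_mem_cons, exists_mem_cons_iff, List.not_mem_nil, false_and,
    exists_false, or_false, IsEmpty.forall_iff, implies_true, and_true, ← Bool.not_eq_true] at h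
  obtain ⟨h1, h2, h3, h4, h5, h6, h7, h8, h9, h10, h11, h12, h13⟩ := h
  exact ⟨h1, ⟨fun x => h2.resolve_left (absurd x), fun x => h3.resolve_right (absurd x)⟩,
    ⟨fun x => h4.resolve_left (absurd x), fun x => h5.resolve_right (absurd x)⟩,
    ⟨fun x => imp_iff_not_or.2 (h6.resolve_left (absurd x)), fun x => h7.elim id fun y =>
      h8.resolve_right (absurd (x y))⟩,
    fun x => h9.resolve_left (absurd x), fun x => h10.resolve_right (absurd x),
    ⟨fun x => h11.resolve_left (absurd x), fun x => h12.resolve_right (absurd x)⟩, h13⟩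

theorem IsModel.axiomFacts (hv : IsModel v) (n : ℕ) : ∀ φ ∈ axiomList n, v (pSat φ 0 []) = true := by
  intro φ hφ
  have h := hv ((n, 0, 0, 0), [], [])
  simp only [clauses, List.forall_mem_append] at h
  simpa using h.2.2.2 _ (List.mem_map_of_mem hφ)

end Facts

/-- Equality of constants under a valuation. -/
def modelSetoid (v : ℕ → Bool) (hv : IsModel v) : Setoid ℕ where
  r a b := v (pEq a b) = true
  iseqv := ⟨fun a => (hv.eqFacts a 0 0 0).1, fun {a b} => (hv.eqFacts a b 0 0).2.1,
    fun {a b c} => (hv.eqFacts a b c 0).2.2.1⟩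

/-- The Henkin model of a valuation. -/
def Model (v : ℕ → Bool) (hv : IsModel v) : Type := Quotient (modelSetoid v hv)

namespace Model

variable {v : ℕ → Bool} {hv : IsModel v}

def mk (c : ℕ) : Model v hv := Quotient.mk (modelSetoid v hv) c

theorem mk_surjective : Function.Surjective (mk : ℕ → Model v hv) := Quotient.mk_surjective

theorem mk_eq_mk {a b : ℕ} : (mk a : Model v hv) = mk b ↔ v (pEq a b) = true := Quotient.eq

instance : Zero (Model v hv) := ⟨mk cZero⟩
instance : One (Model v hv) := ⟨mk cOne⟩
instance : Add (Model v hv) := ⟨Quotient.map₂ cAdd fun a b h c d h' =>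
  (hv.eqFacts a b c d).2.2.2.1 h h'⟩
instance : Mul (Model v hv) := ⟨Quotient.map₂ cMul fun a b h c d h' =>
  (hv.eqFacts a b c d).2.2.2.2.1 h h'⟩
instance : LT (Model v hv) := ⟨Quotient.lift₂ (fun a b => v (pLt a b) = true)
  fun a c b d (h : v (pEq a b) = true) (h' : v (pEq c d) = true) =>
    propext ⟨(hv.eqFacts a b c d).2.2.2.2.2 h h',
      (hv.eqFacts b a d c).2.2.2.2.2 ((hv.eqFacts a b 0 0).2.1 h) ((hv.eqFacts c d 0 0).2.1 h')⟩⟩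

theorem mk_cZero : (mk cZero : Model v hv) = 0 := rfl
theorem mk_cOne : (mk cOne : Model v hv) = 1 := rfl
theorem mk_cAdd (a b : ℕ) : (mk (cAdd a b) : Model v hv) = mk a + mk b := rfl
theorem mk_cMul (a b : ℕ) : (mk (cMul a b) : Model v hv) = mk a * mk b := rfl
theorem mk_lt_mk {a b : ℕ} : (mk a : Model v hv) < mk b ↔ v (pLt a b) = true := Iff.rfl

theorem getD_map_mk (e : List ℕ) (i : ℕ) :
    (e.map (mk : ℕ → Model v hv)).getD i 0 = mk (e.getD i cZero) := by
  rw [← mk_cZero, List.getD_map]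

theorem mk_cTerm (p : ℕ) (e : List ℕ) (t : ℕ) :
    (mk (cTerm p t e) : Model v hv) = tval p (e.map mk) t := by
  induction t using termCode_induction with
  | free i => rw [tval_free, getD_map_mk, mk_eq_mk]; exact (hv.termFacts p i 0 e).1
  | bound i => rw [tval_bound, getD_map_mk, mk_eq_mk]; exact (hv.termFacts p i 0 e).2.1
  | zero i => rw [tval_zero, ← mk_cZero, mk_eq_mk]; exact (hv.termFacts p i 0 e).2.2.1
  | one i => rw [tval_one, ← mk_cOne, mk_eq_mk]; exact (hv.termFacts p i 0 e).2.2.2.1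
  | add s t ihs iht =>
    rw [tval_add, ← ihs, ← iht, ← mk_cAdd, mk_eq_mk]; exact (hv.termFacts p s t e).2.2.2.2.1
  | mul s t ihs iht =>
    rw [tval_mul, ← ihs, ← iht, ← mk_cMul, mk_eq_mk]; exact (hv.termFacts p s t e).2.2.2.2.2.1
  | other k x =>
    rw [tval_other, ← mk_cZero, mk_eq_mk]; exact (hv.termFacts p k x e).2.2.2.2.2.2

/-- A formula holds in the Henkin model if and only if the valuation makes it true. -/
theorem sat_iff (φ : ℕ) : ∀ (p : ℕ) (e : List ℕ),
    sat φ p (e.map (mk : ℕ → Model v hv)) ↔ v (pSat φ p e) = true := by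
  induction φ using code_induction with
  | falsum i => exact fun p e => iff_of_false (sat_falsum i) (hv.formulaFacts p i 0 e []).1
  | equal s t =>
    intro p e
    rw [sat_equal, ← mk_cTerm, ← mk_cTerm, mk_eq_mk]
    exact (hv.formulaFacts p s t e []).2.1.symm
  | lt s t =>
    intro p e
    rw [sat_lt, ← mk_cTerm, ← mk_cTerm, mk_lt_mk]
    exact (hv.formulaFacts p s t e []).2.2.1.symm
  | imp φ ψ ih1 ih2 =>
    intro p e
    rw [sat_imp, ih1, ih2]
    exact (hv.formulaFacts p φ ψ e []).2.2.2.1.symm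
  | all φ ih =>
    intro p e
    have happ : ∀ c, e.map (mk : ℕ → Model v hv) ++ [mk c] = (e ++ [c]).map mk := by simp
    rw [sat_all]
    constructor
    · intro h
      -- A single instance suffices, the one at the Henkin witness.
      have := h (mk (cWit p φ e))
      rw [happ, ih] at this
      exact (hv.formulaFacts p φ 0 e []).2.2.2.2.2.1 this
    · intro h c
      obtain ⟨c, rfl⟩ := mk_surjective c
      rw [happ, ih]
      exact (hv.formulaFacts p φ c e []).2.2.2.2.1 h
  | call q ψ l ih =>
    intro p e
    have : (l.map fun i => (e.map (mk : ℕ → Model v hv)).getD i 0) =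
        (l.map fun i => e.getD i cZero).map mk := by
      rw [List.map_map]
      exact List.map_congr_left fun i _ => getD_map_mk e i
    rw [sat_call, this, ih]
    exact (hv.formulaFacts p q ψ e l).2.2.2.2.2.2.1.symm
  | other k x =>
    exact fun p e => iff_of_false (sat_other k x) (hv.formulaFacts p k x e []).2.2.2.2.2.2.2

theorem sat_axiomList (n : ℕ) : ∀ φ ∈ axiomList n, sat φ 0 ([] : List (Model v hv)) :=
  fun φ hφ => (sat_iff φ 0 []).2 (hv.axiomFacts n φ hφ)

/-- The axioms of ordered fields, in the Henkin model. -/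
theorem fieldFacts :
    (∀ x y : Model v hv, x + y = y + x) ∧ (∀ x y z : Model v hv, x + y + z = x + (y + z)) ∧
    (∀ x : Model v hv, 0 + x = x) ∧ (∀ x : Model v hv, ∃ y, y + x = 0) ∧
    (∀ x y : Model v hv, x * y = y * x) ∧ (∀ x y z : Model v hv, x * y * z = x * (y * z)) ∧
    (∀ x : Model v hv, 1 * x = x) ∧ (∀ x y z : Model v hv, x * (y + z) = x * y + x * z) ∧
    (∀ x : Model v hv, x ≠ 0 → ∃ y, x * y = 1) ∧ (0 : Model v hv) < 1 ∧
    (∀ x : Model v hv, ¬ x < x) ∧ (∀ x y z : Model v hv, x < y → y < z → x < z) ∧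
    (∀ x y : Model v hv, x < y ∨ x = y ∨ y < x) ∧
    (∀ x y z : Model v hv, x < y → z + x < z + y) ∧
    (∀ x y : Model v hv, 0 < x → 0 < y → 0 < x * y) := by
  have h := sat_axiomList (hv := hv) 0
  simp only [axiomList, List.forall_mem_cons] at h
  obtain ⟨h1, h2, h3, h4, h5, h6, h7, h8, h9, h10, h11, h12, h13, h14, h15, -⟩ := h
  refine ⟨?_, ?_, ?_, ?_, ?_, ?_, ?_, ?_, ?_, ?_, ?_, ?_, ?_, ?_, ?_⟩
  · simpa using h1
  · simpa using h2
  · simpa using h3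
  · simpa using h4
  · simpa using h5
  · simpa using h6
  · simpa using h7
  · simpa using h8
  · simpa using h9
  · simpa using h10
  · simpa using h11
  · simpa using h12
  · simpa using h13
  · simpa using h14
  · simpa using h15

theorem mul_zero_aux (x : Model v hv) : x * 0 = 0 := by
  have h := fieldFacts (hv := hv)
  have h1 : x * 0 + x * 0 = x * 0 := by rw [← h.2.2.2.2.2.2.2.1, h.2.2.1]
  obtain ⟨y, hy⟩ := h.2.2.2.1 (x * 0)
  calc x * 0 = y + x * 0 + x * 0 := by rw [hy, h.2.2.1]
    _ = 0 := by rw [h.2.1, h1, hy]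

noncomputable instance : Neg (Model v hv) := ⟨fun x => (fieldFacts.2.2.2.1 x).choose⟩

open scoped Classical in
noncomputable instance : Inv (Model v hv) :=
  ⟨fun x => if h : x = 0 then 0 else (fieldFacts.2.2.2.2.2.2.2.2.1 x h).choose⟩

open scoped Classical in
theorem mul_inv_aux (x : Model v hv) (h : x ≠ 0) : x * x⁻¹ = 1 := by
  have := (fieldFacts.2.2.2.2.2.2.2.2.1 x h).choose_spec
  change x * (if h : x = 0 then 0 else (fieldFacts.2.2.2.2.2.2.2.2.1 x h).choose) = 1
  rwa [dif_neg h]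

noncomputable instance : Field (Model v hv) where
  add_comm := fieldFacts.1
  add_assoc := fieldFacts.2.1
  zero_add := fieldFacts.2.2.1
  add_zero x := by rw [fieldFacts.1]; exact fieldFacts.2.2.1 x
  neg_add_cancel x := (fieldFacts.2.2.2.1 x).choose_spec
  nsmul := nsmulRec
  zsmul := zsmulRec
  mul_comm := fieldFacts.2.2.2.2.1
  mul_assoc := fieldFacts.2.2.2.2.2.1
  one_mul := fieldFacts.2.2.2.2.2.2.1
  mul_one x := by rw [fieldFacts.2.2.2.2.1]; exact fieldFacts.2.2.2.2.2.2.1 x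
  left_distrib := fieldFacts.2.2.2.2.2.2.2.1
  right_distrib x y z := by
    have h := fieldFacts (hv := hv)
    rw [h.2.2.2.2.1, h.2.2.2.2.2.2.2.1, h.2.2.2.2.1 z, h.2.2.2.2.1 z]
  zero_mul x := by rw [fieldFacts.2.2.2.2.1, mul_zero_aux]
  mul_zero := mul_zero_aux
  mul_inv_cancel := mul_inv_aux
  inv_zero := dif_pos rfl
  exists_pair_ne := ⟨0, 1, fun h => by
    have h1 := (fieldFacts (hv := hv)).2.2.2.2.2.2.2.2.2.1
    rw [← h] at h1
    exact fieldFacts.2.2.2.2.2.2.2.2.2.2.1 _ h1⟩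
  nnqsmul := _
  nnqsmul_def := fun _ _ => rfl
  qsmul := _
  qsmul_def := fun _ _ => rfl

noncomputable instance : LinearOrder (Model v hv) where
  le x y := x < y ∨ x = y
  le_refl x := Or.inr rfl
  le_trans x y z h1 h2 := by
    rcases h1 with h1 | rfl
    · rcases h2 with h2 | rfl
      · exact Or.inl (fieldFacts.2.2.2.2.2.2.2.2.2.2.2.1 x y z h1 h2)
      · exact Or.inl h1
    · exact h2
  lt_iff_le_not_ge x y := by
    have hi := (fieldFacts (hv := hv)).2.2.2.2.2.2.2.2.2.2.1
    have ht := (fieldFacts (hv := hv)).2.2.2.2.2.2.2.2.2.2.2.1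
    constructor
    · refine fun h => ⟨Or.inl h, ?_⟩
      rintro (h' | rfl)
      · exact hi x (ht x y x h h')
      · exact hi _ h
    · rintro ⟨h | rfl, h'⟩
      · exact h
      · exact absurd (Or.inr rfl) h'
  le_antisymm x y h1 h2 := by
    rcases h1 with h1 | h1
    · rcases h2 with h2 | h2
      · exact absurd (fieldFacts.2.2.2.2.2.2.2.2.2.2.2.1 x y x h1 h2)
          (fieldFacts.2.2.2.2.2.2.2.2.2.2.1 x)
      · exact h2.symm
    · exact h1
  le_total x y := by
    rcases (fieldFacts (hv := hv)).2.2.2.2.2.2.2.2.2.2.2.2.1 x y with h | h | h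
    · exact Or.inl (Or.inl h)
    · exact Or.inl (Or.inr h)
    · exact Or.inr (Or.inl h)
  toDecidableLE := Classical.decRel _

instance : IsStrictOrderedRing (Model v hv) :=
  have : IsOrderedAddMonoid (Model v hv) := ⟨fun x y h z => by
    rcases h.eq_or_lt with rfl | h
    · exact le_rfl
    · have := fieldFacts.2.2.2.2.2.2.2.2.2.2.2.2.2.1 x y z h
      rw [add_comm z, add_comm z] at this
      exact this.le, fun x y h z => by
    rcases h.eq_or_lt with rfl | h
    · exact le_rfl
    · exact (fieldFacts.2.2.2.2.2.2.2.2.2.2.2.2.2.1 x y z h).le⟩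
  have : ZeroLEOneClass (Model v hv) := ⟨(fieldFacts (hv := hv)).2.2.2.2.2.2.2.2.2.1.le⟩
  IsStrictOrderedRing.of_mul_pos fieldFacts.2.2.2.2.2.2.2.2.2.2.2.2.2.2

instance : PolynomialIVT (Model v hv) := polynomialIVT_iff.2 fun n => by
  have h := sat_axiomList (hv := hv) n
  simp only [axiomList, List.forall_mem_cons] at h
  exact ⟨h.2.2.2.2.2.2.2.2.2.2.2.2.2.2.2.1, h.2.2.2.2.2.2.2.2.2.2.2.2.2.2.2.2.1⟩

/-- Completeness enters here: the Henkin model is an ordered field with the required properties,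
hence has the same true sentences as `ℝ`. So every valuation satisfying the clauses gives each
sentence its real truth value. -/
theorem sat_iff_real (hv : IsModel v) (φ : ℕ) : v (pSat φ 0 []) = true ↔ sat φ 0 ([] : List ℝ) := by
  rw [← sat_iff_of_models (Model v hv) φ]
  exact (sat_iff (hv := hv) φ 0 []).symm

end Model

/-! ### The true sentences of the real field are recursively enumerable -/

section Decision

/-- All lists of Booleans of length `n`. -/
def boolLists (n : ℕ) : List (List Bool) :=
  Nat.rec [[]] (fun _ L => L.flatMap fun w => [w ++ [true], w ++ [false]]) n

theorem mem_boolLists (n : ℕ) (v : ℕ → Bool) : (List.range n).map v ∈ boolLists n := by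
  induction n with
  | zero => simp [boolLists]
  | succ n ih =>
    have : boolLists (n + 1) = (boolLists n).flatMap fun w => [w ++ [true], w ++ [false]] := rfl
    rw [this, List.mem_flatMap]
    refine ⟨_, ih, ?_⟩
    rw [List.range_succ, List.map_append]
    cases h : v n <;> simp [h]

theorem length_of_mem_boolLists (n : ℕ) : ∀ w ∈ boolLists n, w.length = n := by
  induction n with
  | zero => simp [boolLists]
  | succ n ih =>
    intro w hw
    have : boolLists (n + 1) = (boolLists n).flatMap fun w => [w ++ [true], w ++ [false]] := rfl
    rw [this, List.mem_flatMap] at hw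
    obtain ⟨u, hu, hw⟩ := hw
    have := ih u hu
    simp only [List.mem_cons, List.not_mem_nil, or_false] at hw
    rcases hw with rfl | rfl <;> simp [this]

/-- The clauses with number `n`, together with the negation of the sentence `φ`. -/
def clauseSeq (φ n : ℕ) : List Clause :=
  [(pSat φ 0 [], false)] ::
    ((Encodable.decode n : Option ((ℕ × ℕ × ℕ × ℕ) × List ℕ × List ℕ)).map clauses).getD []

/-- Every literal of the clause `c` is false under the assignment `w`. -/
def falsifies (w : List Bool) (c : Clause) : Bool :=
  c.all fun l => decide (w[l.1]? = some (!l.2))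

/-- One of the first `n` entries of `clauseSeq φ` is false under the assignment `w`. -/
def falsifiesSome (φ n : ℕ) (w : List Bool) : Bool :=
  (List.range n).any fun i => (clauseSeq φ i).any fun c => falsifies w c

/-- `s` codes a bound on clauses and a bound on propositions such that every assignment to the
latter falsifies one of the former. -/
def refutes (φ s : ℕ) : Bool :=
  (boolLists s.unpair.2).all fun w => falsifiesSome φ s.unpair.1 w

theorem primrec_boolLists : Primrec boolLists :=
  primrec_rec (f := id) (g := fun _ => [[]])
    (h := fun _ _ L => L.flatMap fun w => [w ++ [true], w ++ [false]])
    (by fun_prop) (by fun_prop) (by fun_prop)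

theorem primrec_clauseSeq : Primrec fun x : ℕ × ℕ => clauseSeq x.1 x.2 := by
  unfold clauseSeq
  have h1 : Primrec fun x : ℕ × ℕ => [(pSat x.1 0 [], false)] := by fun_prop
  have h2 : Primrec fun x : ℕ × ℕ =>
      (Encodable.decode x.2 : Option ((ℕ × ℕ × ℕ × ℕ) × List ℕ × List ℕ)) := by fun_prop
  have h3 : Primrec fun x : ℕ × ℕ =>
      ((Encodable.decode x.2 : Option ((ℕ × ℕ × ℕ × ℕ) × List ℕ × List ℕ)).map clauses) :=
    primrec_optionMap h2 (primrec_comp primrec_clauses (primrec_snd primrec_id))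
  exact primrec_cons h1 (primrec_optionGetD h3 (primrec_const _))

theorem primrec_falsifies : Primrec fun x : List Bool × Clause => falsifies x.1 x.2 := by
  unfold falsifies
  fun_prop

theorem primrec_falsifiesSome :
    Primrec fun x : (ℕ × ℕ) × List Bool => falsifiesSome x.1.1 x.1.2 x.2 := by
  unfold falsifiesSome
  have h1 : Primrec fun x : ((ℕ × ℕ) × List Bool) × ℕ => clauseSeq x.1.1.1 x.2 :=
    primrec_comp (f := fun y : ℕ × ℕ => clauseSeq y.1 y.2) primrec_clauseSeq
      (g := fun x : ((ℕ × ℕ) × List Bool) × ℕ => (x.1.1.1, x.2)) (by fun_prop)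
  have h2 : Primrec fun x : (((ℕ × ℕ) × List Bool) × ℕ) × Clause => falsifies x.1.1.2 x.2 :=
    primrec_comp (f := fun y : List Bool × Clause => falsifies y.1 y.2) primrec_falsifies
      (g := fun x : (((ℕ × ℕ) × List Bool) × ℕ) × Clause => (x.1.1.2, x.2)) (by fun_prop)
  have h3 : Primrec fun x : ((ℕ × ℕ) × List Bool) × ℕ =>
      (clauseSeq x.1.1.1 x.2).any fun c => falsifies x.1.2 c := primrec_any h1 h2
  have h4 : Primrec fun x : (ℕ × ℕ) × List Bool => List.range x.1.2 := by fun_prop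
  exact primrec_any h4 h3

theorem primrec_refutes : Primrec fun x : ℕ × ℕ => refutes x.1 x.2 := by
  unfold refutes
  have h1 : Primrec fun x : ℕ × ℕ => boolLists x.2.unpair.2 :=
    primrec_comp primrec_boolLists (by fun_prop)
  have h2 : Primrec fun x : (ℕ × ℕ) × List Bool => falsifiesSome x.1.1 x.1.2.unpair.1 x.2 :=
    primrec_comp (g := fun x : (ℕ × ℕ) × List Bool => ((x.1.1, x.1.2.unpair.1), x.2))
      primrec_falsifiesSome (by fun_prop)
  exact primrec_all h1 h2

-- If `φ` were false in `ℝ`, the valuation given by `ℝ` would satisfy all clauses and the negation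
-- of `φ`, and its initial segment would falsify none of them.
open scoped Classical in
theorem sat_of_refutes {φ s : ℕ} (h : refutes φ s = true) : sat φ 0 ([] : List ℝ) := by
  by_contra hn
  set v : ℕ → Bool := fun n => decide (realVal n)
  have h1 := List.all_eq_true.1 h _ (mem_boolLists s.unpair.2 v)
  obtain ⟨i, -, h2⟩ := List.any_eq_true.1 h1
  obtain ⟨c, hc, h3⟩ := List.any_eq_true.1 h2
  have hall : ∀ l ∈ c, v l.1 = !l.2 := by
    intro l hl
    have := List.all_eq_true.1 h3 l hl
    simp only [decide_eq_true_eq, List.getElem?_map, Option.map_eq_some_iff] at this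
    obtain ⟨a, ha, h4⟩ := this
    rw [List.getElem?_eq_some_iff] at ha
    obtain ⟨ha1, ha2⟩ := ha
    rw [List.getElem_range] at ha2
    rw [ha2, h4]
  rw [clauseSeq, List.mem_cons] at hc
  rcases hc with rfl | hc
  · have := hall _ (List.mem_singleton_self _)
    simp [v, realVal_pSat, hn] at this
  · rcases hd : (Encodable.decode i : Option ((ℕ × ℕ × ℕ × ℕ) × List ℕ × List ℕ)) with _ | d
    · rw [hd] at hc; exact absurd hc List.not_mem_nil
    · rw [hd] at hc
      obtain ⟨l, hl, h4⟩ := isModel_realVal d c hc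
      have := hall l hl
      rw [show v l.1 = l.2 from h4] at this
      simp at this

/-- Compactness of `ℕ → Bool`. The set `U i` of valuations falsifying some clause of number `i` is
open, because a clause involves finitely many propositions. -/
theorem exists_refutes_of_sat {φ : ℕ} (h : sat φ 0 ([] : List ℝ)) : ∃ s, refutes φ s = true := by
  let U : ℕ → Set (ℕ → Bool) := fun i => {v | ∃ c ∈ clauseSeq φ i, ∀ l ∈ c, v l.1 = !l.2}
  have hopen : ∀ i, IsOpen (U i) := by
    intro i
    have : U i = ⋃ c ∈ {c | c ∈ clauseSeq φ i}, ⋂ l ∈ {l | l ∈ c}, {v | v l.1 = !l.2} := by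
      ext v; simp [U]
    rw [this]
    refine isOpen_biUnion fun c _ => Set.Finite.isOpen_biInter (List.finite_toSet c) fun l _ => ?_
    exact (isOpen_discrete ({!l.2} : Set Bool)).preimage (continuous_apply (A := fun _ => Bool) l.1)
  -- A valuation outside every `U i` would be a model in which `φ` fails, contrary to
  -- `Model.sat_iff_real`. The negation of `φ` belongs to each entry of `clauseSeq`, in particular
  -- to the one with number 0.
  have hcov : (Set.univ : Set (ℕ → Bool)) ⊆ ⋃ i, U i := by
    intro v _
    by_contra hn
    simp only [Set.mem_iUnion, not_exists] at hn
    have hv : IsModel v := by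
      intro d c hc
      by_contra hl
      refine hn (Encodable.encode d) ⟨c, ?_, fun l hlc => ?_⟩
      · rw [clauseSeq, Encodable.encodek]; exact List.mem_cons_of_mem _ hc
      · push Not at hl
        have := hl l hlc
        cases h1 : v l.1 <;> cases h2 : l.2 <;> simp_all
    have := (Model.sat_iff_real hv φ).2 h
    refine hn 0 ⟨[(pSat φ 0 [], false)], by simp [clauseSeq], by simpa using this⟩
  obtain ⟨T, hT⟩ := isCompact_univ.elim_finite_subcover U hopen hcov
  let N := T.sup id + 1
  -- `M` exceeds every proposition occurring in the first `N` entries, since a sum bounds each of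
  -- its terms. A list of length `M` thus assigns a value to every literal that matters; below it is
  -- extended by `false` to a full valuation.
  let M := ((List.range N).flatMap fun i => (clauseSeq φ i).flatMap fun c => c.map Prod.fst).sum + 1
  refine ⟨Nat.pair N M, ?_⟩
  simp only [refutes, Nat.unpair_pair]
  rw [List.all_eq_true]
  intro w hw
  have hlen := length_of_mem_boolLists M w hw
  obtain ⟨i, hi⟩ := Set.mem_iUnion.1 (hT (Set.mem_univ fun n => w.getD n false))
  obtain ⟨hiT, c, hc, hcl⟩ := Set.mem_iUnion.1 hi
  have hiN : i < N := Nat.lt_succ_of_le (Finset.le_sup (f := id) hiT)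
  refine List.any_eq_true.2 ⟨i, List.mem_range.2 hiN, List.any_eq_true.2 ⟨c, hc,
    List.all_eq_true.2 fun l hl => ?_⟩⟩
  have hlM : l.1 < M := by
    refine Nat.lt_succ_of_le (List.single_le_sum (by simp) _ ?_)
    rw [List.mem_flatMap]
    exact ⟨i, List.mem_range.2 hiN, List.mem_flatMap.2 ⟨c, hc, List.mem_map_of_mem hl⟩⟩
  have := hcl l hl
  rw [decide_eq_true_eq, List.getElem?_eq_getElem (by omega), ← this]
  simp [hlen, hlM]

end Decision

end OrderedRings

namespace OrderedRings

/-! ### Dominance of monomials -/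

section Dominance

open Filter Topology

/-- The terms of largest weight share one value `u j`, so together they contribute `S * u j`. If `S
≠ 0`, this outweighs all other terms for small `ε` and the sign is that of `S`; if `S = 0`, the
whole class cancels and the smaller index set `D` is treated by induction. -/
theorem exists_sign_sum_eq {ι Λ : Type*} [LinearOrder Λ] [DecidableEq ι] (w : ι → Λ) (c : ι → ℝ)
    (E : Finset ι) : ∃ ε : ℝ, 0 < ε ∧ ∃ s : SignType, ∀ u : ι → ℝ, (∀ i ∈ E, 0 < u i) →
      (∀ i ∈ E, ∀ j ∈ E, w i < w j → u i ≤ ε * u j) →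
      (∀ i ∈ E, ∀ j ∈ E, w i = w j → u i = u j) → SignType.sign (∑ i ∈ E, c i * u i) = s := by
  induction E using Finset.strongInduction with
  | H E ih =>
  rcases E.eq_empty_or_nonempty with rfl | hE
  · exact ⟨1, one_pos, 0, fun u _ _ _ => by simp⟩
  obtain ⟨j, hj, hmax⟩ := E.exists_max_image w hE
  set C := E.filter fun i => w i = w j with hC
  set D := E.filter fun i => ¬ w i = w j with hD
  have hDE : D ⊆ E := Finset.filter_subset _ _
  have hsplit : ∀ u : ι → ℝ, (∀ i ∈ E, ∀ j ∈ E, w i = w j → u i = u j) →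
      ∑ i ∈ E, c i * u i = (∑ i ∈ C, c i) * u j + ∑ i ∈ D, c i * u i := by
    intro u hu
    rw [← Finset.sum_filter_add_sum_filter_not E fun i => w i = w j, Finset.sum_mul]
    congr 1
    refine Finset.sum_congr rfl fun i hi => ?_
    rw [Finset.mem_filter] at hi
    rw [hu i hi.1 j hj hi.2]
  by_cases hS : ∑ i ∈ C, c i = 0
  · have hlt : D ⊂ E := (Finset.ssubset_iff_of_subset hDE).2 ⟨j, hj, by simp [hD]⟩
    obtain ⟨ε, hε, s, h⟩ := ih D hlt
    refine ⟨ε, hε, s, fun u h1 h2 h3 => ?_⟩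
    rw [hsplit u h3, hS, zero_mul, zero_add]
    exact h u (fun i hi => h1 i (hDE hi)) (fun i hi j hj => h2 i (hDE hi) j (hDE hj))
      fun i hi j hj => h3 i (hDE hi) j (hDE hj)
  · set S := ∑ i ∈ C, c i
    set K := ∑ i ∈ D, |c i|
    have hK : 0 ≤ K := Finset.sum_nonneg fun i _ => abs_nonneg _
    -- With this `ε` the remaining terms are at most `K * ε * u j < |S| * u j` in absolute value;
    -- the `+ 1` makes the inequality strict and the denominator nonzero.
    have hε : 0 < |S| / (K + 1) := by positivity
    refine ⟨|S| / (K + 1), hε, SignType.sign S, fun u h1 h2 h3 => ?_⟩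
    rw [hsplit u h3]
    have hj0 := h1 j hj
    have hb : |∑ i ∈ D, c i * u i| ≤ K * (|S| / (K + 1) * u j) := by
      refine (Finset.abs_sum_le_sum_abs _ _).trans ?_
      rw [Finset.sum_mul]
      refine Finset.sum_le_sum fun i hi => ?_
      have hiE := hDE hi
      rw [abs_mul, abs_of_pos (h1 i hiE)]
      refine mul_le_mul_of_nonneg_left (h2 i hiE j hj ?_) (abs_nonneg _)
      rw [hD, Finset.mem_filter] at hi
      exact lt_of_le_of_ne (hmax i hiE) hi.2
    have hlt : K * (|S| / (K + 1) * u j) < |S| * u j := by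
      have : K * (|S| / (K + 1) * u j) = K / (K + 1) * (|S| * u j) := by ring
      rw [this]
      have h4 : K / (K + 1) < 1 := by rw [div_lt_one (by positivity)]; linarith
      have h5 : 0 < |S| * u j := by positivity
      exact mul_lt_of_lt_one_left h5 h4
    have hb' := abs_lt.1 (hb.trans_lt hlt)
    rcases lt_or_gt_of_ne hS with h | h
    · rw [sign_neg h, sign_neg]
      rw [abs_of_neg h] at hb'
      linarith [hb'.2]
    · rw [sign_pos h, sign_pos]
      rw [abs_of_pos h] at hb'
      linarith [hb'.1]

/-- The monomial with exponents `b` in `y_0, …, y_{m-1}`. -/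
def mon (m : ℕ) (y : ℕ → ℝ) (b : List ℕ) : ℝ := ∏ i ∈ Finset.range m, y i ^ b.getD i 0

/-- The point `(t, y)` has the relative sizes of the monomials listed in `T` that the points
`(n, ρ^n)` have for large `n`, up to the factor `ε`. -/
def Dominated (m : ℕ) (ρ : ℕ → ℝ) (T : List (ℕ × List ℕ × List ℕ)) (ε t : ℝ) (y : ℕ → ℝ) : Prop :=
  1 < t ∧ 1 < ε * t ∧ (∀ i < m, 0 < y i) ∧ ∀ d ∈ T,
    (mon m ρ d.2.1 < mon m ρ d.2.2 → t ^ d.1 * mon m y d.2.1 < ε * mon m y d.2.2) ∧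
    (mon m ρ d.2.1 = mon m ρ d.2.2 → mon m y d.2.1 = mon m y d.2.2)

theorem mon_pos {m : ℕ} {y : ℕ → ℝ} (h : ∀ i < m, 0 < y i) (b : List ℕ) : 0 < mon m y b :=
  Finset.prod_pos fun i hi => pow_pos (h i (Finset.mem_range.1 hi)) _

theorem mon_mul (m : ℕ) (y z : ℕ → ℝ) (b : List ℕ) :
    mon m (fun i => y i * z i) b = mon m y b * mon m z b := by
  simp [mon, mul_pow, Finset.prod_mul_distrib]

theorem mon_pow (m n : ℕ) (y : ℕ → ℝ) (b : List ℕ) :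
    mon m (fun i => y i ^ n) b = mon m y b ^ n := by
  simp only [mon, ← Finset.prod_pow]
  exact Finset.prod_congr rfl fun i _ => pow_right_comm _ _ _

theorem Dominated.mono {m : ℕ} {ρ : ℕ → ℝ} {T : List (ℕ × List ℕ × List ℕ)} {ε ε' t : ℝ}
    {y : ℕ → ℝ} (h : Dominated m ρ T ε t y) (hε : ε ≤ ε') : Dominated m ρ T ε' t y := by
  obtain ⟨h1, h2, h3, h4⟩ := h
  refine ⟨h1, h2.trans_le (by gcongr), h3, fun d hd => ⟨fun h => ((h4 d hd).1 h).trans_le ?_,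
    (h4 d hd).2⟩⟩
  have := mon_pos h3 d.2.2
  gcongr

/-- For a ratio `r < 1` of monomials, `n^a r^n` tends to 0, so it is eventually below `ε`.
Equalities between monomials survive taking powers, and `n` and `ε n` eventually exceed 1. -/
theorem eventually_dominated {m : ℕ} {ρ : ℕ → ℝ} (hρ : ∀ i < m, 0 < ρ i)
    (T : List (ℕ × List ℕ × List ℕ)) {ε : ℝ} (hε : 0 < ε) :
    ∀ᶠ n : ℕ in atTop, Dominated m ρ T ε n fun i => ρ i ^ n := by
  have h1 : ∀ᶠ n : ℕ in atTop, (1 : ℝ) < n := tendsto_natCast_atTop_atTop.eventually_gt_atTop 1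
  have h2 : ∀ᶠ n : ℕ in atTop, 1 < ε * (n : ℝ) :=
    (tendsto_natCast_atTop_atTop.const_mul_atTop hε).eventually_gt_atTop 1
  have h4 : ∀ d ∈ T, ∀ᶠ n : ℕ in atTop, mon m ρ d.2.1 < mon m ρ d.2.2 →
      (n : ℝ) ^ d.1 * mon m ρ d.2.1 ^ n < ε * mon m ρ d.2.2 ^ n := by
    intro d _
    by_cases hlt : mon m ρ d.2.1 < mon m ρ d.2.2
    · have hp := mon_pos hρ d.2.1
      have hq := mon_pos hρ d.2.2
      have := tendsto_pow_const_mul_const_pow_of_abs_lt_one d.1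
        (r := mon m ρ d.2.1 / mon m ρ d.2.2)
        (by rw [abs_of_pos (by positivity), div_lt_one hq]; exact hlt)
      filter_upwards [this.eventually_lt_const hε] with n hn _
      rw [div_pow, ← mul_div_assoc, div_lt_iff₀ (by positivity)] at hn
      exact hn
    · exact Eventually.of_forall fun n h => absurd h hlt
  have h4' : ∀ᶠ n : ℕ in atTop, ∀ d ∈ T, mon m ρ d.2.1 < mon m ρ d.2.2 →
      (n : ℝ) ^ d.1 * mon m ρ d.2.1 ^ n < ε * mon m ρ d.2.2 ^ n :=
    (Set.Finite.eventually_all (List.finite_toSet T)).2 h4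
  filter_upwards [h1, h2, h4'] with n h1 h2 h4
  refine ⟨h1, h2, fun i hi => pow_pos (hρ i hi) _, fun d hd => ?_⟩
  simp only [mon_pow]
  exact ⟨h4 d hd, fun h => by rw [h]⟩

/-- Since `(1 + 1/t)^a` tends to 1, for large `t` the growth of `t^a` in one step is outweighed by
the ratio of two monomials `ρ^b < ρ^b'`. The bound on `t` is independent of `ε` and `y`, so one
threshold serves for every step. -/
theorem eventually_dominated_succ {m : ℕ} {ρ : ℕ → ℝ} (hρ : ∀ i < m, 0 < ρ i)
    (T : List (ℕ × List ℕ × List ℕ)) :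
    ∀ᶠ t : ℝ in atTop, ∀ (ε : ℝ) (y : ℕ → ℝ), 0 < ε → Dominated m ρ T ε t y →
      Dominated m ρ T ε (t + 1) fun i => ρ i * y i := by
  have h4 : ∀ d ∈ T, ∀ᶠ t : ℝ in atTop, mon m ρ d.2.1 < mon m ρ d.2.2 →
      (t + 1) ^ d.1 * mon m ρ d.2.1 ≤ t ^ d.1 * mon m ρ d.2.2 := by
    intro d _
    by_cases hlt : mon m ρ d.2.1 < mon m ρ d.2.2
    · have h0 : Tendsto (fun t : ℝ => (1 + t⁻¹) ^ d.1 * mon m ρ d.2.1) atTop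
          (𝓝 ((1 + 0) ^ d.1 * mon m ρ d.2.1)) :=
        ((tendsto_inv_atTop_zero.const_add 1).pow _).mul_const _
      rw [add_zero, one_pow, one_mul] at h0
      filter_upwards [h0.eventually_lt_const hlt, eventually_gt_atTop 0] with t h1 h2 _
      have h3 : (t + 1) ^ d.1 = t ^ d.1 * (1 + t⁻¹) ^ d.1 := by
        rw [← mul_pow]; congr 1; field_simp
      rw [h3, mul_assoc]
      gcongr
    · exact Eventually.of_forall fun n h => absurd h hlt
  have h4' : ∀ᶠ t : ℝ in atTop, ∀ d ∈ T, mon m ρ d.2.1 < mon m ρ d.2.2 →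
      (t + 1) ^ d.1 * mon m ρ d.2.1 ≤ t ^ d.1 * mon m ρ d.2.2 :=
    (Set.Finite.eventually_all (List.finite_toSet T)).2 h4
  filter_upwards [h4'] with t h4 ε y hε hD
  obtain ⟨k1, k2, k3, k4⟩ := hD
  refine ⟨by linarith, by nlinarith, fun i hi => mul_pos (hρ i hi) (k3 i hi), fun d hd => ?_⟩
  simp only [mon_mul]
  refine ⟨fun h => ?_, fun h => by rw [h, (k4 d hd).2 h]⟩
  calc (t + 1) ^ d.1 * (mon m ρ d.2.1 * mon m y d.2.1)
      = ((t + 1) ^ d.1 * mon m ρ d.2.1) * mon m y d.2.1 := by ring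
    _ ≤ (t ^ d.1 * mon m ρ d.2.2) * mon m y d.2.1 :=
        mul_le_mul_of_nonneg_right (h4 d hd h) (mon_pos k3 d.2.1).le
    _ = mon m ρ d.2.2 * (t ^ d.1 * mon m y d.2.1) := by ring
    _ < mon m ρ d.2.2 * (ε * mon m y d.2.2) := by
        have := mon_pos hρ d.2.2
        have := (k4 d hd).1 h
        gcongr
    _ = ε * (mon m ρ d.2.2 * mon m y d.2.2) := by ring

/-- The exponents of `y_0, …, y_{m-1}` in a monomial in `x_0, …, x_{k-1}, t, y_0, …, y_{m-1}`. -/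
def exponents (k m : ℕ) (d : ℕ →₀ ℕ) : List ℕ := (List.range m).map fun i => d (k + 1 + i)

/-- Collects powers of the `x`-variables and integer coefficients into real coefficients `c d`,
leaving a sum of monomials in `t` and `y` to which `exists_sign_sum_eq` applies. -/
theorem exists_evalHom_eq (k m : ℕ) (q : MvPolynomial ℕ ℤ) (x : List ℝ) (hx : x.length = k) :
    ∃ c : (ℕ →₀ ℕ) → ℝ, ∀ (t : ℝ) (y : ℕ → ℝ),
      evalHom (x ++ t :: (List.range m).map y) q =
        ∑ d ∈ q.support, c d * (t ^ d k * mon m y (exponents k m d)) := by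
  -- Each coordinate is split as `z i * h i`: `z` carries `x` and the zeros beyond the list, `h`
  -- carries `t` and `y`, and each is 1 where the other carries the value.
  let z : ℕ → ℝ := fun i => (x ++ List.replicate (m + 1) 1).getD i 0
  refine ⟨fun d => ((MvPolynomial.coeff d q : ℤ) : ℝ) * ∏ i ∈ d.support, z i ^ d i, fun t y => ?_⟩
  have h1 : evalHom (x ++ t :: (List.range m).map y) q = ∑ d ∈ q.support,
      ((MvPolynomial.coeff d q : ℤ) : ℝ) * ∏ i ∈ d.support, (x ++ t :: (List.range m).map y).getD i 0 ^ d i := by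
    change MvPolynomial.aeval _ q = _
    rw [MvPolynomial.aeval_def, MvPolynomial.eval₂_eq]
    rfl
  rw [h1]
  refine Finset.sum_congr rfl fun d _ => ?_
  rw [mul_assoc]
  congr 1
  let h : ℕ → ℝ := fun i => if i < k then 1 else if i = k then t else
    if i < k + 1 + m then y (i - (k + 1)) else 1
  have h2 : ∀ i, (x ++ t :: (List.range m).map y).getD i 0 = z i * h i := by
    intro i
    simp only [z, h]
    rcases lt_or_ge i k with hi | hi
    · rw [List.getD_append _ _ _ _ (by omega), List.getD_append _ _ _ _ (by omega), if_pos hi,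
        mul_one]
    · obtain ⟨j, rfl⟩ := Nat.exists_eq_add_of_le hi
      rw [List.getD_append_right _ _ _ _ (by omega), List.getD_append_right _ _ _ _ (by omega),
        if_neg (by omega), hx, Nat.add_sub_cancel_left]
      rcases j with _ | j
      · simp
      · rw [if_neg (by omega)]
        by_cases hj : j < m
        · rw [if_pos (by omega)]
          simp [hj, show k + (j + 1) - (k + 1) = j by omega]
        · rw [if_neg (by omega)]
          simp [hj]
  have h3 : ∏ i ∈ d.support, h i ^ d i = ∏ i ∈ Finset.range (k + 1 + m), h i ^ d i := by
    trans ∏ i ∈ d.support ∪ Finset.range (k + 1 + m), h i ^ d i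
    · refine Finset.prod_subset Finset.subset_union_left fun i _ hi => ?_
      rw [Finsupp.notMem_support_iff] at hi
      rw [hi, pow_zero]
    · refine (Finset.prod_subset Finset.subset_union_right fun i _ hi => ?_).symm
      rw [Finset.mem_range] at hi
      have : h i = 1 := by
        simp only [h]
        rw [if_neg (by omega), if_neg (by omega), if_neg (by omega)]
      rw [this, one_pow]
  simp only [h2, mul_pow, Finset.prod_mul_distrib]
  congr 1
  rw [h3, Finset.prod_range_add, Finset.prod_range_succ, Finset.prod_eq_one, one_mul]
  · congr 1
    · simp [h]
    · refine Finset.prod_congr rfl fun i hi => ?_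
      rw [Finset.mem_range] at hi
      simp only [h]
      rw [if_neg (by omega), if_neg (by omega), if_pos (by omega), Nat.add_sub_cancel_left]
      simp [exponents, hi]
  · intro i hi
    rw [Finset.mem_range] at hi
    simp [h, hi]

/-- If the monomials in `ρ` differ, domination gives the bound, and `t > 1` absorbs the factor `t ^
a'`. If they coincide, so do those in `y`; then `a < a'`, and the condition `1 < ε * t` provides the
factor `ε`. -/
theorem Dominated.le_of_lt {m : ℕ} {ρ : ℕ → ℝ} {T : List (ℕ × List ℕ × List ℕ)} {ε t : ℝ}
    {y : ℕ → ℝ} (hD : Dominated m ρ T ε t y) (hε : 0 < ε) {a a' : ℕ} {b b' : List ℕ}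
    (hT : (a, b, b') ∈ T) (h : toLex (mon m ρ b, a) < toLex (mon m ρ b', a')) :
    t ^ a * mon m y b ≤ ε * (t ^ a' * mon m y b') := by
  obtain ⟨h1, h2, h3, h4⟩ := hD
  have hp := mon_pos h3 b'
  rw [Prod.Lex.toLex_lt_toLex] at h
  rcases h with h | ⟨h, ha⟩
  · calc t ^ a * mon m y b ≤ ε * mon m y b' := ((h4 _ hT).1 h).le
      _ ≤ ε * (t ^ a' * mon m y b') := by
        gcongr
        exact le_mul_of_one_le_left hp.le (one_le_pow₀ h1.le)
  · simp only at h ha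
    rw [(h4 _ hT).2 h]
    obtain ⟨j, rfl⟩ := Nat.exists_eq_add_of_lt ha
    have : ε * (t ^ (a + j + 1) * mon m y b') = (ε * t) * t ^ j * (t ^ a * mon m y b') := by ring
    rw [this]
    refine le_mul_of_one_le_left (by positivity) ?_
    exact one_le_mul_of_one_le_of_one_le h2.le (one_le_pow₀ h1.le)

/-- The comparisons of monomials that determine the signs of the polynomials in `P`. -/
noncomputable def comparisons (k m : ℕ) (P : Finset (MvPolynomial ℕ ℤ)) :
    List (ℕ × List ℕ × List ℕ) :=
  P.toList.flatMap fun q => q.support.toList.flatMap fun d => q.support.toList.map fun d' =>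
    (d k, exponents k m d, exponents k m d')

/-- The coefficients depend on `x`, and so do `ε` and the sign; the list of comparisons involves
exponents only. This uniformity in `x` makes the sets definable by one formula. -/
theorem exists_sign_evalHom_eq {k m : ℕ} (ρ : ℕ → ℝ) {P : Finset (MvPolynomial ℕ ℤ)}
    {q : MvPolynomial ℕ ℤ} (hq : q ∈ P) (x : List ℝ) (hx : x.length = k) :
    ∃ ε : ℝ, 0 < ε ∧ ∃ s : SignType, ∀ (t : ℝ) (y : ℕ → ℝ),
      Dominated m ρ (comparisons k m P) ε t y →
        SignType.sign (evalHom (x ++ t :: (List.range m).map y) q) = s := by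
  obtain ⟨c, hc⟩ := exists_evalHom_eq k m q x hx
  obtain ⟨ε, hε, s, h⟩ := exists_sign_sum_eq
    (fun d : ℕ →₀ ℕ => toLex (mon m ρ (exponents k m d), d k)) c q.support
  have hmem : ∀ d ∈ q.support, ∀ d' ∈ q.support,
      (d k, exponents k m d, exponents k m d') ∈ comparisons k m P := by
    intro d hd d' hd'
    simp only [comparisons, List.mem_flatMap, List.mem_map, Finset.mem_toList]
    exact ⟨q, hq, d, hd, d', hd', rfl⟩
  refine ⟨ε, hε, s, fun t y hD => ?_⟩
  rw [hc]
  refine h (fun d => t ^ d k * mon m y (exponents k m d)) (fun d _ => ?_) (fun d hd d' hd' hlt => ?_)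
    fun d hd d' hd' heq => ?_
  · exact mul_pos (pow_pos (one_pos.trans hD.1) _) (mon_pos hD.2.2.1 _)
  · exact hD.le_of_lt hε (hmem d hd d' hd') hlt
  · have := toLex_inj.1 heq
    rw [Prod.mk.injEq] at this
    change t ^ d k * _ = t ^ d' k * _
    rw [this.2, (hD.2.2.2 _ (hmem d hd d' hd')).2 this.1]

theorem exists_forall_finset {α : Type*} (P : Finset α) {R : α → ℝ → Prop}
    (hmono : ∀ q ∈ P, ∀ ε ε', ε ≤ ε' → R q ε' → R q ε)
    (h : ∀ q ∈ P, ∃ ε, 0 < ε ∧ R q ε) : ∃ ε, 0 < ε ∧ ∀ q ∈ P, R q ε := by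
  classical
  induction P using Finset.induction_on with
  | empty => exact ⟨1, one_pos, by simp⟩
  | insert q P _ ih =>
    obtain ⟨ε, hε, h1⟩ := ih (fun q hq => hmono q (Finset.mem_insert_of_mem hq))
      fun q hq => h q (Finset.mem_insert_of_mem hq)
    obtain ⟨ε', hε', h2⟩ := h q (Finset.mem_insert_self _ _)
    refine ⟨min ε ε', lt_min hε hε', fun r hr => ?_⟩
    rcases Finset.mem_insert.1 hr with rfl | hr'
    · exact hmono _ hr _ _ (min_le_right _ _) h2
    · exact hmono _ hr _ _ (min_le_left _ _) (h1 r hr')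

/-- On points whose monomials are dominated, a formula is eventually constant. -/
theorem exists_dominated_const (φ k m : ℕ) (ρ : ℕ → ℝ) : ∃ T : List (ℕ × List ℕ × List ℕ),
    ∀ x : List ℝ, x.length = k → ∃ ε : ℝ, 0 < ε ∧
      ((∀ t y, Dominated m ρ T ε t y →
        sat φ (k + (m + 1)) (x ++ t :: (List.range m).map y)) ∨
      ∀ t y, Dominated m ρ T ε t y →
        ¬ sat φ (k + (m + 1)) (x ++ t :: (List.range m).map y)) := by
  obtain ⟨P, hP⟩ := exists_decidedBy φ (k + (m + 1)) (k + (m + 1))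
  refine ⟨comparisons k m P, fun x hx => ?_⟩
  obtain ⟨ε, hε, h⟩ := exists_forall_finset P (R := fun q ε => ∃ s : SignType,
    ∀ (t : ℝ) (y : ℕ → ℝ), Dominated m ρ (comparisons k m P) ε t y →
        SignType.sign (evalHom (x ++ t :: (List.range m).map y) q) = s)
    (fun q _ ε ε' hle ⟨s, hs⟩ => ⟨s, fun t y hD => hs t y (hD.mono hle)⟩)
    fun q hq => exists_sign_evalHom_eq ρ hq x hx
  refine ⟨ε, hε, ?_⟩
  -- Otherwise two dominated points would give `φ` different truth values, although all polynomials
  -- deciding `φ` have equal signs there.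
  by_contra! hn
  obtain ⟨⟨t, y, hD, h1⟩, t', y', hD', h2⟩ := hn
  refine h1 ((hP ℝ ℝ _ _ (by simp [hx]) (by simp [hx]) fun q hq => ?_).1 h2)
  obtain ⟨s, hs⟩ := h q hq
  rw [hs t y hD, hs t' y' hD']

end Dominance

end OrderedRings

namespace OrderedRings

/-! ### Formulas and their codes -/

section Formulas

open FirstOrder Language

theorem exists_term (p t n : ℕ) : ∃ τ : Lor.Term (Fin n),
    ∀ v : Fin n → ℝ, τ.realize v = tval p (List.ofFn v) t := by
  have hzero : ∃ τ : Lor.Term (Fin n), ∀ v : Fin n → ℝ, τ.realize v = 0 :=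
    ⟨.func Func.zero Fin.elim0, fun v => rfl⟩
  have hvar : ∀ i, ∃ τ : Lor.Term (Fin n), ∀ v : Fin n → ℝ,
      τ.realize v = (List.ofFn v).getD i 0 := by
    intro i
    by_cases hi : i < n
    · exact ⟨.var ⟨i, hi⟩, fun v => by simp [hi]⟩
    · obtain ⟨τ, hτ⟩ := hzero
      exact ⟨τ, fun v => by simp [hτ, hi]⟩
  induction t using termCode_induction with
  | free i => simpa only [tval_free] using hvar i
  | bound i => simpa only [tval_bound] using hvar (p + i)
  | zero i => simpa only [tval_zero] using hzero
  | one i => exact ⟨.func Func.one Fin.elim0, fun v => by rw [tval_one]; rfl⟩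
  | add s t ihs iht =>
    obtain ⟨σ, hσ⟩ := ihs
    obtain ⟨τ, hτ⟩ := iht
    refine ⟨.func Func.add ![σ, τ], fun v => ?_⟩
    rw [tval_add, ← hσ, ← hτ]
    rfl
  | mul s t ihs iht =>
    obtain ⟨σ, hσ⟩ := ihs
    obtain ⟨τ, hτ⟩ := iht
    refine ⟨.func Func.mul ![σ, τ], fun v => ?_⟩
    rw [tval_mul, ← hσ, ← hτ]
    rfl
  | other k x => simpa only [tval_other] using hzero

/-- A number read by `sat` may contain calls (tag 5) or variables out of range, and so need not code
a formula. Over `ℝ` it is nevertheless equivalent to one. Sentences can thus be assembled with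
`fCall`, without carrying out substitutions on codes. -/
theorem exists_formula (c : ℕ) : ∀ p n, ∃ ψ : Lor.Formula (Fin n),
    ∀ v : Fin n → ℝ, ψ.Realize v ↔ sat c p (List.ofFn v) := by
  induction c using code_induction with
  | falsum i => exact fun p n => ⟨⊥, fun v => iff_of_false id (sat_falsum i)⟩
  | equal s t =>
    intro p n
    obtain ⟨σ, hσ⟩ := exists_term p s n
    obtain ⟨τ, hτ⟩ := exists_term p t n
    exact ⟨σ.equal τ, fun v => by rw [Formula.realize_equal, sat_equal, hσ, hτ]⟩
  | lt s t =>
    intro p n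
    obtain ⟨σ, hσ⟩ := exists_term p s n
    obtain ⟨τ, hτ⟩ := exists_term p t n
    refine ⟨Relations.formula₂ (Rel.lt : Lor.Relations 2) σ τ, fun v => ?_⟩
    rw [Formula.realize_rel₂, sat_lt, ← hσ, ← hτ]
    rfl
  | imp φ ψ ih1 ih2 =>
    intro p n
    obtain ⟨σ, hσ⟩ := ih1 p n
    obtain ⟨τ, hτ⟩ := ih2 p n
    exact ⟨σ.imp τ, fun v => by rw [Formula.realize_imp, sat_imp, hσ, hτ]⟩
  | all φ ih =>
    intro p n
    obtain ⟨σ, hσ⟩ := ih p (n + 1)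
    -- `sat` appends the quantified value at position `n`, so the last free variable of `σ` is the
    -- one to be bound.
    refine ⟨Formula.iAlls (Fin 1) (σ.relabel (Fin.snoc (fun i : Fin n => Sum.inl i) (Sum.inr 0) :
      Fin (n + 1) → Fin n ⊕ Fin 1)), fun v => ?_⟩
    rw [Formula.realize_iAlls, sat_all]
    have key : ∀ i : Fin 1 → ℝ, List.ofFn (Sum.elim v i ∘ (Fin.snoc (fun i : Fin n => Sum.inl i)
        (Sum.inr 0) : Fin (n + 1) → Fin n ⊕ Fin 1)) = List.ofFn v ++ [i 0] := by
      intro i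
      rw [List.ofFn_succ', List.concat_eq_append]
      simp
    constructor
    · intro h c
      have := h fun _ => c
      rwa [Formula.realize_relabel, hσ, key] at this
    · intro h i
      rw [Formula.realize_relabel, hσ, key]
      exact h (i 0)
  | call q ψ l ih =>
    intro p n
    obtain ⟨σ, hσ⟩ := ih q l.length
    choose τ hτ using fun i : Fin l.length => exists_term 0 (tVar (l.get i)) n
    refine ⟨σ.subst τ, fun v => ?_⟩
    have : List.ofFn (fun i => (τ i).realize v) = l.map fun i => (List.ofFn v).getD i 0 := by
      simp only [hτ, tval_tVar]
      rw [← List.ofFn_get (l.map _)]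
      refine List.ext_getElem (by simp) fun i h1 h2 => ?_
      simp
    rw [sat_call, ← this, ← hσ]
    exact BoundedFormula.realize_subst
  | other k x => exact fun p n => ⟨⊥, fun v => iff_of_false id (sat_other k x)⟩

/-- Only the existence of `ψ` matters, not a computation of it: its code is found by search. -/
theorem exists_formula_code (c n : ℕ) : ∃ ψ : Lor.Formula (Fin n),
    ∀ v : List ℝ, v.length = n → (sat (code ψ) n v ↔ sat c n v) := by
  obtain ⟨ψ, hψ⟩ := exists_formula c n n
  refine ⟨ψ, fun v hv => ?_⟩
  subst hv
  have := (sat_code_formula ψ v.get).trans (hψ v.get)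
  rwa [List.ofFn_get] at this

end Formulas

/-! ### Recognizing codes of formulas -/

section Certificates

open FirstOrder Language

def memCheck (d : ℕ × ℕ) (l : List (ℕ × ℕ)) : Bool := l.any fun x => decide (x = d)

theorem memCheck_iff {d : ℕ × ℕ} {l : List (ℕ × ℕ)} : memCheck d l = true ↔ d ∈ l := by
  simp [memCheck]

/-- The number `d.2` codes a term with `k` free and `d.1` bound variables, provided that this is
true of the entries of `l`. -/
def termCheck (k : ℕ) (l : List (ℕ × ℕ)) (d : ℕ × ℕ) : Bool :=
  (decide (d.2.unpair.1 = 0) && decide (d.2.unpair.2 < k)) ||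
  (decide (d.2.unpair.1 = 1) && decide (d.2.unpair.2 < d.1)) ||
  decide (d.2 = tZero) || decide (d.2 = tOne) ||
  (decide (d.2.unpair.1 = 4) && (memCheck (d.1, d.2.unpair.2.unpair.1) l &&
    memCheck (d.1, d.2.unpair.2.unpair.2) l)) ||
  (decide (d.2.unpair.1 = 5) && (memCheck (d.1, d.2.unpair.2.unpair.1) l &&
    memCheck (d.1, d.2.unpair.2.unpair.2) l))

/-- The number `d.2` codes a formula with `k` free and `d.1` bound variables, provided that the
entries of `l` code terms and those of `l'` formulas. -/
def formulaCheck (l l' : List (ℕ × ℕ)) (d : ℕ × ℕ) : Bool :=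
  decide (d.2 = fFalse) ||
  (decide (d.2.unpair.1 = 1) && (memCheck (d.1, d.2.unpair.2.unpair.1) l &&
    memCheck (d.1, d.2.unpair.2.unpair.2) l)) ||
  (decide (d.2.unpair.1 = 2) && (memCheck (d.1, d.2.unpair.2.unpair.1) l &&
    memCheck (d.1, d.2.unpair.2.unpair.2) l)) ||
  (decide (d.2.unpair.1 = 3) && (memCheck (d.1, d.2.unpair.2.unpair.1) l' &&
    memCheck (d.1, d.2.unpair.2.unpair.2) l')) ||
  (decide (d.2.unpair.1 = 4) && memCheck (d.1 + 1, d.2.unpair.2) l')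

/-- The lists `w.1` and `w.2` certify that `c` codes a formula with `k` free variables. -/
def certifies (k c : ℕ) (w : List (ℕ × ℕ) × List (ℕ × ℕ)) : Bool :=
  w.1.all (fun d => termCheck k w.1 d) && (w.2.all (fun d => formulaCheck w.1 w.2 d) &&
    memCheck (0, c) w.2)

@[fun_prop] theorem primrec_memCheck {α : Type} [Primcodable α] {f : α → ℕ × ℕ}
    {g : α → List (ℕ × ℕ)} (hf : Primrec f) (hg : Primrec g) :
    Primrec fun x => memCheck (f x) (g x) := by unfold memCheck; fun_prop

@[fun_prop] theorem primrec_termCheck {α : Type} [Primcodable α] {f : α → ℕ} {g : α → List (ℕ × ℕ)}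
    {h : α → ℕ × ℕ} (hf : Primrec f) (hg : Primrec g) (hh : Primrec h) :
    Primrec fun x => termCheck (f x) (g x) (h x) := by unfold termCheck; fun_prop

@[fun_prop] theorem primrec_formulaCheck {α : Type} [Primcodable α] {f g : α → List (ℕ × ℕ)}
    {h : α → ℕ × ℕ} (hf : Primrec f) (hg : Primrec g) (hh : Primrec h) :
    Primrec fun x => formulaCheck (f x) (g x) (h x) := by unfold formulaCheck; fun_prop

@[fun_prop] theorem primrec_certifies {α : Type} [Primcodable α] {f g : α → ℕ}
    {h : α → List (ℕ × ℕ) × List (ℕ × ℕ)} (hf : Primrec f) (hg : Primrec g) (hh : Primrec h) :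
    Primrec fun x => certifies (f x) (g x) (h x) := by
  unfold certifies
  fun_prop

/-- Strong induction on the number: the parts of an entry are again entries, and they are smaller
because the tag is nonzero. Hence a list closed under this local check cannot contain a circular
justification. -/
theorem exists_termCode_eq {k : ℕ} {l : List (ℕ × ℕ)}
    (hl : ∀ d ∈ l, termCheck k l d = true) (t : ℕ) :
    ∀ n, (n, t) ∈ l → ∃ τ : Lor.Term (Fin k ⊕ Fin n), termCode τ = t := by
  induction t using Nat.strong_induction_on with
  | _ t ih =>
  intro n ht
  have h := hl _ ht
  simp only [termCheck, Bool.or_eq_true, Bool.and_eq_true, decide_eq_true_eq, memCheck_iff] at h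
  have hlt : t.unpair.1 ≠ 0 → t.unpair.2.unpair.1 < t ∧ t.unpair.2.unpair.2 < t := by
    intro h0
    have := lt_pair_right (b := t.unpair.2) h0
    rw [Nat.pair_unpair] at this
    exact ⟨(Nat.unpair_left_le _).trans_lt this, (Nat.unpair_right_le _).trans_lt this⟩
  have key : ∀ a, t.unpair.1 = a → t = Nat.pair a t.unpair.2 := by
    rintro a rfl
    rw [Nat.pair_unpair]
  rcases h with ((((⟨h, h'⟩ | ⟨h, h'⟩) | h) | h) | ⟨h, h', h''⟩) | ⟨h, h', h''⟩
  · exact ⟨.var (.inl ⟨_, h'⟩), by rw [termCode]; exact (key _ h).symm⟩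
  · exact ⟨.var (.inr ⟨_, h'⟩), by rw [termCode]; exact (key _ h).symm⟩
  · exact ⟨.func Func.zero Fin.elim0, by rw [termCode, h, tZero]⟩
  · exact ⟨.func Func.one Fin.elim0, by rw [termCode, h, tOne]⟩
  · obtain ⟨σ, hσ⟩ := ih _ (hlt (by omega)).1 n h'
    obtain ⟨τ, hτ⟩ := ih _ (hlt (by omega)).2 n h''
    refine ⟨.func Func.add ![σ, τ], ?_⟩
    simp only [termCode, Matrix.cons_val_zero, Matrix.cons_val_one, hσ, hτ, Nat.pair_unpair]
    exact (key _ h).symm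
  · obtain ⟨σ, hσ⟩ := ih _ (hlt (by omega)).1 n h'
    obtain ⟨τ, hτ⟩ := ih _ (hlt (by omega)).2 n h''
    refine ⟨.func Func.mul ![σ, τ], ?_⟩
    simp only [termCode, Matrix.cons_val_zero, Matrix.cons_val_one, hσ, hτ, Nat.pair_unpair]
    exact (key _ h).symm

theorem exists_code_eq {k : ℕ} {l l' : List (ℕ × ℕ)} (hl : ∀ d ∈ l, termCheck k l d = true)
    (hl' : ∀ d ∈ l', formulaCheck l l' d = true) (c : ℕ) :
    ∀ n, (n, c) ∈ l' → ∃ ψ : Lor.BoundedFormula (Fin k) n, code ψ = c := by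
  induction c using Nat.strong_induction_on with
  | _ c ih =>
  intro n hc
  have h := hl' _ hc
  simp only [formulaCheck, Bool.or_eq_true, Bool.and_eq_true, decide_eq_true_eq,
    memCheck_iff] at h
  have hlt0 : c.unpair.1 ≠ 0 → c.unpair.2 < c := by
    intro h0
    have := lt_pair_right (b := c.unpair.2) h0
    rwa [Nat.pair_unpair] at this
  have hlt : c.unpair.1 ≠ 0 → c.unpair.2.unpair.1 < c ∧ c.unpair.2.unpair.2 < c := fun h0 =>
    ⟨(Nat.unpair_left_le _).trans_lt (hlt0 h0), (Nat.unpair_right_le _).trans_lt (hlt0 h0)⟩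
  have key : ∀ a, c.unpair.1 = a → c = Nat.pair a c.unpair.2 := by
    rintro a rfl
    rw [Nat.pair_unpair]
  rcases h with (((h | ⟨h, h', h''⟩) | ⟨h, h', h''⟩) | ⟨h, h', h''⟩) | ⟨h, h'⟩
  · exact ⟨.falsum, by rw [code, h, fFalse]⟩
  · obtain ⟨σ, hσ⟩ := exists_termCode_eq hl _ n h'
    obtain ⟨τ, hτ⟩ := exists_termCode_eq hl _ n h''
    refine ⟨.equal σ τ, ?_⟩
    rw [code, hσ, hτ, Nat.pair_unpair]
    exact (key _ h).symm
  · obtain ⟨σ, hσ⟩ := exists_termCode_eq hl _ n h'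
    obtain ⟨τ, hτ⟩ := exists_termCode_eq hl _ n h''
    refine ⟨.rel Rel.lt ![σ, τ], ?_⟩
    simp only [code, Matrix.cons_val_zero, Matrix.cons_val_one, hσ, hτ, Nat.pair_unpair]
    exact (key _ h).symm
  · obtain ⟨σ, hσ⟩ := ih _ (hlt (by omega)).1 n h'
    obtain ⟨τ, hτ⟩ := ih _ (hlt (by omega)).2 n h''
    refine ⟨.imp σ τ, ?_⟩
    rw [code, hσ, hτ, Nat.pair_unpair]
    exact (key _ h).symm
  · obtain ⟨σ, hσ⟩ := ih _ (hlt0 (by omega)) (n + 1) h'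
    refine ⟨.all σ, ?_⟩
    rw [code, hσ]
    exact (key _ h).symm

theorem exists_code_of_certifies {k c : ℕ} {w : List (ℕ × ℕ) × List (ℕ × ℕ)}
    (h : certifies k c w = true) : ∃ ψ : Lor.Formula (Fin k), code ψ = c := by
  simp only [certifies, Bool.and_eq_true, List.all_eq_true, memCheck_iff] at h
  exact exists_code_eq h.1 h.2.1 c 0 h.2.2

theorem memCheck_mono {d : ℕ × ℕ} {l l₁ : List (ℕ × ℕ)} (h : l ⊆ l₁)
    (hd : memCheck d l = true) : memCheck d l₁ = true :=
  memCheck_iff.2 (h (memCheck_iff.1 hd))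

theorem termCheck_mono {k : ℕ} {d : ℕ × ℕ} {l l₁ : List (ℕ × ℕ)} (h : l ⊆ l₁)
    (hd : termCheck k l d = true) : termCheck k l₁ d = true := by
  simp only [termCheck, Bool.or_eq_true, Bool.and_eq_true] at hd ⊢
  exact hd.imp (Or.imp_right fun h' => ⟨h'.1, memCheck_mono h h'.2.1, memCheck_mono h h'.2.2⟩)
    fun h' => ⟨h'.1, memCheck_mono h h'.2.1, memCheck_mono h h'.2.2⟩

theorem formulaCheck_mono {d : ℕ × ℕ} {l l₁ l' l₁' : List (ℕ × ℕ)} (h : l ⊆ l₁) (h₁ : l' ⊆ l₁')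
    (hd : formulaCheck l l' d = true) : formulaCheck l₁ l₁' d = true := by
  simp only [formulaCheck, Bool.or_eq_true, Bool.and_eq_true] at hd ⊢
  exact hd.imp (Or.imp (Or.imp (Or.imp_right fun h' =>
    ⟨h'.1, memCheck_mono h h'.2.1, memCheck_mono h h'.2.2⟩) fun h' =>
    ⟨h'.1, memCheck_mono h h'.2.1, memCheck_mono h h'.2.2⟩) fun h' =>
    ⟨h'.1, memCheck_mono h₁ h'.2.1, memCheck_mono h₁ h'.2.2⟩)
    fun h' => ⟨h'.1, memCheck_mono h₁ h'.2⟩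

/-- The certificate lists the codes of all subterms. The checks are monotone in the list, so
certificates of the parts can be concatenated. -/
theorem exists_termCheck {k n : ℕ} (τ : Lor.Term (Fin k ⊕ Fin n)) : ∃ l : List (ℕ × ℕ),
    (∀ d ∈ l, termCheck k l d = true) ∧ (n, termCode τ) ∈ l := by
  have pair : ∀ (a : ℕ), (a = 4 ∨ a = 5) → ∀ s t : ℕ,
      (∃ l : List (ℕ × ℕ), (∀ d ∈ l, termCheck k l d = true) ∧ (n, s) ∈ l) →
      (∃ l : List (ℕ × ℕ), (∀ d ∈ l, termCheck k l d = true) ∧ (n, t) ∈ l) →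
      ∃ l : List (ℕ × ℕ), (∀ d ∈ l, termCheck k l d = true) ∧
        (n, Nat.pair a (Nat.pair s t)) ∈ l := by
    rintro a ha s t ⟨l, h1, h2⟩ ⟨l₁, h3, h4⟩
    refine ⟨(n, Nat.pair a (Nat.pair s t)) :: (l ++ l₁), ?_, List.mem_cons_self⟩
    rw [List.forall_mem_cons, List.forall_mem_append]
    refine ⟨?_, fun d hd => termCheck_mono (by intro; simp; tauto) (h1 d hd),
      fun d hd => termCheck_mono (by intro; simp; tauto) (h3 d hd)⟩
    simp only [termCheck, Nat.unpair_pair, Bool.or_eq_true, Bool.and_eq_true, decide_eq_true_eq,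
      memCheck_iff]
    have h5 : (n, s) ∈ (n, Nat.pair a (Nat.pair s t)) :: (l ++ l₁) := by simp [h2]
    have h6 : (n, t) ∈ (n, Nat.pair a (Nat.pair s t)) :: (l ++ l₁) := by simp [h4]
    rcases ha with rfl | rfl
    · exact Or.inl (Or.inr ⟨rfl, h5, h6⟩)
    · exact Or.inr ⟨rfl, h5, h6⟩
  induction τ with
  | var v =>
    rcases v with i | i
    · exact ⟨[(n, Nat.pair 0 i)], by simp [termCheck], by simp [termCode]⟩
    · exact ⟨[(n, Nat.pair 1 i)], by simp [termCheck], by simp [termCode]⟩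
  | func f ts ih =>
    cases f with
    | zero => exact ⟨[(n, tZero)], by simp [termCheck], by simp [termCode, tZero]⟩
    | one => exact ⟨[(n, tOne)], by simp [termCheck], by simp [termCode, tOne]⟩
    | add => exact pair 4 (Or.inl rfl) _ _ (ih 0) (ih 1)
    | mul => exact pair 5 (Or.inr rfl) _ _ (ih 0) (ih 1)

theorem exists_formulaCheck {k n : ℕ} (ψ : Lor.BoundedFormula (Fin k) n) :
    ∃ l l' : List (ℕ × ℕ), (∀ d ∈ l, termCheck k l d = true) ∧
      (∀ d ∈ l', formulaCheck l l' d = true) ∧ (n, code ψ) ∈ l' := by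
  have atom : ∀ (n a : ℕ), (a = 1 ∨ a = 2) → ∀ σ τ : Lor.Term (Fin k ⊕ Fin n),
      ∃ l l' : List (ℕ × ℕ), (∀ d ∈ l, termCheck k l d = true) ∧
      (∀ d ∈ l', formulaCheck l l' d = true) ∧
        (n, Nat.pair a (Nat.pair (termCode σ) (termCode τ))) ∈ l' := by
    intro n a ha σ τ
    obtain ⟨l, h1, h2⟩ := exists_termCheck σ
    obtain ⟨l₁, h3, h4⟩ := exists_termCheck τ
    refine ⟨l ++ l₁, [(n, Nat.pair a (Nat.pair (termCode σ) (termCode τ)))], ?_, ?_,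
      List.mem_singleton_self _⟩
    · rw [List.forall_mem_append]
      exact ⟨fun d hd => termCheck_mono (by intro; simp; tauto) (h1 d hd),
        fun d hd => termCheck_mono (by intro; simp; tauto) (h3 d hd)⟩
    · rw [List.forall_mem_singleton]
      rcases ha with rfl | rfl <;>
        simp [formulaCheck, memCheck_iff, h2, h4]
  induction ψ with
  | @falsum n => exact ⟨[], [(n, fFalse)], by simp, by simp [formulaCheck], by simp [code, fFalse]⟩
  | @equal n σ τ => exact atom n 1 (Or.inl rfl) σ τ
  | @rel n _ R ts =>
    cases R
    exact atom n 2 (Or.inr rfl) (ts 0) (ts 1)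
  | @imp n φ ψ ih1 ih2 =>
    obtain ⟨l, l', h1, h2, h3⟩ := ih1
    obtain ⟨l₁, l₁', h4, h5, h6⟩ := ih2
    refine ⟨l ++ l₁, (n, code (φ.imp ψ)) :: (l' ++ l₁'), ?_, ?_, List.mem_cons_self⟩
    · rw [List.forall_mem_append]
      exact ⟨fun d hd => termCheck_mono (by intro; simp; tauto) (h1 d hd),
        fun d hd => termCheck_mono (by intro; simp; tauto) (h4 d hd)⟩
    · rw [List.forall_mem_cons, List.forall_mem_append]
      refine ⟨?_, fun d hd => formulaCheck_mono (by intro; simp; tauto) (by intro; simp; tauto)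
        (h2 d hd), fun d hd => formulaCheck_mono (by intro; simp; tauto) (by intro; simp; tauto)
        (h5 d hd)⟩
      simp [formulaCheck, memCheck_iff, h3, h6, code]
  | @all n φ ih =>
    obtain ⟨l, l', h1, h2, h3⟩ := ih
    refine ⟨l, (n, code φ.all) :: l', h1, ?_, List.mem_cons_self⟩
    rw [List.forall_mem_cons]
    refine ⟨?_, fun d hd => formulaCheck_mono (by intro; simp) (by intro; simp; tauto) (h2 d hd)⟩
    simp [formulaCheck, memCheck_iff, h3, code]

theorem exists_certifies {k : ℕ} (ψ : Lor.Formula (Fin k)) : ∃ w, certifies k (code ψ) w = true := by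
  obtain ⟨l, l', h1, h2, h3⟩ := exists_formulaCheck ψ
  refine ⟨(l, l'), ?_⟩
  simp only [certifies, Bool.and_eq_true, List.all_eq_true, memCheck_iff]
  exact ⟨h1, h2, h3⟩

end Certificates

end OrderedRings

namespace OrderedRings

/-! ### The sentences expressing that the output of the algorithms is correct -/

section Sentences

def fTrue : ℕ := fNot fFalse
def fConj (l : List ℕ) : ℕ := l.foldr (fun φ ψ => fAnd φ ψ) fTrue

/-- The consecutive variables `o, o + 1, …, o + n - 1`. -/
def slice (o n : ℕ) : List ℕ := (List.range n).map fun i => o + i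

/-- The monomial with exponents `b` in the variables `o, o + 1, …, o + m - 1`. -/
def tMon (m o : ℕ) (b : List ℕ) : ℕ :=
  Nat.rec tOne (fun i r => tMul r (tPow (tVar (o + i)) (b.getD i 0))) m

def fComparison (m i j : ℕ) (d : ℕ × List ℕ × List ℕ) : ℕ :=
  fAnd (fImp (fLt (tMon m 0 d.2.1) (tMon m 0 d.2.2))
    (fLt (tMul (tPow (tVar j) d.1) (tMon m (j + 1) d.2.1))
      (tMul (tVar i) (tMon m (j + 1) d.2.2))))
    (fImp (fEq (tMon m 0 d.2.1) (tMon m 0 d.2.2))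
      (fEq (tMon m (j + 1) d.2.1) (tMon m (j + 1) d.2.2)))

/-- Domination of monomials, where the variables `0, …, m - 1` stand for `ρ`, the variable `i`
for `ε`, the variable `j` for `t` and the variables `j + 1, …, j + m` for `y`. -/
def fDom (m i j : ℕ) (T : List (ℕ × List ℕ × List ℕ)) : ℕ :=
  fAnd (fLt tOne (tVar j)) (fAnd (fLt tOne (tMul (tVar i) (tVar j)))
    (fAnd (fConj ((List.range m).map fun l => fLt tZero (tVar (j + 1 + l))))
      (fConj (T.map fun d => fComparison m i j d))))

/-- The variables `0, 1, …` satisfy the formulas in the list. -/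
def fRepr (χ : List ℕ) : ℕ :=
  fConj ((List.range χ.length).map fun i => fCall 1 (χ.getD i 0) [i])

/-- The formula `φ` at `x`, `t` and `y`, where `x` starts at `m` and `t`, `y` after `m + k`. -/
def fAt (k m φ : ℕ) : ℕ := fCall (k + (m + 1)) φ (slice m k ++ slice (m + k + 1) (m + 1))

/-- For some positive `ε`, the formula `φ` holds on all dominated points. -/
def fAlways (k m φ : ℕ) (T : List (ℕ × List ℕ × List ℕ)) : ℕ :=
  fEx (fAnd (fLt tZero (tVar (m + k)))
    (fAlls (m + 1) (fImp (fDom m (m + k) (m + k + 1) T) (fAt k m φ))))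

/-- `α` and `β` cover the space, `φ` is eventually true on `α` and eventually false on `β`. -/
def setsSentence (a : ℕ × ℕ × List ℕ) (T : List (ℕ × List ℕ × List ℕ)) (α β : ℕ) : ℕ :=
  fAlls a.2.2.length (fImp (fRepr a.2.2) (fAlls a.1 (fAnd
    (fImp (fCall a.1 α (slice a.2.2.length a.1)) (fAlways a.1 a.2.2.length a.2.1 T))
    (fAnd (fImp (fCall a.1 β (slice a.2.2.length a.1))
      (fAlways a.1 a.2.2.length (fNot a.2.1) T))
      (fOr (fCall a.1 α (slice a.2.2.length a.1)) (fCall a.1 β (slice a.2.2.length a.1)))))))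

/-- The variable `i` equals the quotient of the integer and the natural number in `q`. -/
def fRat (i : ℕ) (q : ℤ × ℕ) : ℕ :=
  if decide (Encodable.encode q.1 % 2 = 0) = true then
    fEq (tMul (tVar i) (tNum q.2)) (tNum (Encodable.encode q.1 / 2))
  else fEq (tAdd (tMul (tVar i) (tNum q.2)) (tNum (Encodable.encode q.1 / 2 + 1))) tZero

def fRats (k m : ℕ) (x : List (ℤ × ℕ)) : ℕ :=
  fConj ((List.range k).map fun i => fRat (m + i) (x.getD i (0, 0)))

/-- Layout of the variables: `ρ` at `0, …, m - 1`, then `x` of length `k`, `ε` at `m + k`, `t` at `m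
+ k + 1`, then `y`. Since `fDom` reads `t` and `y` from variables, the point `(N, ρ^N)` is
introduced by quantifying and equating. -/
def fStart (k m N : ℕ) (T : List (ℕ × List ℕ × List ℕ)) : ℕ :=
  fAlls (m + 1) (fImp (fEq (tVar (m + k + 1)) (tNum N)) (fImp
    (fConj ((List.range m).map fun i => fEq (tVar (m + k + 1 + 1 + i)) (tPow (tVar i) N)))
    (fDom m (m + k) (m + k + 1) T)))

/-- The next point occupies `m + 1` further variables after the current one, starting at `m + k + 1
+ 1 + m`. The first hypothesis is `N ≤ t`, written as the negation of `t < N`. -/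
def fStep (k m N : ℕ) (T : List (ℕ × List ℕ × List ℕ)) : ℕ :=
  fAlls (m + 1) (fAlls (m + 1) (fImp (fNot (fLt (tVar (m + k + 1)) (tNum N)))
    (fImp (fEq (tVar (m + k + 1 + 1 + m)) (tAdd (tVar (m + k + 1)) tOne))
      (fImp (fConj ((List.range m).map fun i => fEq (tVar (m + k + 1 + 1 + m + 1 + i))
          (tMul (tVar i) (tVar (m + k + 1 + 1 + i)))))
        (fImp (fDom m (m + k) (m + k + 1) T) (fDom m (m + k) (m + k + 1 + 1 + m) T))))))

/-- At `x`, the formula `φ` fails on all dominated points, the point with number `N` is dominated,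
and domination passes from every later point to the next. -/
def thresholdSentence (a : ℕ × ℕ × List ℕ) (x : List (ℤ × ℕ)) (T : List (ℕ × List ℕ × List ℕ))
    (N : ℕ) : ℕ :=
  fAlls a.2.2.length (fImp (fRepr a.2.2) (fAlls a.1 (fImp (fRats a.1 a.2.2.length x)
    (fEx (fAnd (fLt tZero (tVar (a.2.2.length + a.1)))
      (fAnd (fAlls (a.2.2.length + 1) (fImp
        (fDom a.2.2.length (a.2.2.length + a.1) (a.2.2.length + a.1 + 1) T)
        (fAt a.1 a.2.2.length (fNot a.2.1))))
        (fAnd (fStart a.1 a.2.2.length N T) (fStep a.1 a.2.2.length N T))))))))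

section Computability

variable {α : Type} [Primcodable α] {f g h i : α → ℕ} {l : α → List ℕ}
  {T : α → List (ℕ × List ℕ × List ℕ)}

@[fun_prop] theorem primrec_fConj (hl : Primrec l) : Primrec fun x => fConj (l x) :=
  primrec_foldr hl (primrec_const _) (by fun_prop)

@[fun_prop] theorem primrec_slice (hf : Primrec f) (hg : Primrec g) :
    Primrec fun x => slice (f x) (g x) := by unfold slice; fun_prop

@[fun_prop] theorem primrec_tMon (hf : Primrec f) (hg : Primrec g) (hl : Primrec l) :
    Primrec fun x => tMon (f x) (g x) (l x) :=
  primrec_rec hf (primrec_const _) (by fun_prop)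

@[fun_prop] theorem primrec_fComparison {d : α → ℕ × List ℕ × List ℕ} (hf : Primrec f)
    (hg : Primrec g) (hh : Primrec h) (hd : Primrec d) :
    Primrec fun x => fComparison (f x) (g x) (h x) (d x) := by unfold fComparison; fun_prop

@[fun_prop] theorem primrec_fDom (hf : Primrec f) (hg : Primrec g) (hh : Primrec h)
    (hT : Primrec T) : Primrec fun x => fDom (f x) (g x) (h x) (T x) := by unfold fDom; fun_prop

@[fun_prop] theorem primrec_fRepr (hl : Primrec l) : Primrec fun x => fRepr (l x) := by
  unfold fRepr; fun_prop

@[fun_prop] theorem primrec_fAt (hf : Primrec f) (hg : Primrec g) (hh : Primrec h) :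
    Primrec fun x => fAt (f x) (g x) (h x) := by unfold fAt; fun_prop

@[fun_prop] theorem primrec_fAlways (hf : Primrec f) (hg : Primrec g) (hh : Primrec h)
    (hT : Primrec T) : Primrec fun x => fAlways (f x) (g x) (h x) (T x) := by
  unfold fAlways; fun_prop

@[fun_prop] theorem primrec_setsSentence {a : α → ℕ × ℕ × List ℕ} (ha : Primrec a)
    (hT : Primrec T) (hf : Primrec f) (hg : Primrec g) :
    Primrec fun x => setsSentence (a x) (T x) (f x) (g x) := by unfold setsSentence; fun_prop

@[fun_prop] theorem primrec_fRat {q : α → ℤ × ℕ} (hf : Primrec f) (hq : Primrec q) :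
    Primrec fun x => fRat (f x) (q x) := by
  unfold fRat
  have h1 : Primrec fun x => Encodable.encode (q x).1 % 2 :=
    Primrec.nat_mod.comp (by fun_prop) (primrec_const 2)
  have h2 : Primrec fun x => Encodable.encode (q x).1 / 2 :=
    Primrec.nat_div.comp (by fun_prop) (primrec_const 2)
  fun_prop

@[fun_prop] theorem primrec_fRats {q : α → List (ℤ × ℕ)} (hf : Primrec f) (hg : Primrec g)
    (hq : Primrec q) : Primrec fun x => fRats (f x) (g x) (q x) := by unfold fRats; fun_prop

@[fun_prop] theorem primrec_fStart (hf : Primrec f) (hg : Primrec g) (hh : Primrec h)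
    (hT : Primrec T) : Primrec fun x => fStart (f x) (g x) (h x) (T x) := by
  unfold fStart; fun_prop

@[fun_prop] theorem primrec_fStep (hf : Primrec f) (hg : Primrec g) (hh : Primrec h)
    (hT : Primrec T) : Primrec fun x => fStep (f x) (g x) (h x) (T x) := by
  unfold fStep; fun_prop

@[fun_prop] theorem primrec_thresholdSentence {a : α → ℕ × ℕ × List ℕ} {q : α → List (ℤ × ℕ)}
    (ha : Primrec a) (hq : Primrec q) (hT : Primrec T) (hf : Primrec f) :
    Primrec fun x => thresholdSentence (a x) (q x) (T x) (f x) := by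
  unfold thresholdSentence; fun_prop

end Computability

section Values

variable {p : ℕ} {e : List ℝ}

@[simp] theorem sat_fTrue : sat fTrue p e := by simp [fTrue]

@[simp] theorem sat_fConj (l : List ℕ) : sat (fConj l) p e ↔ ∀ φ ∈ l, sat φ p e := by
  induction l with
  | nil => simp [fConj]
  | cons φ l ih =>
    have : fConj (φ :: l) = fAnd φ (fConj l) := rfl
    rw [this, sat_fAnd, ih, List.forall_mem_cons]

@[simp] theorem tval_tMon (m o : ℕ) (b : List ℕ) :
    tval p e (tMon m o b) = mon m (fun i => e.getD (o + i) 0) b := by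
  induction m with
  | zero => simp [tMon, mon]
  | succ m ih =>
    have : tMon (m + 1) o b = tMul (tMon m o b) (tPow (tVar (o + m)) (b.getD m 0)) := rfl
    rw [this, tval_tMul, ih, tval_tPow, tval_tVar, mon, mon, Finset.prod_range_succ]

theorem dominated_congr {m : ℕ} {ρ ρ' y y' : ℕ → ℝ} (hρ : ∀ i < m, ρ i = ρ' i)
    (hy : ∀ i < m, y i = y' i) (T : List (ℕ × List ℕ × List ℕ)) (ε t : ℝ) :
    Dominated m ρ T ε t y ↔ Dominated m ρ' T ε t y' := by
  have h : ∀ {y y' : ℕ → ℝ}, (∀ i < m, y i = y' i) → mon m y = mon m y' := by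
    intro y y' h
    funext b
    exact Finset.prod_congr rfl fun i hi => by rw [h i (Finset.mem_range.1 hi)]
  rw [Dominated, Dominated, h hρ, h hy]
  have : (∀ i < m, 0 < y i) ↔ ∀ i < m, 0 < y' i :=
    forall₂_congr fun i hi => by rw [hy i hi]
  rw [this]

theorem sat_fDom {m i j : ℕ} {T : List (ℕ × List ℕ × List ℕ)} {ε t : ℝ} {ρ y : ℕ → ℝ}
    (h1 : ∀ l < m, e.getD l 0 = ρ l) (h2 : e.getD i 0 = ε) (h3 : e.getD j 0 = t)
    (h4 : ∀ l < m, e.getD (j + 1 + l) 0 = y l) :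
    sat (fDom m i j T) p e ↔ Dominated m ρ T ε t y := by
  rw [← dominated_congr h1 h4, ← h2, ← h3]
  simp only [fDom, sat_fAnd, sat_fLt, tval_tOne, tval_tVar, tval_tMul, sat_fConj, List.mem_map,
    forall_exists_index, and_imp, forall_apply_eq_imp_iff₂, List.mem_range, tval_tZero,
    fComparison, sat_fImp, tval_tMon, tval_tPow, sat_fEq, zero_add, Dominated]

theorem getD_append_add {a b : List ℝ} {n : ℕ} (h : a.length = n) (i : ℕ) :
    (a ++ b).getD (n + i) 0 = b.getD i 0 := by
  rw [List.getD_append_right _ _ _ _ (by omega), h, Nat.add_sub_cancel_left]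

theorem map_slice {a b c : List ℝ} {o n : ℕ} (ha : a.length = o) (hb : b.length = n) :
    (slice o n).map (fun i => (a ++ (b ++ c)).getD i 0) = b := by
  rw [slice, List.map_map]
  refine List.ext_getElem (by simp [hb]) fun i h1 h2 => ?_
  simp only [List.getElem_map, List.getElem_range, Function.comp_apply]
  rw [getD_append_add ha, List.getD_append _ _ _ _ h2, List.getD_eq_getElem _ _ h2]

theorem forall_length_eq_succ {m : ℕ} {Q : List ℝ → Prop} :
    (∀ l : List ℝ, l.length = m + 1 → Q l) ↔
      ∀ (t : ℝ) (y : ℕ → ℝ), Q (t :: (List.range m).map y) := by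
  constructor
  · exact fun h t y => h _ (by simp)
  · intro h l hl
    cases l with
    | nil => simp at hl
    | cons t l =>
      have := h t fun i => l.getD i 0
      have h1 : (List.range m).map (fun i => l.getD i 0) = l := by
        refine List.ext_getElem (by simpa using hl.symm) fun i h1 h2 => ?_
        simp [h2]
      rwa [h1] at this

section Layout

variable {k m : ℕ} {r x : List ℝ} (ε t : ℝ) (y : ℕ → ℝ) (z : List ℝ)

theorem getD_layout_left {i : ℕ} (hr : r.length = m) (hi : i < m) (z : List ℝ) :
    (r ++ z).getD i 0 = r.getD i 0 := List.getD_append _ _ _ _ (by omega)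

theorem getD_layout (hr : r.length = m) (hx : x.length = k) (i : ℕ) :
    (r ++ (x ++ z)).getD (m + k + i) 0 = z.getD i 0 := by
  rw [add_assoc, getD_append_add hr, getD_append_add hx]

theorem getD_range_map_append {i : ℕ} (hi : i < m) :
    ((List.range m).map y ++ z).getD i 0 = y i := by
  rw [List.getD_append _ _ _ _ (by simpa using hi)]
  simp [hi]

theorem sat_fDom_layout (hr : r.length = m) (hx : x.length = k)
    {T : List (ℕ × List ℕ × List ℕ)} :
    sat (fDom m (m + k) (m + k + 1) T) p (r ++ (x ++ ε :: t :: ((List.range m).map y ++ z))) ↔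
      Dominated m (fun i => r.getD i 0) T ε t y := by
  refine sat_fDom (fun l hl => getD_layout_left hr hl _) ?_ ?_ fun l hl => ?_
  · exact getD_layout _ hr hx 0
  · exact getD_layout _ hr hx 1
  · rw [show m + k + 1 + 1 + l = m + k + (l + 2) by omega, getD_layout _ hr hx]
    exact getD_range_map_append _ _ hl

theorem sat_fDom_layout_next (hr : r.length = m) (hx : x.length = k) (t' : ℝ) (y' : ℕ → ℝ)
    {T : List (ℕ × List ℕ × List ℕ)} :
    sat (fDom m (m + k) (m + k + 1 + 1 + m) T) p
      (r ++ (x ++ ε :: t :: ((List.range m).map y ++ t' :: (List.range m).map y'))) ↔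
      Dominated m (fun i => r.getD i 0) T ε t' y' := by
  have hl' : ((List.range m).map y).length = m := by simp
  refine sat_fDom (fun l hl => getD_layout_left hr hl _) ?_ ?_ fun l hl => ?_
  · exact getD_layout _ hr hx 0
  · rw [show m + k + 1 + 1 + m = m + k + ((m + 0) + 2) by omega, getD_layout _ hr hx]
    exact getD_append_add hl' 0
  · rw [show m + k + 1 + 1 + m + 1 + l = m + k + ((m + (l + 1)) + 2) by omega,
      getD_layout _ hr hx]
    refine (getD_append_add hl' _).trans ?_
    simp [hl]

theorem sat_fAt {φ : ℕ} (hr : r.length = m) (hx : x.length = k) :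
    sat (fAt k m φ) p (r ++ (x ++ ε :: t :: (List.range m).map y)) ↔
      sat φ (k + (m + 1)) (x ++ t :: (List.range m).map y) := by
  have h1 := map_slice (a := r) (b := x) (c := ε :: t :: (List.range m).map y) hr hx
  have h2 := map_slice (a := r ++ (x ++ [ε])) (b := t :: (List.range m).map y) (c := [])
    (o := m + k + 1) (n := m + 1) (by simp [hr, hx, add_assoc]) (by simp)
  simp only [List.append_assoc, List.append_nil, List.cons_append, List.nil_append] at h2
  rw [fAt, sat_fCall, List.map_append, h1, h2]

theorem sat_fAlways {φ : ℕ} {T : List (ℕ × List ℕ × List ℕ)} (hr : r.length = m)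
    (hx : x.length = k) : sat (fAlways k m φ T) p (r ++ x) ↔ ∃ ε : ℝ, 0 < ε ∧ ∀ t y,
      Dominated m (fun i => r.getD i 0) T ε t y →
        sat φ (k + (m + 1)) (x ++ t :: (List.range m).map y) := by
  rw [fAlways, sat_fEx]
  refine exists_congr fun ε => ?_
  rw [sat_fAnd, sat_fLt, tval_tZero, tval_tVar, sat_fAlls, forall_length_eq_succ]
  simp only [List.append_assoc, List.cons_append, List.nil_append, sat_fImp, sat_fAt _ _ _ hr hx]
  refine and_congr ?_ (forall₂_congr fun t y => ?_)
  · rw [show (r ++ (x ++ [ε])).getD (m + k) 0 = ε from getD_layout [ε] hr hx 0]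
  · have := sat_fDom_layout (p := p) ε t y [] hr hx (T := T)
    rw [List.append_nil] at this
    rw [this]

theorem sat_fStart {N : ℕ} {T : List (ℕ × List ℕ × List ℕ)} (hr : r.length = m)
    (hx : x.length = k) : sat (fStart k m N T) p (r ++ (x ++ [ε])) ↔
      Dominated m (fun i => r.getD i 0) T ε N fun i => r.getD i 0 ^ N := by
  rw [fStart, sat_fAlls, forall_length_eq_succ]
  have hdom : ∀ t y, sat (fDom m (m + k) (m + k + 1) T) p
      (r ++ (x ++ ε :: t :: (List.range m).map y)) ↔
        Dominated m (fun i => r.getD i 0) T ε t y := by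
    intro t y
    have := sat_fDom_layout (p := p) ε t y [] hr hx (T := T)
    rwa [List.append_nil] at this
  have ht : ∀ t y, (r ++ (x ++ ε :: t :: (List.range m).map y)).getD (m + k + 1) 0 = t :=
    fun t y => getD_layout _ hr hx 1
  have hy : ∀ t y, ∀ i < m,
      (r ++ (x ++ ε :: t :: (List.range m).map y)).getD (m + k + 1 + 1 + i) 0 = y i := by
    intro t y i hi
    rw [show m + k + 1 + 1 + i = m + k + (i + 2) by omega, getD_layout _ hr hx]
    simp [hi]
  have hr' : ∀ z, ∀ i < m, (r ++ z).getD i 0 = r.getD i 0 := fun z i hi =>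
    getD_layout_left hr hi z
  simp only [List.append_assoc, List.cons_append, List.nil_append, sat_fImp, sat_fEq, tval_tVar,
    tval_tNum, sat_fConj, List.mem_map, List.mem_range, forall_exists_index, and_imp,
    forall_apply_eq_imp_iff₂, tval_tPow, ht, hdom]
  constructor
  · intro h
    refine h N (fun i => r.getD i 0 ^ N) rfl fun i hi => ?_
    rw [hy _ _ i hi, hr' _ i hi]
  · rintro h t y rfl h2
    refine (dominated_congr (fun _ _ => rfl) (fun i hi => ?_) T ε _).1 h
    exact ((hy _ y i hi).symm.trans ((h2 i hi).trans (by rw [hr' _ i hi]))).symm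

theorem sat_fStep {N : ℕ} {T : List (ℕ × List ℕ × List ℕ)} (hr : r.length = m)
    (hx : x.length = k) : sat (fStep k m N T) p (r ++ (x ++ [ε])) ↔
      ∀ (t : ℝ) (y : ℕ → ℝ), N ≤ t → Dominated m (fun i => r.getD i 0) T ε t y →
        Dominated m (fun i => r.getD i 0) T ε (t + 1) fun i => r.getD i 0 * y i := by
  rw [fStep, sat_fAlls, forall_length_eq_succ]
  simp only [sat_fAlls, forall_length_eq_succ]
  refine forall₂_congr fun t y => ?_
  have hl' : ((List.range m).map y).length = m := by simp
  have ht : ∀ z, (r ++ (x ++ ε :: t :: z)).getD (m + k + 1) 0 = t :=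
    fun z => getD_layout _ hr hx 1
  have hy : ∀ z, ∀ i < m,
      (r ++ (x ++ ε :: t :: ((List.range m).map y ++ z))).getD (m + k + 1 + 1 + i) 0 = y i := by
    intro z i hi
    rw [show m + k + 1 + 1 + i = m + k + (i + 2) by omega, getD_layout _ hr hx]
    exact getD_range_map_append y z hi
  have ht' : ∀ t' z, (r ++ (x ++ ε :: t :: ((List.range m).map y ++ t' :: z))).getD
      (m + k + 1 + 1 + m) 0 = t' := by
    intro t' z
    rw [show m + k + 1 + 1 + m = m + k + ((m + 0) + 2) by omega, getD_layout _ hr hx]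
    exact getD_append_add hl' 0
  have hy' : ∀ (t' : ℝ) (y' : ℕ → ℝ), ∀ i < m,
      (r ++ (x ++ ε :: t :: ((List.range m).map y ++ t' :: (List.range m).map y'))).getD
        (m + k + 1 + 1 + m + 1 + i) 0 = y' i := by
    intro t' y' i hi
    rw [show m + k + 1 + 1 + m + 1 + i = m + k + ((m + (i + 1)) + 2) by omega,
      getD_layout _ hr hx]
    refine (getD_append_add hl' _).trans ?_
    simp [hi]
  have hr' : ∀ z, ∀ i < m, (r ++ z).getD i 0 = r.getD i 0 := fun z i hi =>
    getD_layout_left hr hi z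
  simp only [List.append_assoc, List.cons_append, List.nil_append, sat_fImp, sat_fEq, sat_fNot,
    sat_fLt, tval_tVar, tval_tAdd, tval_tMul, tval_tOne, tval_tNum, sat_fConj, List.mem_map,
    List.mem_range, forall_exists_index, and_imp, forall_apply_eq_imp_iff₂, ht, ht',
    sat_fDom_layout _ _ _ _ hr hx, sat_fDom_layout_next _ _ _ hr hx, not_lt]
  constructor
  · intro h hN hD
    refine h (t + 1) (fun i => r.getD i 0 * y i) hN rfl (fun i hi => ?_) hD
    rw [hy' _ _ i hi, hr' _ i hi, hy _ i hi]
  · rintro h t' y' hN rfl h2 hD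
    refine (dominated_congr (fun _ _ => rfl) (fun i hi => ?_) T ε _).1 (h hN hD)
    exact ((hy' _ y' i hi).symm.trans
      ((h2 i hi).trans (by rw [hr' _ i hi, hy _ i hi]))).symm

/-- The encoding sends `n ≥ 0` to `2n` and `-(n + 1)` to `2n + 1`, so parity gives the sign. For
negative numerators the equation is rearranged to avoid subtraction. -/
theorem sat_fRat {i : ℕ} {q : ℤ × ℕ} : sat (fRat i q) p e ↔ e.getD i 0 * q.2 = q.1 := by
  obtain ⟨z, d⟩ := q
  rcases z with n | n
  · have h1 : Encodable.encode (Int.ofNat n) = 2 * n := rfl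
    simp only [fRat, h1]
    simp
  · have h1 : Encodable.encode (Int.negSucc n) = 2 * n + 1 := rfl
    have h2 : (2 * n + 1) % 2 = 1 := by omega
    have h3 : (2 * n + 1) / 2 = n := by omega
    simp only [fRat, h1, h2, h3]
    have h4 : ((Int.negSucc n : ℤ) : ℝ) = -((n + 1 : ℕ) : ℝ) := by simp [Int.negSucc_eq]
    simp only [h4, eq_neg_iff_add_eq_zero]
    simp

theorem sat_fRats (hr : r.length = m) {q : List (ℤ × ℕ)} : sat (fRats k m q) p (r ++ x) ↔
    ∀ i < k, x.getD i 0 * (q.getD i (0, 0)).2 = (q.getD i (0, 0)).1 := by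
  simp only [fRats, sat_fConj, List.mem_map, List.mem_range, forall_exists_index, and_imp,
    forall_apply_eq_imp_iff₂, sat_fRat, getD_append_add hr]

theorem sat_fRepr {χ : List ℕ} :
    sat (fRepr χ) p e ↔ ∀ i < χ.length, sat (χ.getD i 0) 1 [e.getD i 0] := by
  simp only [fRepr, sat_fConj, List.mem_map, List.mem_range, forall_exists_index, and_imp,
    forall_apply_eq_imp_iff₂, sat_fCall, List.map_cons, List.map_nil]

end Layout

/-- The list `r` is the only one whose entries satisfy the formulas coded by `χ`. -/
def IsSolution (χ : List ℕ) (r : List ℝ) : Prop :=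
  ∀ l : List ℝ, l.length = χ.length ∧ (∀ i < χ.length, sat (χ.getD i 0) 1 [l.getD i 0]) ↔ l = r

/-- The hypothesis `fRepr` has exactly one solution, so quantifying over all lists that satisfy it
amounts to inserting the parameters `r`. -/
theorem sat_setsSentence {a : ℕ × ℕ × List ℕ} {r : List ℝ} (hr : IsSolution a.2.2 r)
    {T : List (ℕ × List ℕ × List ℕ)} {α β : ℕ} :
    sat (setsSentence a T α β) 0 ([] : List ℝ) ↔ ∀ x : List ℝ, x.length = a.1 →
      (sat α a.1 x → ∃ ε : ℝ, 0 < ε ∧ ∀ t y,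
        Dominated a.2.2.length (fun i => r.getD i 0) T ε t y →
          sat a.2.1 (a.1 + (a.2.2.length + 1)) (x ++ t :: (List.range a.2.2.length).map y)) ∧
      (sat β a.1 x → ∃ ε : ℝ, 0 < ε ∧ ∀ t y,
        Dominated a.2.2.length (fun i => r.getD i 0) T ε t y →
          ¬ sat a.2.1 (a.1 + (a.2.2.length + 1)) (x ++ t :: (List.range a.2.2.length).map y)) ∧
      (sat α a.1 x ∨ sat β a.1 x) := by
  have hlen := ((hr r).2 rfl).1
  have hcall : ∀ (x : List ℝ) (φ : ℕ), x.length = a.1 →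
      (sat (fCall a.1 φ (slice a.2.2.length a.1)) 0 (r ++ x) ↔ sat φ a.1 x) := by
    intro x φ hx
    have := map_slice (c := []) hlen hx
    rw [List.append_nil] at this
    rw [sat_fCall, this]
  simp only [setsSentence, sat_fAlls, List.nil_append, sat_fImp, sat_fRepr]
  trans ∀ x : List ℝ, x.length = a.1 → sat (fAnd
    (fImp (fCall a.1 α (slice a.2.2.length a.1)) (fAlways a.1 a.2.2.length a.2.1 T))
    (fAnd (fImp (fCall a.1 β (slice a.2.2.length a.1))
      (fAlways a.1 a.2.2.length (fNot a.2.1) T))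
      (fOr (fCall a.1 α (slice a.2.2.length a.1)) (fCall a.1 β (slice a.2.2.length a.1)))))
      0 (r ++ x)
  · constructor
    · exact fun h => h r hlen ((hr r).2 rfl).2
    · intro h l h1 h2
      rw [(hr l).1 ⟨h1, h2⟩]
      exact h
  · refine forall₂_congr fun x hx => ?_
    simp only [sat_fAnd, sat_fImp, sat_fOr, hcall x _ hx, sat_fAlways hlen hx, sat_fNot]

theorem sat_thresholdSentence {a : ℕ × ℕ × List ℕ} {r : List ℝ} (hr : IsSolution a.2.2 r)
    {q : List (ℤ × ℕ)} {T : List (ℕ × List ℕ × List ℕ)} {N : ℕ} :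
    sat (thresholdSentence a q T N) 0 ([] : List ℝ) ↔ ∀ x : List ℝ, x.length = a.1 →
      (∀ i < a.1, x.getD i 0 * (q.getD i (0, 0)).2 = (q.getD i (0, 0)).1) →
      ∃ ε : ℝ, 0 < ε ∧ (∀ t y, Dominated a.2.2.length (fun i => r.getD i 0) T ε t y →
          ¬ sat a.2.1 (a.1 + (a.2.2.length + 1)) (x ++ t :: (List.range a.2.2.length).map y)) ∧
        Dominated a.2.2.length (fun i => r.getD i 0) T ε N (fun i => r.getD i 0 ^ N) ∧
        ∀ (t : ℝ) (y : ℕ → ℝ), N ≤ t → Dominated a.2.2.length (fun i => r.getD i 0) T ε t y →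
          Dominated a.2.2.length (fun i => r.getD i 0) T ε (t + 1) fun i => r.getD i 0 * y i := by
  have hlen := ((hr r).2 rfl).1
  simp only [thresholdSentence, sat_fAlls (K := ℝ) a.2.2.length, List.nil_append, sat_fImp,
    sat_fRepr]
  trans ∀ x : List ℝ, x.length = a.1 → sat (fImp (fRats a.1 a.2.2.length q)
    (fEx (fAnd (fLt tZero (tVar (a.2.2.length + a.1)))
      (fAnd (fAlls (a.2.2.length + 1) (fImp
        (fDom a.2.2.length (a.2.2.length + a.1) (a.2.2.length + a.1 + 1) T)
        (fAt a.1 a.2.2.length (fNot a.2.1))))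
        (fAnd (fStart a.1 a.2.2.length N T) (fStep a.1 a.2.2.length N T)))))) 0 (r ++ x)
  · constructor
    · exact fun h => (sat_fAlls _ _ _).1 (h r hlen ((hr r).2 rfl).2)
    · intro h l h1 h2
      rw [(hr l).1 ⟨h1, h2⟩]
      exact (sat_fAlls _ _ _).2 h
  · refine forall₂_congr fun x hx => ?_
    rw [sat_fImp, sat_fRats hlen, sat_fEx]
    refine imp_congr_right fun _ => exists_congr fun ε => ?_
    simp only [sat_fAnd, List.append_assoc, sat_fStart _ hlen hx, sat_fStep _ hlen hx, sat_fLt,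
      tval_tZero, tval_tVar, sat_fAlls, forall_length_eq_succ]
    refine and_congr ?_ (and_congr_left' (forall₂_congr fun t y => ?_))
    · rw [show (r ++ (x ++ [ε])).getD (a.2.2.length + a.1) 0 = ε from getD_layout [ε] hlen hx 0]
    · have := sat_fDom_layout (p := 0) ε t y [] hlen hx (T := T)
      rw [List.append_nil] at this
      simp only [List.cons_append, List.nil_append, sat_fImp, this, sat_fAt _ _ _ hlen hx,
        sat_fNot]

end Values

end Sentences

end OrderedRings

namespace OrderedRings

/-! ### Correctness of the sentences -/

section Correctness

open Filter

theorem Represents.sat_iff {χ : Lor.Formula (Fin 1)} {r : ℝ} (h : Represents χ r) (c : ℝ) :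
    sat (code χ) 1 [c] ↔ c = r := by
  have h1 := sat_code_formula χ fun _ => c
  simp only [List.ofFn_succ, List.ofFn_zero] at h1
  rw [h1]
  have h2 : (fun _ => c) ∈ definedSet χ ↔ (fun _ => c) ∈ ({fun _ => r} : Set (Fin 1 → ℝ)) := by
    rw [h]
  exact h2.trans ⟨fun h => congr_fun h 0, fun h => by rw [h]; rfl⟩

theorem isSolution_ofFn {m : ℕ} {χ : Fin m → Lor.Formula (Fin 1)} {ρ : Fin m → ℝ}
    (h : ∀ i, Represents (χ i) (ρ i)) :
    IsSolution (List.ofFn fun i => code (χ i)) (List.ofFn ρ) := by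
  intro l
  rw [List.length_ofFn]
  have key : ∀ i (hi : i < m), sat ((List.ofFn fun i => code (χ i)).getD i 0) 1 [l.getD i 0] ↔
      l.getD i 0 = ρ ⟨i, hi⟩ := by
    intro i hi
    rw [← (h ⟨i, hi⟩).sat_iff]
    simp [hi]
  constructor
  · rintro ⟨h1, h2⟩
    refine List.ext_getElem (by simpa using h1) fun i hi hi' => ?_
    have := (key i (by omega)).1 (h2 i (by omega))
    rw [List.getD_eq_getElem _ _ hi] at this
    simp [this]
  · rintro rfl
    refine ⟨by simp, fun i hi => (key i hi).2 ?_⟩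
    simp [hi]

theorem holdsAt_iff {k m : ℕ} (φ : Lor.Formula (Fin (k + (m + 1)))) (ρ : Fin m → ℝ)
    (x : Fin k → ℝ) (n : ℕ) : HoldsAt φ ρ x n ↔ sat (code φ) (k + (m + 1))
      (List.ofFn x ++ (n : ℝ) :: (List.range m).map fun i => (List.ofFn ρ).getD i 0 ^ n) := by
  rw [HoldsAt, ← sat_code_formula, List.ofFn_fin_append, List.ofFn_cons]
  have : List.ofFn (fun i => ρ i ^ n) =
      (List.range m).map fun i => (List.ofFn ρ).getD i 0 ^ n := by
    refine List.ext_getElem (by simp) fun i h1 h2 => ?_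
    have : i < m := by simpa using h1
    simp [this]
  rw [this]

theorem getD_ofFn_pos {m : ℕ} {ρ : Fin m → ℝ} (h : ∀ i, 0 < ρ i) :
    ∀ i < m, 0 < (List.ofFn ρ).getD i 0 := by
  intro i hi
  simpa [hi] using h ⟨i, hi⟩

/-- `α` says that some `ε` makes `φ` true on all dominated points, and `β` is its negation. By
`exists_dominated_const` the failure of `α` makes `φ` false on all dominated points for some `ε`. -/
theorem exists_sat_setsSentence {a : ℕ × ℕ × List ℕ} {r : List ℝ} (hr : IsSolution a.2.2 r) :
    ∃ (T : List (ℕ × List ℕ × List ℕ)) (α β : Lor.Formula (Fin a.1)),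
      sat (setsSentence a T (code α) (code β)) 0 ([] : List ℝ) := by
  obtain ⟨T, hT⟩ := exists_dominated_const a.2.1 a.1 a.2.2.length fun i => r.getD i 0
  have hlen := ((hr r).2 rfl).1
  -- Here `x` must be free and comes first, while `fAlways` expects `ρ` before `x`; the slices
  -- permute the two blocks. The parameters are quantified subject to their defining formulas.
  let c := fAlls a.2.2.length (fImp (fCall a.2.2.length (fRepr a.2.2) (slice a.1 a.2.2.length))
    (fCall (a.2.2.length + a.1) (fAlways a.1 a.2.2.length a.2.1 T)
      (slice a.1 a.2.2.length ++ slice 0 a.1)))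
  have hc : ∀ x : List ℝ, x.length = a.1 → (sat c a.1 x ↔ ∃ ε : ℝ, 0 < ε ∧ ∀ t y,
      Dominated a.2.2.length (fun i => r.getD i 0) T ε t y →
        sat a.2.1 (a.1 + (a.2.2.length + 1)) (x ++ t :: (List.range a.2.2.length).map y)) := by
    intro x hx
    rw [← sat_fAlways (p := a.2.2.length + a.1) hlen hx]
    simp only [c, sat_fAlls, sat_fImp]
    have h1 : ∀ l : List ℝ, l.length = a.2.2.length →
        (slice a.1 a.2.2.length).map (fun i => (x ++ l).getD i 0) = l := by
      intro l hl
      have := map_slice (c := []) hx hl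
      rwa [List.append_nil] at this
    have h2 : ∀ l : List ℝ, (slice 0 a.1).map (fun i => (x ++ l).getD i 0) = x := fun l =>
      map_slice (a := []) (o := 0) rfl hx
    constructor
    · intro h
      have := h r hlen
      rw [sat_fCall, h1 r hlen, sat_fCall, List.map_append, h1 r hlen, h2, sat_fRepr] at this
      exact this ((hr r).2 rfl).2
    · intro h l hl
      rw [sat_fCall, h1 l hl, sat_fCall, List.map_append, h1 l hl, h2, sat_fRepr]
      intro h3
      rw [(hr l).1 ⟨hl, h3⟩]
      exact h
  obtain ⟨α, hα⟩ := exists_formula_code c a.1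
  obtain ⟨β, hβ⟩ := exists_formula_code (fNot c) a.1
  refine ⟨T, α, β, (sat_setsSentence hr).2 fun x hx => ?_⟩
  rw [hα x hx, hβ x hx, sat_fNot]
  refine ⟨(hc x hx).1, fun hn => ?_, em _⟩
  obtain ⟨ε, hε, h | h⟩ := hT x hx
  · exact absurd ((hc x hx).2 ⟨ε, hε, h⟩) hn
  · exact ⟨ε, hε, h⟩

section Input

variable {k m : ℕ} {φ : Lor.Formula (Fin (k + (m + 1)))} {ρ : Fin m → ℝ}
  {χ : Fin m → Lor.Formula (Fin 1)} {T : List (ℕ × List ℕ × List ℕ)}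

theorem eventuallyTrue_disjoint : Disjoint (eventuallyTrue φ ρ) (eventuallyFalse φ ρ) := by
  rw [Set.disjoint_left]
  rintro x ⟨N, hN⟩ ⟨N', hN'⟩
  exact hN' _ (le_max_right N N') (hN _ (le_max_left N N'))

/-- Since `(n, ρ^n)` is eventually dominated, `α` and `β` define subsets of `A` and `B`. These are
disjoint while `α` and `β` cover the space, so both inclusions are equalities; part (a) follows as
well. -/
theorem of_sat_setsSentence {α β : Lor.Formula (Fin k)} (hρ : ∀ i, 0 < ρ i)
    (hχ : ∀ i, Represents (χ i) (ρ i))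
    (h : sat (setsSentence (input φ χ) T (code α) (code β)) 0 ([] : List ℝ)) :
    definedSet α = eventuallyTrue φ ρ ∧ definedSet β = eventuallyFalse φ ρ ∧
      eventuallyTrue φ ρ ∪ eventuallyFalse φ ρ = Set.univ := by
  have hmem : ∀ (ψ : Lor.Formula (Fin k)) (x : Fin k → ℝ),
      x ∈ definedSet ψ ↔ sat (code ψ) k (List.ofFn x) := fun ψ x => (sat_code_formula ψ x).symm
  have hS := (sat_setsSentence (a := input φ χ) (isSolution_ofFn hχ)).1 h
  simp only [input, List.length_ofFn] at hS
  have hev : ∀ {ε : ℝ}, 0 < ε → ∃ N : ℕ, ∀ n ≥ N,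
      Dominated m (fun i => (List.ofFn ρ).getD i 0) T ε n
        fun i => (List.ofFn ρ).getD i 0 ^ n := fun hε =>
    eventually_atTop.1 (eventually_dominated (getD_ofFn_pos hρ) T hε)
  have h1 : definedSet α ⊆ eventuallyTrue φ ρ := by
    intro x hx
    obtain ⟨ε, hε, h⟩ := (hS (List.ofFn x) (by simp)).1 ((hmem α x).1 hx)
    obtain ⟨N, hN⟩ := hev hε
    exact ⟨N, fun n hn => (holdsAt_iff φ ρ x n).2 (h _ _ (hN n hn))⟩
  have h2 : definedSet β ⊆ eventuallyFalse φ ρ := by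
    intro x hx
    obtain ⟨ε, hε, h⟩ := (hS (List.ofFn x) (by simp)).2.1 ((hmem β x).1 hx)
    obtain ⟨N, hN⟩ := hev hε
    exact ⟨N, fun n hn h' => h _ _ (hN n hn) ((holdsAt_iff φ ρ x n).1 h')⟩
  have h3 : ∀ x, x ∈ definedSet α ∨ x ∈ definedSet β := by
    intro x
    rw [hmem, hmem]
    exact (hS (List.ofFn x) (by simp)).2.2
  have hdis := Set.disjoint_left.1 (eventuallyTrue_disjoint (φ := φ) (ρ := ρ))
  refine ⟨h1.antisymm fun x hx => ?_, h2.antisymm fun x hx => ?_, Set.eq_univ_of_forall fun x => ?_⟩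
  · exact (h3 x).resolve_right fun h => hdis hx (h2 h)
  · exact (h3 x).resolve_left fun h => hdis (h1 h) hx
  · exact (h3 x).imp (fun h => h1 h) fun h => h2 h

theorem ratInput_iff {k : ℕ} (x : Fin k → ℚ) {l : List ℝ} (hl : l.length = k) :
    (∀ i < k, l.getD i 0 * ((ratInput x).getD i (0, 0)).2 = ((ratInput x).getD i (0, 0)).1) ↔
      l = List.ofFn fun i => (x i : ℝ) := by
  have key : ∀ i (hi : i < k), (l.getD i 0 * ((ratInput x).getD i (0, 0)).2 =
      ((ratInput x).getD i (0, 0)).1) ↔ l.getD i 0 = x ⟨i, hi⟩ := by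
    intro i hi
    have h1 : (ratInput x).getD i (0, 0) = ((x ⟨i, hi⟩).num, (x ⟨i, hi⟩).den) := by
      simp [ratInput, hi]
    have h2 : ((x ⟨i, hi⟩).den : ℝ) ≠ 0 := by exact_mod_cast (x ⟨i, hi⟩).den_nz
    rw [h1, Rat.cast_def (x ⟨i, hi⟩), eq_div_iff h2]
  constructor
  · intro h
    refine List.ext_getElem (by simpa using hl) fun i hi hi' => ?_
    have := (key i (by omega)).1 (h i (by omega))
    rw [List.getD_eq_getElem _ _ hi] at this
    simp [this]
  · rintro rfl i hi
    refine (key i hi).2 ?_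
    simp [hi]

/-- At an index past both `N₀` and `N₁` the point is dominated and `φ` fails, so on dominated points
`φ` is always false. `N` must be at least `N₁`, where domination begins, and `N₂`, from which it
propagates. -/
theorem exists_sat_thresholdSentence (hρ : ∀ i, 0 < ρ i) (hχ : ∀ i, Represents (χ i) (ρ i))
    {x : Fin k → ℚ} (hx : (fun i => (x i : ℝ)) ∈ eventuallyFalse φ ρ) :
    ∃ (T : List (ℕ × List ℕ × List ℕ)) (N : ℕ),
      sat (thresholdSentence (input φ χ) (ratInput x) T N) 0 ([] : List ℝ) := by
  have hpos := getD_ofFn_pos hρ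
  obtain ⟨T, hT⟩ := exists_dominated_const (code φ) k m fun i => (List.ofFn ρ).getD i 0
  obtain ⟨ε, hε, hc⟩ := hT (List.ofFn fun i => (x i : ℝ)) (by simp)
  obtain ⟨N₀, h0⟩ := hx
  obtain ⟨N₁, h1⟩ := eventually_atTop.1 (eventually_dominated hpos T hε)
  obtain ⟨N₂, h2⟩ := eventually_atTop.1 (eventually_dominated_succ hpos T)
  have hfalse := hc.resolve_left fun h => h0 _ (le_max_left N₀ N₁)
    ((holdsAt_iff φ ρ _ _).2 (h _ _ (h1 _ (le_max_right N₀ N₁))))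
  refine ⟨T, max N₁ ⌈N₂⌉₊, (sat_thresholdSentence (a := input φ χ) (isSolution_ofFn hχ)).2 ?_⟩
  simp only [input, List.length_ofFn]
  intro l hl hq
  rw [ratInput_iff x hl] at hq
  subst hq
  refine ⟨ε, hε, hfalse, h1 _ (le_max_left _ _), fun t y ht hD => h2 t ?_ ε y hε hD⟩
  refine (Nat.le_ceil N₂).trans (le_trans ?_ ht)
  exact_mod_cast le_max_right _ _

/-- Induction from `N`: the sentence gives domination at `(N, ρ^N)` and carries it from `(n, ρ^n)`
to `(n + 1, ρ^(n + 1))`. On dominated points `φ` fails. -/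
theorem of_sat_thresholdSentence (hχ : ∀ i, Represents (χ i) (ρ i)) {x : Fin k → ℚ} {N : ℕ}
    (h : sat (thresholdSentence (input φ χ) (ratInput x) T N) 0 ([] : List ℝ)) :
    ∀ n ≥ N, ¬ HoldsAt φ ρ (fun i => (x i : ℝ)) n := by
  have hS := (sat_thresholdSentence (a := input φ χ) (isSolution_ofFn hχ)).1 h
  simp only [input, List.length_ofFn] at hS
  obtain ⟨ε, -, h1, h2, h3⟩ := hS (List.ofFn fun i => (x i : ℝ)) (by simp)
    ((ratInput_iff x (by simp)).2 rfl)
  have hD : ∀ n ≥ N, Dominated m (fun i => (List.ofFn ρ).getD i 0) T ε n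
      fun i => (List.ofFn ρ).getD i 0 ^ n := by
    intro n hn
    induction n, hn using Nat.le_induction with
    | base => exact h2
    | succ n hn ih =>
      have := h3 n _ (by exact_mod_cast hn) ih
      simpa only [Nat.cast_succ, pow_succ'] using this
  intro n hn h'
  exact h1 _ _ (hD n hn) ((holdsAt_iff φ ρ _ n).1 h')

end Input

end Correctness

/-! ### Real algebraic numbers are definable -/

section Algebraic

open Polynomial

/-- Terms have no minus sign, so an integer polynomial is represented as a difference of two terms.
-/
theorem exists_tval_sub_eq (q : ℤ[X]) : ∃ s t : ℕ,
    ∀ c : ℝ, tval 1 [c] s - tval 1 [c] t = aeval c q := by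
  induction q using Polynomial.induction_on' with
  | add q r hq hr =>
    obtain ⟨s, t, h⟩ := hq
    obtain ⟨s', t', h'⟩ := hr
    refine ⟨tAdd s s', tAdd t t', fun c => ?_⟩
    rw [tval_tAdd, tval_tAdd, map_add, ← h, ← h']
    ring
  | monomial n a =>
    refine ⟨tMul (tNum a.toNat) (tPow (tVar 0) n), tMul (tNum (-a).toNat) (tPow (tVar 0) n),
      fun c => ?_⟩
    have h : ((a.toNat : ℤ) : ℝ) - (((-a).toNat : ℤ) : ℝ) = (a : ℝ) := by
      exact_mod_cast congrArg (Int.cast : ℤ → ℝ) (Int.toNat_sub_toNat_neg a)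
    rw [Int.cast_natCast, Int.cast_natCast] at h
    rw [aeval_monomial, eq_intCast, ← h]
    simp
    ring

/-- An annihilating polynomial has finitely many real roots, so a rational interval around `r`
excludes the others. Being a root inside that interval is expressed without parameters. -/
theorem exists_represents {r : ℝ} (hr : IsAlgebraic ℤ r) : ∃ χ, Represents χ r := by
  obtain ⟨P, hP, hPr⟩ := hr
  have hfin : (P.rootSet ℝ \ {r}).Finite := (P.rootSet_finite ℝ).subset Set.sdiff_subset
  obtain ⟨δ, hδ, hball⟩ := Metric.isOpen_iff.1 hfin.isClosed.isOpen_compl r (by simp)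
  obtain ⟨a, ha, ha'⟩ := exists_rat_btwn (sub_lt_self r hδ)
  obtain ⟨b, hb, hb'⟩ := exists_rat_btwn (lt_add_of_pos_right r hδ)
  obtain ⟨s, t, h⟩ := exists_tval_sub_eq P
  -- The rational bounds enter through the signs of the integer polynomials `den * X - num`.
  obtain ⟨s₁, t₁, h₁⟩ := exists_tval_sub_eq (C (a.den : ℤ) * X - C a.num)
  obtain ⟨s₂, t₂, h₂⟩ := exists_tval_sub_eq (C (b.den : ℤ) * X - C b.num)
  have hda : (0 : ℝ) < a.den := by exact_mod_cast a.den_pos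
  have hdb : (0 : ℝ) < b.den := by exact_mod_cast b.den_pos
  obtain ⟨χ, hχ⟩ := exists_formula (fAnd (fEq s t) (fAnd (fLt t₁ s₁) (fLt s₂ t₂))) 1 1
  refine ⟨χ, Set.ext fun v => ?_⟩
  have key : v ∈ definedSet χ ↔ aeval (v 0) P = 0 ∧ (a : ℝ) < v 0 ∧ v 0 < b := by
    refine (hχ v).trans ?_
    have hv : List.ofFn v = [v 0] := by simp
    rw [hv, sat_fAnd, sat_fAnd, sat_fEq, sat_fLt, sat_fLt, ← sub_eq_zero, h,
      ← sub_pos (b := tval 1 [v 0] t₁), h₁, ← sub_neg (b := tval 1 [v 0] t₂), h₂,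
      Rat.cast_def a, Rat.cast_def b, div_lt_iff₀ hda, lt_div_iff₀ hdb]
    simp [mul_comm]
  rw [key, Set.mem_singleton_iff]
  constructor
  · rintro ⟨h1, h2, h3⟩
    have : v 0 = r := by
      by_contra hne
      have hv : v 0 ∈ Metric.ball r δ := by
        rw [Metric.mem_ball, Real.dist_eq, abs_lt]
        constructor <;> linarith
      exact hball hv ⟨mem_rootSet.2 ⟨hP, h1⟩, hne⟩
    funext i
    rw [Subsingleton.elim i 0, this]
  · rintro rfl
    exact ⟨hPr, ha', hb⟩

end Algebraic

/-! ### The algorithms -/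

section Algorithms

/-- A certificate for the output `c.1.2` of the algorithm computing the sets. -/
def setsCheck (a : ℕ × ℕ × List ℕ)
    (c : (List (ℕ × List ℕ × List ℕ) × ℕ × ℕ) ×
      ((List (ℕ × ℕ) × List (ℕ × ℕ)) × List (ℕ × ℕ) × List (ℕ × ℕ)) × ℕ) : Bool :=
  certifies a.1 c.1.2.1 c.2.1.1 && (certifies a.1 c.1.2.2 c.2.1.2 &&
    refutes (setsSentence a c.1.1 c.1.2.1 c.1.2.2) c.2.2)

/-- A certificate for the output `c.2.1` of the algorithm computing thresholds. -/
def thresholdCheck (a : (ℕ × ℕ × List ℕ) × List (ℤ × ℕ))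
    (c : List (ℕ × List ℕ × List ℕ) × ℕ × ℕ) : Bool :=
  refutes (thresholdSentence a.1 a.2 c.1 c.2.1) c.2.2

/-- Unbounded search for a certificate. -/
def search {α γ σ : Type} [Encodable γ] (check : α → γ → Bool) (out : γ → σ) (a : α) : Part σ :=
  Nat.rfindOpt fun n => ((Encodable.decode n : Option γ).map fun c =>
    if check a c = true then some (out c) else none).getD none

theorem partrec_search {α γ σ : Type} [Primcodable α] [Primcodable γ] [Primcodable σ]
    {check : α → γ → Bool} {out : γ → σ} (hc : Primrec fun x : α × γ => check x.1 x.2)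
    (ho : Primrec out) : Partrec (search check out) := by
  refine Partrec.rfindOpt (Primrec.to_comp ?_)
  have h1 : Primrec fun x : (α × ℕ) × γ =>
      if check x.1.1 x.2 = true then some (out x.2) else none :=
    primrec_ite_bool (primrec_comp (f := fun y : α × γ => check y.1 y.2) hc
      (g := fun x : (α × ℕ) × γ => (x.1.1, x.2)) (by fun_prop)) (by fun_prop) (by fun_prop)
  have h2 : Primrec fun x : α × ℕ => (Encodable.decode x.2 : Option γ) := by fun_prop
  exact primrec_optionGetD (primrec_optionMap h2 h1) (primrec_const _)

/-- The search halts at some valid certificate, not necessarily the given one. Its users therefore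
rely on the soundness of every certificate. -/
theorem exists_mem_search {α γ σ : Type} [Encodable γ] {check : α → γ → Bool} {out : γ → σ}
    {a : α} (h : ∃ c, check a c = true) : ∃ c, check a c = true ∧ out c ∈ search check out a := by
  obtain ⟨c, hc⟩ := h
  have hdom : (search check out a).Dom := by
    refine Nat.rfindOpt_dom.2 ⟨Encodable.encode c, out c, ?_⟩
    rw [Encodable.encodek, Option.map_some, if_pos hc]
    rfl
  obtain ⟨n, hn⟩ := Nat.rfindOpt_spec (Part.get_mem hdom)
  rcases hd : (Encodable.decode n : Option γ) with _ | d
  · rw [hd] at hn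
    cases hn
  · rw [hd, Option.map_some, Option.getD_some] at hn
    by_cases hcd : check a d = true
    · rw [if_pos hcd, Option.mem_some_iff] at hn
      exact ⟨d, hcd, hn ▸ Part.get_mem hdom⟩
    · rw [if_neg hcd] at hn
      cases hn

theorem primrec_setsCheck : Primrec fun x : (ℕ × ℕ × List ℕ) ×
    ((List (ℕ × List ℕ × List ℕ) × ℕ × ℕ) ×
      ((List (ℕ × ℕ) × List (ℕ × ℕ)) × List (ℕ × ℕ) × List (ℕ × ℕ)) × ℕ) =>
    setsCheck x.1 x.2 := by
  unfold setsCheck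
  refine primrec_and (by fun_prop) (primrec_and (by fun_prop) ?_)
  exact primrec_comp (f := fun y : ℕ × ℕ => refutes y.1 y.2) primrec_refutes
    (g := fun x : (ℕ × ℕ × List ℕ) × ((List (ℕ × List ℕ × List ℕ) × ℕ × ℕ) ×
      ((List (ℕ × ℕ) × List (ℕ × ℕ)) × List (ℕ × ℕ) × List (ℕ × ℕ)) × ℕ) =>
      (setsSentence x.1 x.2.1.1 x.2.1.2.1 x.2.1.2.2, x.2.2.2)) (by fun_prop)

theorem primrec_thresholdCheck : Primrec fun x : ((ℕ × ℕ × List ℕ) × List (ℤ × ℕ)) ×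
    (List (ℕ × List ℕ × List ℕ) × ℕ × ℕ) => thresholdCheck x.1 x.2 := by
  unfold thresholdCheck
  exact primrec_comp (f := fun y : ℕ × ℕ => refutes y.1 y.2) primrec_refutes
    (g := fun x : ((ℕ × ℕ × List ℕ) × List (ℤ × ℕ)) × (List (ℕ × List ℕ × List ℕ) × ℕ × ℕ) =>
      (thresholdSentence x.1.1 x.1.2 x.2.1 x.2.2.1, x.2.2.2)) (by fun_prop)

end Algorithms

end OrderedRings

open OrderedRings in
theorem mainTheorem3 :
    -- (a), and the semialgebraicity in (b)
    (∀ (k m : ℕ), 0 < k → ∀ (φ : OrderedRings.Lor.Formula (Fin (k + (m + 1)))) (ρ : Fin m → ℝ),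
      (∀ i, 0 < ρ i ∧ IsAlgebraic ℤ (ρ i)) →
        OrderedRings.eventuallyTrue φ ρ ∪ OrderedRings.eventuallyFalse φ ρ = Set.univ ∧
        OrderedRings.IsSemialgebraic (OrderedRings.eventuallyTrue φ ρ) ∧
        OrderedRings.IsSemialgebraic (OrderedRings.eventuallyFalse φ ρ)) ∧
    -- (b): one algorithm computes, from `k`, `φ` and the `ρ_i`, formulas defining both sets
    (∃ F : ℕ × ℕ × List ℕ →. ℕ × ℕ, Partrec F ∧
      ∀ (k m : ℕ), 0 < k → ∀ (φ : OrderedRings.Lor.Formula (Fin (k + (m + 1)))) (ρ : Fin m → ℝ)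
        (χ : Fin m → OrderedRings.Lor.Formula (Fin 1)),
        (∀ i, 0 < ρ i ∧ IsAlgebraic ℤ (ρ i)) → (∀ i, OrderedRings.Represents (χ i) (ρ i)) →
        ∃ α β : OrderedRings.Lor.Formula (Fin k),
          (OrderedRings.code α, OrderedRings.code β) ∈ F (OrderedRings.input φ χ) ∧
          OrderedRings.definedSet α = OrderedRings.eventuallyTrue φ ρ ∧
          OrderedRings.definedSet β = OrderedRings.eventuallyFalse φ ρ) ∧
    -- (c): one algorithm computes a threshold for every rational point of the second set
    (∃ G : (ℕ × ℕ × List ℕ) × List (ℤ × ℕ) →. ℕ, Partrec G ∧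
      ∀ (k m : ℕ), 0 < k → ∀ (φ : OrderedRings.Lor.Formula (Fin (k + (m + 1)))) (ρ : Fin m → ℝ)
        (χ : Fin m → OrderedRings.Lor.Formula (Fin 1)),
        (∀ i, 0 < ρ i ∧ IsAlgebraic ℤ (ρ i)) → (∀ i, OrderedRings.Represents (χ i) (ρ i)) →
        ∀ x : Fin k → ℚ, (fun i => (x i : ℝ)) ∈ OrderedRings.eventuallyFalse φ ρ →
          ∃ N ∈ G (OrderedRings.input φ χ, OrderedRings.ratInput x),
            ∀ n ≥ N, ¬ OrderedRings.HoldsAt φ ρ (fun i => (x i : ℝ)) n) := by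
  refine ⟨?_, ⟨search setsCheck fun c => c.1.2, partrec_search primrec_setsCheck (by fun_prop), ?_⟩,
    ⟨search thresholdCheck fun c => c.2.1, partrec_search primrec_thresholdCheck (by fun_prop), ?_⟩⟩
  · intro k m _ φ ρ hρ
    choose χ hχ using fun i => exists_represents (hρ i).2
    obtain ⟨T, α, β, h⟩ := exists_sat_setsSentence (a := input φ χ) (isSolution_ofFn hχ)
    obtain ⟨h1, h2, h3⟩ := of_sat_setsSentence (fun i => (hρ i).1) hχ h
    exact ⟨h3, Set.empty_definable_iff.2 ⟨α, h1.symm⟩, Set.empty_definable_iff.2 ⟨β, h2.symm⟩⟩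
  · intro k m _ φ ρ χ hρ hχ
    obtain ⟨T, α, β, h⟩ := exists_sat_setsSentence (a := input φ χ) (isSolution_ofFn hχ)
    obtain ⟨s, hs⟩ := exists_refutes_of_sat h
    obtain ⟨w, hw⟩ := exists_certifies α
    obtain ⟨w', hw'⟩ := exists_certifies β
    -- The certificate found may contain other lists and other formulas than those constructed
    -- above. The checks alone show that its entries code formulas and that these define the two
    -- sets.
    obtain ⟨⟨⟨T', c, c'⟩, ⟨u, u'⟩, s'⟩, hc, hmem⟩ := exists_mem_search (check := setsCheck)
      (out := fun c => c.1.2) (a := input φ χ)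
      ⟨((T, code α, code β), (w, w'), s), by
        simp only [setsCheck, Bool.and_eq_true]
        exact ⟨hw, hw', hs⟩⟩
    simp only [setsCheck, Bool.and_eq_true] at hc
    obtain ⟨α', rfl⟩ := exists_code_of_certifies (k := k) hc.1
    obtain ⟨β', rfl⟩ := exists_code_of_certifies (k := k) hc.2.1
    obtain ⟨h1, h2, -⟩ := of_sat_setsSentence (fun i => (hρ i).1) hχ (sat_of_refutes hc.2.2)
    exact ⟨α', β', hmem, h1, h2⟩
  · intro k m _ φ ρ χ hρ hχ x hx
    obtain ⟨T, N, h⟩ := exists_sat_thresholdSentence (fun i => (hρ i).1) hχ hx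
    obtain ⟨s, hs⟩ := exists_refutes_of_sat h
    obtain ⟨⟨T', N', s'⟩, hc, hmem⟩ := exists_mem_search (check := thresholdCheck)
      (out := fun c => c.2.1) (a := (input φ χ, ratInput x)) ⟨(T, N, s), hs⟩
    exact ⟨N', hmem, of_sat_thresholdSentence hχ (sat_of_refutes hc)⟩
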